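/- Let $\Omega\subset\mathbb{R}^N$, $N\ge 1$, be a bounded domain, let $1<q<p$ and $\lambda<0$, and let $a\in C(\overline\Omega)$ change sign in $\Omega$. Put $\Omega_a^+=\{x\in\Omega: a(x)>0\}$, and let $X=W_0^{1,p}(\Omega)$ (Dirichlet case) or $X=W^{1,p}(\Omega)$ (Neumann case). For $u\in X$ define $$E_\lambda(u)=\int_\Omega\left(|\nabla u|^p-\lambda|u|^p\right),\qquad I_\lambda(u)=\int_\Omega\left(\tfrac1p|\nabla u|^p-\tfrac{\lambda}{p}|u|^p-\tfrac1q\,a(x)|u|^q\right).$$ A solution of $$(P_\lambda)\qquad -\Delta_p u=\lambda u^{p-1}+a(x)u^{q-1},\quad u\ge 0\ \text{ in }\Omega,$$ under the Dirichlet, respectively Neumann, homogeneous boundary condition, is a nonnegative $u\in X$ with $$\int_\Omega|\nabla u|^{p-2}\nabla u\cdot\nabla\varphi=\int_\Omega\left(\lambda u^{p-1}+a\,u^{q-1}\right)\varphi\qquad\text{for all }\varphi\in X,$$ that is, a nonnegative critical point of $I_\lambda$ on $X$. Functions in $X$ are identified when they agree a.e. in $\Omega$. Then, in both cases: 1. The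 infimum $$m_+=\inf\left\{E_\lambda(u): u\in X,\ \int_\Omega a|u|^q=1\right\}$$ is attained by exactly one nonnegative function $V_+$. 2. We have $m_+>0$, and the infimum of $I_\lambda$ over $\{u\in X:\int_\Omega a|u|^q>0\}$ is attained by exactly one nonnegative function, namely $U_+=m_+^{-1/(p-q)}V_+$. This $U_+$ is a solution of $(P_\lambda)$ that is positive in $\Omega_a^+$ (a.e. in $\Omega_a^+$, and, for its continuous representative, at every point of $\Omega_a^+$). It is the only such solution: every solution $u$ of $(P_\lambda)$ with $u>0$ a.e. in $\Omega_a^+$ coincides with $U_+$. -/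

import Mathlib

open MeasureTheory Set
open scoped ContDiff

noncomputable section

namespace SubhomPLap

/-- The Euclidean space `ℝ^N`. -/
abbrev Eucl (N : ℕ) := EuclideanSpace ℝ (Fin N)

variable {N : ℕ}

/-- Test functions: smooth functions with compact support contained in `Ω`. -/
def IsTestFunction (Ω : Set (Eucl N)) (φ : Eucl N → ℝ) : Prop :=
  ContDiff ℝ ∞ φ ∧ HasCompactSupport φ ∧ tsupport φ ⊆ Ω

/-- `g` is the weak (distributional) gradient of `u` in `Ω`:
`∫_Ω u ∇φ = - ∫_Ω φ g` for every test function `φ`. -/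
def IsWeakGradient (Ω : Set (Eucl N)) (u : Eucl N → ℝ) (g : Eucl N → Eucl N) : Prop :=
  ∀ φ : Eucl N → ℝ, IsTestFunction Ω φ →
    ∫ x in Ω, u x • gradient φ x = - ∫ x in Ω, φ x • g x

open Classical in
/-- A locally integrable weak gradient of `u` in `Ω` (it is unique up to null sets), and `0` if
there is none. -/
def weakGrad (Ω : Set (Eucl N)) (u : Eucl N → ℝ) : Eucl N → Eucl N :=
  if h : ∃ g : Eucl N → Eucl N, LocallyIntegrableOn g Ω volume ∧ IsWeakGradient Ω u g
  then h.choose else 0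

/-- The Sobolev space `W^{1,p}(Ω)`; functions are identified when they agree a.e. in `Ω`. -/
def W1p (Ω : Set (Eucl N)) (p : ℝ) : Set (Eucl N → ℝ) :=
  {u | MemLp u (ENNReal.ofReal p) (volume.restrict Ω) ∧
    ∃ g : Eucl N → Eucl N, MemLp g (ENNReal.ofReal p) (volume.restrict Ω) ∧ IsWeakGradient Ω u g}

/-- The Sobolev space `W_0^{1,p}(Ω)`: the closure of the test functions in `W^{1,p}(Ω)`. -/
def W01p (Ω : Set (Eucl N)) (p : ℝ) : Set (Eucl N → ℝ) :=
  {u | u ∈ W1p Ω p ∧ ∀ ε : ENNReal, 0 < ε → ∃ φ : Eucl N → ℝ, IsTestFunction Ω φ ∧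
    eLpNorm (fun x => u x - φ x) (ENNReal.ofReal p) (volume.restrict Ω) < ε ∧
    eLpNorm (fun x => weakGrad Ω u x - gradient φ x) (ENNReal.ofReal p) (volume.restrict Ω) < ε}

/-- The two homogeneous boundary conditions. -/
inductive BoundaryCondition
  | dirichlet
  | neumann

/-- The energy space `X`: `W_0^{1,p}(Ω)` for the Dirichlet problem and `W^{1,p}(Ω)` for the
Neumann problem. -/
def energySpace (B : BoundaryCondition) (Ω : Set (Eucl N)) (p : ℝ) : Set (Eucl N → ℝ) :=
  match B with
  | BoundaryCondition.dirichlet => W01p Ω p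
  | BoundaryCondition.neumann => W1p Ω p

/-- `E_lam(u) = ∫_Ω (|∇u|^p - lam |u|^p)`. -/
def energyE (Ω : Set (Eucl N)) (p lam : ℝ) (u : Eucl N → ℝ) : ℝ :=
  ∫ x in Ω, (‖weakGrad Ω u x‖ ^ p - lam * |u x| ^ p)

/-- `∫_Ω a |u|^q`. -/
def weightInt (Ω : Set (Eucl N)) (q : ℝ) (a u : Eucl N → ℝ) : ℝ :=
  ∫ x in Ω, a x * |u x| ^ q

/-- `I_lam(u) = ∫_Ω ((1/p) |∇u|^p - (lam/p) |u|^p - (1/q) a |u|^q)`. -/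
def energyI (Ω : Set (Eucl N)) (p q lam : ℝ) (a u : Eucl N → ℝ) : ℝ :=
  ∫ x in Ω, (1 / p * ‖weakGrad Ω u x‖ ^ p - lam / p * |u x| ^ p - 1 / q * (a x * |u x| ^ q))

/-- The constraint set `{u ∈ X : ∫_Ω a |u|^q = 1}`. -/
def Splus (B : BoundaryCondition) (Ω : Set (Eucl N)) (p q : ℝ) (a : Eucl N → ℝ) :
    Set (Eucl N → ℝ) :=
  {u | u ∈ energySpace B Ω p ∧ weightInt Ω q a u = 1}

/-- The set `{u ∈ X : ∫_Ω a |u|^q > 0}`. -/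
def Aplus (B : BoundaryCondition) (Ω : Set (Eucl N)) (p q : ℝ) (a : Eucl N → ℝ) :
    Set (Eucl N → ℝ) :=
  {u | u ∈ energySpace B Ω p ∧ 0 < weightInt Ω q a u}

/-- `m_+`, the infimum of `E_lam` over `Splus`. -/
def mPlus (B : BoundaryCondition) (Ω : Set (Eucl N)) (p q lam : ℝ) (a : Eucl N → ℝ) : ℝ :=
  sInf (energyE Ω p lam '' Splus B Ω p q a)

/-- `u ≥ 0` a.e. in `Ω`. -/
def NonnegIn (Ω : Set (Eucl N)) (u : Eucl N → ℝ) : Prop :=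
  ∀ᵐ x ∂(volume.restrict Ω), 0 ≤ u x

/-- `V` is a nonnegative function in `Splus` at which `inf_{Splus} E_lam` is attained. -/
def IsNonnegMinimizerE (B : BoundaryCondition) (Ω : Set (Eucl N)) (p q lam : ℝ)
    (a V : Eucl N → ℝ) : Prop :=
  NonnegIn Ω V ∧ V ∈ Splus B Ω p q a ∧ IsMinOn (energyE Ω p lam) (Splus B Ω p q a) V

/-- `U` is a nonnegative function in `Aplus` at which `inf_{Aplus} I_lam` is attained. -/
def IsNonnegMinimizerI (B : BoundaryCondition) (Ω : Set (Eucl N)) (p q lam : ℝ)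
    (a U : Eucl N → ℝ) : Prop :=
  NonnegIn Ω U ∧ U ∈ Aplus B Ω p q a ∧ IsMinOn (energyI Ω p q lam a) (Aplus B Ω p q a) U

/-- Weak solutions of `-Δ_p u = lam u^{p-1} + a u^{q-1}`, `u ≥ 0`, under the boundary condition `B`,
that is, nonnegative critical points of `I_lam` on `X`. -/
def IsSolution (B : BoundaryCondition) (Ω : Set (Eucl N)) (p q lam : ℝ)
    (a u : Eucl N → ℝ) : Prop :=
  u ∈ energySpace B Ω p ∧ NonnegIn Ω u ∧ ∀ φ ∈ energySpace B Ω p,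
    ∫ x in Ω, ‖weakGrad Ω u x‖ ^ (p - 2) * inner ℝ (weakGrad Ω u x) (weakGrad Ω φ x)
      = ∫ x in Ω, (lam * u x ^ (p - 1) + a x * u x ^ (q - 1)) * φ x

/-- `{x ∈ Ω : a(x) > 0}`. -/
def posSet (Ω : Set (Eucl N)) (a : Eucl N → ℝ) : Set (Eucl N) := {x | x ∈ Ω ∧ 0 < a x}

end SubhomPLap

end

noncomputable section

namespace SubhomPLap

open Filter Topology

/-! ### `L^p` norms as integrals of powers -/

section LpTools

variable {α E : Type*} [MeasurableSpace α] {μ : Measure α} [NormedAddCommGroup E]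

/-! Write `A(u) = ∫ a|u|^q`. The constraint is linear in `|u|^q`, and the energy is convex in the
same variable: for nonnegative `u`, `v` the mean `z = ((u^q + v^q)/2)^(1/q)` has `|∇z|^p ≤ (|∇u|^p +
|∇v|^p)/2` because `q ≤ p`, and `-lam ∫ z^p` is strictly convex in `u^q` because `-lam > 0` and `p/q
> 1`. Keeping the defect of strict convexity yields `midpoint_inequality`: up to the factor `-lam`,
the defect of a pair is at most the mean of the two energies minus `m_+`. Uniqueness of the
nonnegative minimizer is immediate (`InEnergySpace.ae_eq_of_minimizers`). Existence follows too,
with no compact embedding and so no regularity of the boundary: along a nonnegative minimizing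
sequence the defects tend to 0, uniform convexity makes the `q`-th powers Cauchy in `L^(p/q)`, hence
the functions Cauchy in `L^p`; a second convexity argument, with arithmetic midpoints, makes the
gradients Cauchy (`exists_minimizer_of_seq`).

The energy is `p`-homogeneous and `A` is `q`-homogeneous, so `I ≥ m_+ A^(p/q)/p - A/q`, which is
minimal at a single value of `A`. Minimizers of `I` are therefore the rescaled minimizers of the
energy (`InEnergySpace.ae_eq_rescaled`). As `A > 0` is an open condition along lines, such a
minimizer is a free critical point (`InEnergySpace.eulerLagrange`).

Positivity on `{a > 0}` comes from an explicit barrier and not from a regularity theory: since `q <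
p`, a small multiple of a radial bump in a ball where `a ≥ a₀ > 0` is a strict subsolution, and
comparing `I(U)` with `I(max U v)` forces `v ≤ U` (`InEnergySpace.exists_continuous_lower_bound`).

For uniqueness among solutions, a solution `u` is tested with a truncation of `U^q / (ε + u)^(q-1)`.
Picone's and Young's inequalities give `A(U) ≤ A(u)`
(`InEnergySpace.weightInt_le_weightInt_of_solution`). Solutions satisfy `I(u) = (1/p - 1/q) A(u)`
with a negative factor, so `u` also minimizes `I`, and uniqueness of the minimizer applies.

All competitors are produced by a chain rule for `C¹` functions of two Sobolev functions with
bounded derivatives; other nonlinearities are reached by approximation and closedness of the energy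
space. -/

lemma integral_norm_rpow_eq {r : ℝ} (hr : 0 < r) {f : α → E} (hf : MemLp f (ENNReal.ofReal r) μ) :
    ∫ x, ‖f x‖ ^ r ∂μ = (eLpNorm f (ENNReal.ofReal r) μ).toReal ^ r := by
  have h0 : ENNReal.ofReal r ≠ 0 := by simpa using hr
  rw [hf.eLpNorm_eq_integral_rpow_norm h0 ENNReal.ofReal_ne_top,
    ENNReal.toReal_ofReal hr.le, ENNReal.toReal_ofReal (by positivity), ← Real.rpow_mul
    (integral_nonneg fun x => by positivity), inv_mul_cancel₀ hr.ne', Real.rpow_one]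

lemma integrable_norm_rpow_real {r : ℝ} (hr : 0 < r) {f : α → E}
    (hf : MemLp f (ENNReal.ofReal r) μ) : Integrable (fun x => ‖f x‖ ^ r) μ := by
  have := hf.integrable_norm_rpow (by simpa using hr) ENNReal.ofReal_ne_top
  rwa [ENNReal.toReal_ofReal hr.le] at this

lemma tendsto_eLpNorm_zero_iff {ι : Type*} {l : Filter ι} {r : ℝ} (hr : 0 < r) {f : ι → α → E}
    (hf : ∀ i, MemLp (f i) (ENNReal.ofReal r) μ) :
    Tendsto (fun i => eLpNorm (f i) (ENNReal.ofReal r) μ) l (𝓝 0) ↔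
      Tendsto (fun i => ∫ x, ‖f i x‖ ^ r ∂μ) l (𝓝 0) := by
  simp_rw [fun i => integral_norm_rpow_eq hr (hf i)]
  rw [← ENNReal.tendsto_toReal_iff (fun i => (hf i).eLpNorm_ne_top) ENNReal.zero_ne_top]
  simp only [ENNReal.toReal_zero]
  constructor
  · intro h
    simpa [Real.zero_rpow hr.ne'] using h.rpow_const (p := r) (Or.inr hr.le)
  · intro h
    have := h.rpow_const (p := r⁻¹) (Or.inr (by positivity))
    simpa [Real.zero_rpow (inv_ne_zero hr.ne'), ← Real.rpow_mul, mul_inv_cancel₀ hr.ne'] using this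

lemma tendsto_integral_norm_rpow {ι : Type*} {l : Filter ι} {r : ℝ} (hr : 1 ≤ r)
    {f : ι → α → E} {g : α → E} (hf : ∀ i, MemLp (f i) (ENNReal.ofReal r) μ)
    (hg : MemLp g (ENNReal.ofReal r) μ)
    (h : Tendsto (fun i => eLpNorm (f i - g) (ENNReal.ofReal r) μ) l (𝓝 0)) :
    Tendsto (fun i => ∫ x, ‖f i x‖ ^ r ∂μ) l (𝓝 (∫ x, ‖g x‖ ^ r ∂μ)) := by
  have hr0 : 0 < r := by linarith
  have : Fact (1 ≤ ENNReal.ofReal r) := ⟨by simpa using hr⟩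
  have h1 := (Lp.tendsto_Lp_iff_tendsto_eLpNorm'' f hf g hg).2 h
  have h2 := h1.norm
  simp only [Lp.norm_toLp] at h2
  rw [integral_norm_rpow_eq hr0 hg]
  simp_rw [fun i => integral_norm_rpow_eq hr0 (hf i)]
  exact h2.rpow_const (Or.inr hr0.le)

lemma tendsto_eLpNorm_zero_of_dominated {r : ℝ} (hr : 0 < r) {f : ℕ → α → E} {G : α → ℝ}
    (hf : ∀ n, AEStronglyMeasurable (f n) μ) (hG : MemLp G (ENNReal.ofReal r) μ)
    (hb : ∀ n, ∀ᵐ x ∂μ, ‖f n x‖ ≤ G x) (h : ∀ᵐ x ∂μ, Tendsto (fun n => f n x) atTop (𝓝 0)) :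
    Tendsto (fun n => eLpNorm (f n) (ENNReal.ofReal r) μ) atTop (𝓝 0) := by
  have hm : ∀ n, MemLp (f n) (ENNReal.ofReal r) μ := fun n =>
    hG.of_le (hf n) ((hb n).mono fun x hx => hx.trans (le_abs_self _))
  rw [tendsto_eLpNorm_zero_iff hr hm]
  have : (0 : ℝ) = ∫ x, (0 : ℝ) ∂μ := by simp
  rw [this]
  refine tendsto_integral_of_dominated_convergence (fun x => ‖G x‖ ^ r)
    (fun n => (integrable_norm_rpow_real hr (hm n)).aestronglyMeasurable)
    (integrable_norm_rpow_real hr hG) (fun n => ?_) ?_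
  · filter_upwards [hb n] with x hx
    rw [Real.norm_of_nonneg (by positivity)]
    exact Real.rpow_le_rpow (norm_nonneg _) (hx.trans (le_abs_self _)) hr.le
  · filter_upwards [h] with x hx
    simpa [Real.zero_rpow hr.ne'] using hx.norm.rpow_const (p := r) (Or.inr hr.le)

/-- The Cauchy condition is put in terms of integrals along `atTop ×ˢ atTop`, the form in which
convexity defects of pairs deliver it; completeness of `Lp` does the rest. -/
lemma exists_limit_of_integral_cauchy [CompleteSpace E] {r : ℝ} (hr : 1 ≤ r) {f : ℕ → α → E}
    (hf : ∀ n, MemLp (f n) (ENNReal.ofReal r) μ)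
    (h : Tendsto (fun z : ℕ × ℕ => ∫ x, ‖f z.1 x - f z.2 x‖ ^ r ∂μ) (atTop ×ˢ atTop) (𝓝 0)) :
    ∃ g, MemLp g (ENNReal.ofReal r) μ ∧
      Tendsto (fun n => eLpNorm (f n - g) (ENNReal.ofReal r) μ) atTop (𝓝 0) := by
  have : Fact (1 ≤ ENNReal.ofReal r) := ⟨by simpa using hr⟩
  have h' := (tendsto_eLpNorm_zero_iff (by linarith) (fun z : ℕ × ℕ => (hf z.1).sub (hf z.2))).2 h
  have hc : CauchySeq (fun n => (hf n).toLp (f n)) := by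
    rw [EMetric.cauchySeq_iff]
    intro ε hε
    have h2 := h'.eventually (gt_mem_nhds hε)
    rw [prod_atTop_atTop_eq, eventually_atTop] at h2
    obtain ⟨⟨a, b⟩, hab⟩ := h2
    refine ⟨max a b, fun m hm n hn => ?_⟩
    rw [Lp.edist_toLp_toLp]
    exact hab (m, n) ⟨(le_max_left a b).trans hm, (le_max_right a b).trans hn⟩
  obtain ⟨g, hg⟩ := cauchySeq_tendsto_of_complete hc
  refine ⟨g, Lp.memLp g, ?_⟩
  rw [← Lp.tendsto_Lp_iff_tendsto_eLpNorm'' f hf g (Lp.memLp g)]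
  simpa using hg

end LpTools

/-! ### Midpoint defects and uniform convexity of `L^r` -/

section UniformConvexity

variable {E : Type*} [NormedAddCommGroup E] [NormedSpace ℝ E]

/-- The midpoint convexity defect of `‖·‖ ^ r`. -/
def midDefect (r : ℝ) (x y : E) : ℝ := (‖x‖ ^ r + ‖y‖ ^ r) / 2 - ‖(2⁻¹ : ℝ) • (x + y)‖ ^ r

lemma norm_midpoint_le (x y : E) : ‖(2⁻¹ : ℝ) • (x + y)‖ ≤ (‖x‖ + ‖y‖) / 2 := by
  rw [norm_smul]
  have := norm_add_le x y
  norm_num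
  linarith

lemma rpow_midpoint_le {r : ℝ} (hr : 1 ≤ r) {s t : ℝ} (hs : 0 ≤ s) (ht : 0 ≤ t) :
    ((s + t) / 2) ^ r ≤ (s ^ r + t ^ r) / 2 := by
  have := (convexOn_rpow hr).2 (mem_Ici.2 hs) (mem_Ici.2 ht)
    (by norm_num : (0 : ℝ) ≤ 1 / 2) (by norm_num : (0 : ℝ) ≤ 1 / 2) (by norm_num)
  simp only [smul_eq_mul] at this
  calc ((s + t) / 2) ^ r = (1 / 2 * s + 1 / 2 * t) ^ r := by ring_nf
    _ ≤ _ := this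
    _ = _ := by ring

lemma midDefect_nonneg {r : ℝ} (hr : 1 ≤ r) (x y : E) : 0 ≤ midDefect r x y := by
  have h1 : ‖(2⁻¹ : ℝ) • (x + y)‖ ^ r ≤ ((‖x‖ + ‖y‖) / 2) ^ r :=
    Real.rpow_le_rpow (norm_nonneg _) (norm_midpoint_le x y) (by linarith)
  have h2 := rpow_midpoint_le hr (norm_nonneg x) (norm_nonneg y)
  unfold midDefect
  linarith

/-- Strict convexity enters twice: that of `t ^ r` forces the norms to agree, and that of the space
then excludes distinct vectors of equal norm. -/
lemma eq_of_midDefect_nonpos [StrictConvexSpace ℝ E] {r : ℝ} (hr : 1 < r) {x y : E}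
    (h : midDefect r x y ≤ 0) : x = y := by
  have h1 : ‖(2⁻¹ : ℝ) • (x + y)‖ ^ r ≤ ((‖x‖ + ‖y‖) / 2) ^ r :=
    Real.rpow_le_rpow (norm_nonneg _) (norm_midpoint_le x y) (by linarith)
  have h2 := rpow_midpoint_le hr.le (norm_nonneg x) (norm_nonneg y)
  unfold midDefect at h
  have hn : ‖x‖ = ‖y‖ := by
    by_contra hne
    have := (strictConvexOn_rpow hr).2 (mem_Ici.2 (norm_nonneg x)) (mem_Ici.2 (norm_nonneg y)) hne
      (by norm_num : (0 : ℝ) < 1 / 2) (by norm_num : (0 : ℝ) < 1 / 2) (by norm_num)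
    simp only [smul_eq_mul] at this
    have h3 : (1 / 2 * ‖x‖ + 1 / 2 * ‖y‖) = (‖x‖ + ‖y‖) / 2 := by ring
    rw [h3] at this
    linarith
  by_contra hne
  have h3 : ‖(2⁻¹ : ℝ) • (x + y)‖ < ‖x‖ := by
    have := norm_combo_lt_of_ne (x := x) (y := y) (a := 2⁻¹) (b := 2⁻¹) le_rfl hn.ge hne
      (by norm_num) (by norm_num) (by norm_num)
    rwa [smul_add]
  have h4 := Real.rpow_lt_rpow (norm_nonneg _) h3 (by linarith : 0 < r)
  rw [← hn] at h
  linarith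

lemma continuous_midDefect {r : ℝ} (hr : 0 ≤ r) :
    Continuous fun z : E × E => midDefect r z.1 z.2 := by
  unfold midDefect
  have h (f : E × E → E) (hf : Continuous f) : Continuous fun z => ‖f z‖ ^ r :=
    hf.norm.rpow_const fun _ => Or.inr hr
  exact (((h _ continuous_fst).add (h _ continuous_snd)).div_const 2).sub
    (h _ (by fun_prop))

lemma midDefect_smul {r : ℝ} {c : ℝ} (hc : 0 ≤ c) (x y : E) :
    midDefect r (c • x) (c • y) = c ^ r * midDefect r x y := by
  have h (z : E) : ‖c • z‖ ^ r = c ^ r * ‖z‖ ^ r := by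
    rw [norm_smul, Real.norm_of_nonneg hc, Real.mul_rpow hc (norm_nonneg _)]
  unfold midDefect
  rw [← smul_add, smul_comm, h, h, h]
  ring

/-- Compactness replaces an explicit modulus of convexity. On the unit sphere of `E × E`, the pairs
whose `ε`-term does not exceed `‖x - y‖ ^ r` form a compact set free of diagonal pairs, so the
defect has a positive lower bound there. All terms scale with the same power `r`. -/
lemma norm_sub_rpow_le_midDefect [StrictConvexSpace ℝ E] [FiniteDimensional ℝ E] {r : ℝ}
    (hr : 1 < r) {ε : ℝ} (hε : 0 < ε) :
    ∃ C : ℝ, 0 ≤ C ∧ ∀ x y : E,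
      ‖x - y‖ ^ r ≤ ε * (‖x‖ ^ r + ‖y‖ ^ r) + C * midDefect r x y := by
  have hr0 : 0 < r := by linarith
  have hcn (f : E × E → E) (hf : Continuous f) : Continuous fun z => ‖f z‖ ^ r :=
    hf.norm.rpow_const fun _ => Or.inr hr0.le
  let K : Set (E × E) := {z | ‖z‖ = 1 ∧ ε * (‖z.1‖ ^ r + ‖z.2‖ ^ r) ≤ ‖z.1 - z.2‖ ^ r}
  have hK : IsCompact K := by
    have : K = Metric.sphere 0 1 ∩ {z | ε * (‖z.1‖ ^ r + ‖z.2‖ ^ r) ≤ ‖z.1 - z.2‖ ^ r} := by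
      ext z; simp [K]
    rw [this]
    refine (isCompact_sphere _ _).inter_right (isClosed_le ?_ (hcn _ (by fun_prop)))
    exact ((hcn _ continuous_fst).add (hcn _ continuous_snd)).const_mul ε
  have hpos : ∀ z ∈ K, 0 < midDefect r z.1 z.2 := by
    rintro ⟨x, y⟩ ⟨hz1, hz2⟩
    by_contra hcon
    have hxy := eq_of_midDefect_nonpos hr (not_lt.1 hcon)
    simp only at hxy hz2
    subst hxy
    simp only [sub_self, norm_zero, Real.zero_rpow hr0.ne'] at hz2
    have hx : 0 < ‖x‖ := by
      have : ‖x‖ = 1 := by simpa using hz1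
      linarith
    have : 0 < ‖x‖ ^ r := by positivity
    nlinarith
  obtain ⟨c, hc, hcK⟩ : ∃ c : ℝ, 0 < c ∧ ∀ z ∈ K, c ≤ midDefect r z.1 z.2 := by
    rcases K.eq_empty_or_nonempty with hK0 | hK0
    · exact ⟨1, one_pos, by simp [hK0]⟩
    · obtain ⟨z, hz, hmin⟩ := hK.exists_isMinOn hK0 (continuous_midDefect hr0.le).continuousOn
      exact ⟨_, hpos z hz, fun w hw => hmin hw⟩
  -- With `t` the sup norm of `(x, y)`, one has `‖x - y‖ ≤ 2 t`, and by homogeneity the defect is at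
  -- least `c t ^ r`; the constant is the quotient.
  refine ⟨2 ^ r / c, by positivity, fun x y => ?_⟩
  rcases eq_or_ne (x, y) 0 with h0 | h0
  · simp only [Prod.mk_eq_zero] at h0
    simp [h0.1, h0.2, midDefect, Real.zero_rpow hr0.ne']
  set t := ‖(x, y)‖ with ht
  have htp : 0 < t := norm_pos_iff.2 h0
  have hD := midDefect_nonneg hr.le x y
  by_cases hcase : ε * (‖x‖ ^ r + ‖y‖ ^ r) ≤ ‖x - y‖ ^ r
  · have hmem : (t⁻¹ • (x, y)) ∈ K := by
      constructor
      · rw [norm_smul, norm_inv, ← ht, Real.norm_of_nonneg htp.le, inv_mul_cancel₀ htp.ne']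
      · have h (z : E) : ‖t⁻¹ • z‖ ^ r = t⁻¹ ^ r * ‖z‖ ^ r := by
          rw [norm_smul, Real.norm_of_nonneg (by positivity),
            Real.mul_rpow (by positivity) (norm_nonneg _)]
        simp only [Prod.smul_mk]
        rw [← smul_sub, h, h, h]
        have : 0 ≤ t⁻¹ ^ r := by positivity
        nlinarith
    have h1 := hcK _ hmem
    simp only [Prod.smul_mk] at h1
    rw [midDefect_smul (by positivity)] at h1
    have h2 : c * t ^ r ≤ midDefect r x y := by
      have h3 : t⁻¹ ^ r * t ^ r = 1 := by
        rw [← Real.mul_rpow (by positivity) htp.le, inv_mul_cancel₀ htp.ne', Real.one_rpow]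
      have h4 : 0 < t ^ r := by positivity
      calc c * t ^ r ≤ (t⁻¹ ^ r * midDefect r x y) * t ^ r := by gcongr
        _ = midDefect r x y * (t⁻¹ ^ r * t ^ r) := by ring
        _ = _ := by rw [h3, mul_one]
    have h5 : ‖x - y‖ ≤ 2 * t := by
      have := norm_sub_le x y
      have hx : ‖x‖ ≤ t := by rw [ht]; exact norm_fst_le (x, y)
      have hy : ‖y‖ ≤ t := by rw [ht]; exact norm_snd_le (x, y)
      linarith
    have h6 : ‖x - y‖ ^ r ≤ 2 ^ r * t ^ r := by
      rw [← Real.mul_rpow (by norm_num) htp.le]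
      exact Real.rpow_le_rpow (norm_nonneg _) h5 hr0.le
    have h7 : 2 ^ r * t ^ r ≤ 2 ^ r / c * midDefect r x y := by
      rw [div_mul_eq_mul_div, le_div_iff₀ hc]
      have : (0 : ℝ) < 2 ^ r := by positivity
      nlinarith
    have : 0 ≤ ε * (‖x‖ ^ r + ‖y‖ ^ r) := by positivity
    linarith
  · have : 0 ≤ 2 ^ r / c * midDefect r x y := by positivity
    linarith

variable {α : Type*} [MeasurableSpace α] {μ : Measure α}

lemma MemLp.integrable_midDefect {r : ℝ} (hr : 1 ≤ r) {f g : α → E}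
    (hf : MemLp f (ENNReal.ofReal r) μ) (hg : MemLp g (ENNReal.ofReal r) μ) :
    Integrable (fun x => midDefect r (f x) (g x)) μ := by
  have hr0 : 0 < r := by linarith
  exact (((integrable_norm_rpow_real hr0 hf).add (integrable_norm_rpow_real hr0 hg)).div_const
    2).sub (integrable_norm_rpow_real hr0 ((hf.add hg).const_smul (2⁻¹ : ℝ)))

/-- Uniform convexity of `L^r` in sequential form: a bounded sequence whose pairwise defects vanish
is Cauchy. It is used for `q`-th powers of functions and again for gradients. -/
lemma tendsto_integral_norm_sub_of_midDefect [StrictConvexSpace ℝ E] [FiniteDimensional ℝ E]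
    {r : ℝ} (hr : 1 < r) {f : ℕ → α → E} (hf : ∀ n, MemLp (f n) (ENNReal.ofReal r) μ) {M : ℝ}
    (hM : ∀ n, ∫ x, ‖f n x‖ ^ r ∂μ ≤ M)
    (h : Tendsto (fun z : ℕ × ℕ => ∫ x, midDefect r (f z.1 x) (f z.2 x) ∂μ)
      (atTop ×ˢ atTop) (𝓝 0)) :
    Tendsto (fun z : ℕ × ℕ => ∫ x, ‖f z.1 x - f z.2 x‖ ^ r ∂μ) (atTop ×ˢ atTop) (𝓝 0) := by
  have hr0 : 0 < r := by linarith
  have hM0 : 0 ≤ M := (integral_nonneg fun x => by positivity).trans (hM 0)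
  rw [tendsto_order]
  refine ⟨fun a ha => Eventually.of_forall fun z =>
    ha.trans_le (integral_nonneg fun x => by positivity), fun η hη => ?_⟩
  -- Half of `η` is spent on `ε (M + M)`, half on `C` times the defect; the `+ 1` in both
  -- denominators makes each share strictly smaller than `η / 2`.
  set ε := η / (4 * (M + 1)) with hε
  have hεp : 0 < ε := by positivity
  obtain ⟨C, hC, hCle⟩ := norm_sub_rpow_le_midDefect (E := E) hr hεp
  have h2 := h.eventually (gt_mem_nhds (show 0 < η / (2 * (C + 1)) by positivity))
  filter_upwards [h2] with z hz
  have hi := MemLp.integrable_midDefect hr.le (hf z.1) (hf z.2)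
  have hi1 := integrable_norm_rpow_real hr0 (hf z.1)
  have hi2 := integrable_norm_rpow_real hr0 (hf z.2)
  calc ∫ x, ‖f z.1 x - f z.2 x‖ ^ r ∂μ
      ≤ ∫ x, (ε * (‖f z.1 x‖ ^ r + ‖f z.2 x‖ ^ r) + C * midDefect r (f z.1 x) (f z.2 x)) ∂μ :=
        integral_mono (integrable_norm_rpow_real hr0 ((hf z.1).sub (hf z.2)))
          (((hi1.add hi2).const_mul ε).add (hi.const_mul C)) fun x => hCle _ _
    _ = ε * (∫ x, ‖f z.1 x‖ ^ r ∂μ + ∫ x, ‖f z.2 x‖ ^ r ∂μ)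
        + C * ∫ x, midDefect r (f z.1 x) (f z.2 x) ∂μ := by
        have h12 : Integrable (fun x => ‖f z.1 x‖ ^ r + ‖f z.2 x‖ ^ r) μ := hi1.add hi2
        rw [integral_add (h12.const_mul ε) (hi.const_mul C), integral_const_mul,
          integral_const_mul, integral_add hi1 hi2]
    _ ≤ ε * (M + M) + C * (η / (2 * (C + 1))) := by
        gcongr
        · exact hM _
        · exact hM _
    _ < η := by
        have e1 : ε * (M + M) = η / 2 * (M / (M + 1)) := by rw [hε]; field_simp; ring
        have e2 : C * (η / (2 * (C + 1))) = η / 2 * (C / (C + 1)) := by field_simp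
        have e3 : M / (M + 1) < 1 := by rw [div_lt_one (by linarith)]; linarith
        have e4 : C / (C + 1) < 1 := by rw [div_lt_one (by linarith)]; linarith
        rw [e1, e2]
        nlinarith

end UniformConvexity

/-! ### First variation of integrals of powers -/

section FirstVariation

variable {α E : Type*} [MeasurableSpace α] {μ : Measure α} [NormedAddCommGroup E]
  [InnerProductSpace ℝ E]

lemma hasDerivAt_norm_rpow_line {r : ℝ} (hr : 1 < r) (x y : E) (t : ℝ) :
    HasDerivAt (fun t : ℝ => ‖x + t • y‖ ^ r)
      (r * ‖x + t • y‖ ^ (r - 2) * inner ℝ (x + t • y) y) t := by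
  have h1 : HasDerivAt (fun t : ℝ => x + t • y) y t := by
    simpa using ((hasDerivAt_id t).smul_const y).const_add x
  have := (hasFDerivAt_norm_rpow (x + t • y) hr).comp_hasDerivAt t h1
  simp only [smul_apply, innerSL_apply_apply, smul_eq_mul] at this
  exact this

lemma abs_rpow_sub_two_mul_inner_le {r : ℝ} (x y : E) :
    |‖x‖ ^ (r - 2) * inner ℝ x y| ≤ ‖x‖ ^ (r - 1) * ‖y‖ := by
  rw [abs_mul, abs_of_nonneg (by positivity)]
  -- The exponent `r - 2` may be negative, so exponents add only for `x ≠ 0`; at `x = 0` the inner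
  -- product vanishes.
  rcases eq_or_ne x 0 with h | h
  · simp only [h, inner_zero_left, abs_zero, mul_zero, norm_zero]
    positivity
  · have hx : 0 < ‖x‖ := norm_pos_iff.2 h
    calc ‖x‖ ^ (r - 2) * |inner ℝ x y| ≤ ‖x‖ ^ (r - 2) * (‖x‖ * ‖y‖) := by
          gcongr; exact abs_real_inner_le_norm x y
      _ = (‖x‖ ^ (r - 2) * ‖x‖ ^ (1 : ℝ)) * ‖y‖ := by rw [Real.rpow_one]; ring
      _ = _ := by rw [← Real.rpow_add hx]; ring_nf

lemma rpow_mul_le_add {r : ℝ} (hr : 1 < r) {s t : ℝ} (hs : 0 ≤ s) (ht : 0 ≤ t) :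
    s ^ (r - 1) * t ≤ s ^ r + t ^ r := by
  have hr0 : 0 < r := by linarith
  rcases le_total s t with h | h
  · calc s ^ (r - 1) * t ≤ t ^ (r - 1) * t := by gcongr
      _ = t ^ r := by
        rcases ht.eq_or_lt with h0 | h0
        · rw [← h0, Real.zero_rpow hr0.ne', mul_zero]
        · rw [Real.rpow_sub_one h0.ne', div_mul_cancel₀ _ h0.ne']
      _ ≤ _ := le_add_of_nonneg_left (by positivity)
  · calc s ^ (r - 1) * t ≤ s ^ (r - 1) * s := by gcongr
      _ = s ^ r := by
        rcases hs.eq_or_lt with h0 | h0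
        · rw [← h0, Real.zero_rpow hr0.ne', mul_zero]
        · rw [Real.rpow_sub_one h0.ne', div_mul_cancel₀ _ h0.ne']
      _ ≤ _ := le_add_of_nonneg_right (by positivity)

/-- The bounded weight `b` lets one statement serve all three terms of `I`: gradients and functions
with `b = 1` and exponent `p`, and the term with weight `a` and exponent `q`. Differentiation under
the integral is dominated by a multiple of `(‖u‖ + ‖v‖) ^ r` for `|t| < 1`. -/
lemma hasDerivAt_integral_norm_rpow {r : ℝ} (hr : 1 < r) {b : α → ℝ} {M : ℝ}
    (hb : AEStronglyMeasurable b μ) (hbM : ∀ᵐ x ∂μ, |b x| ≤ M) {u v : α → E}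
    (hu : MemLp u (ENNReal.ofReal r) μ) (hv : MemLp v (ENNReal.ofReal r) μ) :
    HasDerivAt (fun t : ℝ => ∫ x, b x * ‖u x + t • v x‖ ^ r ∂μ)
      (∫ x, b x * (r * ‖u x‖ ^ (r - 2) * inner ℝ (u x) (v x)) ∂μ) 0 := by
  have hr0 : 0 < r := by linarith
  have hint (t : ℝ) : Integrable (fun x => b x * ‖u x + t • v x‖ ^ r) μ :=
    (integrable_norm_rpow_real hr0 (hu.add (hv.const_smul t))).bdd_mul hb hbM
  have hw : MemLp (fun x => ‖u x‖ + ‖v x‖) (ENNReal.ofReal r) μ := hu.norm.add hv.norm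
  have hmeas : AEStronglyMeasurable
      (fun x => b x * (r * ‖u x + (0:ℝ) • v x‖ ^ (r - 2) * inner ℝ (u x + (0:ℝ) • v x) (v x))) μ := by
    have h1 := hu.aestronglyMeasurable
    have h2 := hv.aestronglyMeasurable
    have h3 : AEStronglyMeasurable (fun x => ‖u x‖ ^ (r - 2)) μ :=
      (h1.norm.aemeasurable.pow_const (r - 2)).aestronglyMeasurable
    simp only [zero_smul, add_zero]
    exact hb.mul ((h3.const_mul r).mul (h1.inner h2))
  have key := hasDerivAt_integral_of_dominated_loc_of_deriv_le (μ := μ) (𝕜 := ℝ)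
    (F := fun t x => b x * ‖u x + t • v x‖ ^ r)
    (F' := fun t x => b x * (r * ‖u x + t • v x‖ ^ (r - 2) * inner ℝ (u x + t • v x) (v x)))
    (x₀ := (0 : ℝ)) (s := Metric.ball 0 1)
    (bound := fun x => M * (r * (2 * ‖‖u x‖ + ‖v x‖‖ ^ r)))
    (Metric.ball_mem_nhds _ one_pos)
    (Eventually.of_forall fun t => (hint t).aestronglyMeasurable) (hint 0) hmeas ?_
    (((integrable_norm_rpow_real hr0 hw).const_mul 2 |>.const_mul r).const_mul M) ?_
  · simpa using key.2
  · filter_upwards [hbM] with x hx t ht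
    have ht1 : |t| ≤ 1 := by simpa using (mem_ball_zero_iff.1 ht).le
    have hM0 : 0 ≤ M := (abs_nonneg _).trans hx
    rw [norm_mul, Real.norm_eq_abs, Real.norm_eq_abs, mul_assoc r, abs_mul, abs_of_pos hr0]
    have h1 : ‖u x + t • v x‖ ≤ ‖u x‖ + ‖v x‖ := by
      refine (norm_add_le _ _).trans ?_
      rw [norm_smul, Real.norm_eq_abs]
      nlinarith [norm_nonneg (v x)]
    gcongr
    calc |‖u x + t • v x‖ ^ (r - 2) * inner ℝ (u x + t • v x) (v x)|
        ≤ ‖u x + t • v x‖ ^ (r - 1) * ‖v x‖ := abs_rpow_sub_two_mul_inner_le _ _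
      _ ≤ ‖u x + t • v x‖ ^ r + ‖v x‖ ^ r := rpow_mul_le_add hr (norm_nonneg _) (norm_nonneg _)
      _ ≤ (‖u x‖ + ‖v x‖) ^ r + (‖u x‖ + ‖v x‖) ^ r := by
          gcongr
          linarith [norm_nonneg (u x)]
      _ = 2 * ‖‖u x‖ + ‖v x‖‖ ^ r := by rw [Real.norm_of_nonneg (by positivity)]; ring
  · exact Eventually.of_forall fun x t _ => (hasDerivAt_norm_rpow_line hr _ _ t).const_mul _

/-- The norm power is convex along the segment from `x` to `y`, so its derivative at the start is at
most the slope. Both the barrier comparison and the Picone inequality rest on this tangent bound. -/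
lemma norm_rpow_convex_ineq {r : ℝ} (hr : 1 < r) (x y : E) :
    ‖x‖ ^ r + r * (‖x‖ ^ (r - 2) * inner ℝ x (y - x)) ≤ ‖y‖ ^ r := by
  have hconv : ConvexOn ℝ univ (fun t : ℝ => ‖x + t • (y - x)‖ ^ r) := by
    refine ⟨convex_univ, fun s _ t _ a b ha hb hab => ?_⟩
    have e : x + (a • s + b • t) • (y - x) = a • (x + s • (y - x)) + b • (x + t • (y - x)) := by
      have : x = (a + b) • x := by rw [hab, one_smul]
      nth_rewrite 1 [this]
      simp only [smul_eq_mul]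
      module
    simp only [smul_eq_mul]
    have h1 : ‖x + (a • s + b • t) • (y - x)‖ ≤ a * ‖x + s • (y - x)‖ + b * ‖x + t • (y - x)‖ := by
      rw [e]
      refine (norm_add_le _ _).trans_eq ?_
      rw [norm_smul, norm_smul, Real.norm_of_nonneg ha, Real.norm_of_nonneg hb]
    refine (Real.rpow_le_rpow (norm_nonneg _) h1 (by linarith)).trans ?_
    exact (convexOn_rpow hr.le).2 (mem_Ici.2 (norm_nonneg _)) (mem_Ici.2 (norm_nonneg _)) ha hb hab
  have hd := hasDerivAt_norm_rpow_line hr x (y - x) 0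
  have := hconv.deriv_le_slope (mem_univ 0) (mem_univ 1) one_pos hd.differentiableAt
  rw [hd.deriv, slope_def_field] at this
  simp only [zero_smul, add_zero, one_smul, add_sub_cancel, sub_zero, div_one] at this
  linarith

end FirstVariation

/-! ### Mollification and approximation by test functions -/

section

open scoped Convolution NNReal ENNReal

section Mollification

variable {N : ℕ} {F : Type*} [NormedAddCommGroup F]

lemma tendsto_eLpNorm_translate_sub {p : ℝ≥0∞} (hp : 1 ≤ p) (hp' : p ≠ ⊤) {f : Eucl N → F}
    (hf : MemLp f p volume) :
    Tendsto (fun t : Eucl N => eLpNorm (fun x => f (x - t) - f x) p volume) (𝓝 0) (𝓝 0) := by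
  have : Fact (1 ≤ p) := ⟨hp⟩
  let c : C(Eucl N × Eucl N, Eucl N) := ⟨fun z => z.2 - z.1, by fun_prop⟩
  have hg : Tendsto (fun t => c.curry t) (𝓝 0) (𝓝 (c.curry 0)) := c.curry.continuous.tendsto 0
  have hm : ∀ t, MeasurePreserving (c.curry t) (volume : Measure (Eucl N)) volume := fun t =>
    measurePreserving_sub_right volume t
  have h := Filter.Tendsto.compMeasurePreservingLp (tendsto_const_nhds (x := hf.toLp f)) hg hm
    (hm 0) hp'
  simp only [Lp.toLp_compMeasurePreserving] at h
  rw [Lp.tendsto_Lp_iff_tendsto_eLpNorm''] at h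
  refine h.congr fun t => ?_
  congr 1
  ext x
  simp [c]

variable [NormedSpace ℝ F] [CompleteSpace F]

/-- The normalized bump is the density of a probability measure `ν`, so the mollification error is a
`ν`-average of translation errors. Jensen's inequality in `t` followed by Tonelli bounds its norm by
the largest translation error over the support. -/
lemma eLpNorm_mollify_sub_le {r : ℝ} (hr : 1 ≤ r) (φ : ContDiffBump (0 : Eucl N)) {f : Eucl N → F}
    (hf : MemLp f (ENNReal.ofReal r) volume) {η : ℝ≥0∞}
    (h : ∀ t ∈ Metric.ball (0 : Eucl N) φ.rOut,
      eLpNorm (fun x => f (x - t) - f x) (ENNReal.ofReal r) volume ≤ η) :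
    eLpNorm (fun x => (∫ t, φ.normed volume t • f (x - t)) - f x) (ENNReal.ofReal r) volume
      ≤ η := by
  have hr0 : 0 < r := by linarith
  set ρ : Eucl N → ℝ≥0 := fun t => (φ.normed volume t).toNNReal with hρ
  have hρm : Measurable ρ := φ.continuous_normed.measurable.real_toNNReal
  set ν : Measure (Eucl N) := volume.withDensity (fun t => (ρ t : ℝ≥0∞)) with hν
  have hρs (t : Eucl N) (y : F) : ρ t • y = φ.normed volume t • y := by
    rw [NNReal.smul_def, hρ, Real.coe_toNNReal _ (φ.nonneg_normed t)]
  have hprob : IsProbabilityMeasure ν := by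
    constructor
    rw [hν, withDensity_apply _ MeasurableSet.univ, Measure.restrict_univ]
    have := ofReal_integral_eq_lintegral_ofReal (φ.integrable_normed (μ := volume))
      (Eventually.of_forall φ.nonneg_normed)
    rw [φ.integral_normed, ENNReal.ofReal_one] at this
    exact this.symm
  have hac : ν ≪ volume := withDensity_absolutelyContinuous _ _
  have hloc : LocallyIntegrable f volume := hf.locallyIntegrable (by simpa using hr)
  have hI (x : Eucl N) : Integrable (fun t => f (x - t)) ν := by
    rw [hν, integrable_withDensity_iff_integrable_smul hρm]
    simp_rw [hρs]
    exact (φ.hasCompactSupport_normed.convolutionExists_left (ContinuousLinearMap.lsmul ℝ ℝ)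
      φ.continuous_normed hloc) x
  have hrep (x : Eucl N) : (∫ t, φ.normed volume t • f (x - t)) - f x
      = ∫ t, (f (x - t) - f x) ∂ν := by
    rw [integral_sub (hI x) (integrable_const _), integral_const, probReal_univ, one_smul, hν,
      integral_withDensity_eq_integral_smul hρm]
    simp_rw [hρs]
  have hmeas : AEStronglyMeasurable (fun z : Eucl N × Eucl N => f (z.1 - z.2) - f z.1)
      ((volume : Measure (Eucl N)).prod ν) := by
    refine AEStronglyMeasurable.mono_ac (Measure.AbsolutelyContinuous.rfl.prod hac) ?_
    exact (hf.aestronglyMeasurable.comp_quasiMeasurePreserving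
      (quasiMeasurePreserving_sub volume volume)).sub hf.aestronglyMeasurable.comp_fst
  have h0 : ENNReal.ofReal r ≠ 0 := by simpa using hr0
  have hpt (x : Eucl N) : ‖∫ t, (f (x - t) - f x) ∂ν‖ₑ ^ r ≤ ∫⁻ t, ‖f (x - t) - f x‖ₑ ^ r ∂ν := by
    have hm : AEStronglyMeasurable (fun t => f (x - t) - f x) ν :=
      ((hI x).sub (integrable_const _)).aestronglyMeasurable
    have h1 : ‖∫ t, (f (x - t) - f x) ∂ν‖ₑ ≤ eLpNorm (fun t => f (x - t) - f x)
        (ENNReal.ofReal r) ν := by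
      refine (enorm_integral_le_lintegral_enorm _).trans ?_
      rw [← eLpNorm_one_eq_lintegral_enorm]
      exact eLpNorm_le_eLpNorm_of_exponent_le (by simpa using hr) hm
    rw [eLpNorm_eq_lintegral_rpow_enorm_toReal h0 ENNReal.ofReal_ne_top,
      ENNReal.toReal_ofReal hr0.le] at h1
    refine (ENNReal.rpow_le_rpow h1 hr0.le).trans_eq ?_
    rw [← ENNReal.rpow_mul, one_div, inv_mul_cancel₀ hr0.ne', ENNReal.rpow_one]
  have hball : ∀ᵐ t ∂ν, t ∈ Metric.ball (0 : Eucl N) φ.rOut := by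
    rw [hν, ae_withDensity_iff (by fun_prop)]
    refine Eventually.of_forall fun t ht => ?_
    rw [← φ.support_normed_eq (μ := volume), Function.mem_support]
    intro h0
    simp [hρ, h0] at ht
  simp_rw [hrep]
  rw [eLpNorm_eq_lintegral_rpow_enorm_toReal h0 ENNReal.ofReal_ne_top,
    ENNReal.toReal_ofReal hr0.le, one_div, ENNReal.rpow_inv_le_iff hr0]
  calc ∫⁻ x, ‖∫ t, (f (x - t) - f x) ∂ν‖ₑ ^ r
      ≤ ∫⁻ x, (∫⁻ t, ‖f (x - t) - f x‖ₑ ^ r ∂ν) := lintegral_mono hpt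
    _ = ∫⁻ t, (∫⁻ x, ‖f (x - t) - f x‖ₑ ^ r) ∂ν :=
        lintegral_lintegral_swap (hmeas.enorm.pow_const r)
    _ ≤ ∫⁻ t, η ^ r ∂ν := by
        refine lintegral_mono_ae (hball.mono fun t ht => ?_)
        have := h t ht
        rwa [eLpNorm_eq_lintegral_rpow_enorm_toReal h0 ENNReal.ofReal_ne_top,
          ENNReal.toReal_ofReal hr0.le, one_div, ENNReal.rpow_inv_le_iff hr0] at this
    _ = η ^ r := by simp

/-- A sequence of bump functions at the origin with radii tending to `0`. -/
def shrinkingBump (N n : ℕ) : ContDiffBump (0 : Eucl N) where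
  rIn := 1 / (2 * ((n : ℝ) + 1))
  rOut := 1 / ((n : ℝ) + 1)
  rIn_pos := by positivity
  rIn_lt_rOut := by
    apply one_div_lt_one_div_of_lt <;> linarith [(Nat.cast_nonneg n : (0 : ℝ) ≤ n)]

lemma tendsto_eLpNorm_mollify_sub {r : ℝ} (hr : 1 ≤ r) {f : Eucl N → F}
    (hf : MemLp f (ENNReal.ofReal r) volume) :
    Tendsto (fun n => eLpNorm (fun x =>
      (∫ t, (shrinkingBump N n).normed volume t • f (x - t)) - f x) (ENNReal.ofReal r) volume)
      atTop (𝓝 0) := by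
  rw [ENNReal.tendsto_nhds_zero]
  intro ε hε
  have h1 := ENNReal.tendsto_nhds_zero.1
    (tendsto_eLpNorm_translate_sub (by simpa using hr) ENNReal.ofReal_ne_top hf) ε hε
  obtain ⟨δ, hδ, hball⟩ := Metric.eventually_nhds_iff_ball.1 h1
  filter_upwards [tendsto_one_div_add_atTop_nhds_zero_nat.eventually (gt_mem_nhds hδ)] with n hn
  exact eLpNorm_mollify_sub_le hr _ hf fun t ht =>
    hball t (Metric.ball_subset_ball (le_of_lt hn) ht)

end Mollification

section Approximation

variable {N : ℕ}

lemma inner_gradient_eq {φ : Eucl N → ℝ} (x v : Eucl N) :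
    inner ℝ (gradient φ x) v = fderiv ℝ φ x v := inner_gradient_left

lemma continuous_gradient_of_contDiff {φ : Eucl N → ℝ} (h : ContDiff ℝ 1 φ) :
    Continuous (gradient φ) :=
  (InnerProductSpace.toDual ℝ (Eucl N)).symm.continuous.comp (h.continuous_fderiv one_ne_zero)

lemma support_gradient_subset (φ : Eucl N → ℝ) : Function.support (gradient φ) ⊆ tsupport φ := by
  intro x hx
  refine support_fderiv_subset ℝ (f := φ) ?_
  simp only [Function.mem_support] at hx ⊢
  contrapose! hx
  simp [gradient, hx]

/-- The derivative falls on the bump, and the reflected bump `t ↦ ρ (x - t)` is a legitimate test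
function on the whole space. Reflection changes the sign of its gradient, which cancels the sign in
the definition of the weak gradient. -/
lemma gradient_mollify {u : Eucl N → ℝ} {g : Eucl N → Eucl N} (φ : ContDiffBump (0 : Eucl N))
    (hu : LocallyIntegrable u volume)
    (hw : IsWeakGradient univ u g) (x : Eucl N) :
    gradient (u ⋆[ContinuousLinearMap.mul ℝ ℝ, volume] φ.normed volume) x
      = ∫ t, φ.normed volume t • g (x - t) := by
  set ρ := φ.normed volume with hρ
  have hρc : HasCompactSupport ρ := φ.hasCompactSupport_normed
  have hρd : ContDiff ℝ ∞ ρ := φ.contDiff_normed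
  have hρ1 : ContDiff ℝ 1 ρ := φ.contDiff_normed
  set ψ : Eucl N → ℝ := fun t => ρ (x - t) with hψ
  have hψd : ContDiff ℝ ∞ ψ := hρd.comp (contDiff_const.sub contDiff_id)
  have hψc : HasCompactSupport ψ :=
    hρc.comp_homeomorph (Homeomorph.subLeft x)
  have hgr (t : Eucl N) : gradient ψ t = - gradient ρ (x - t) := by
    refine ext_inner_right ℝ fun v => ?_
    rw [inner_neg_left, inner_gradient_eq, inner_gradient_eq]
    have h1 : HasFDerivAt (fun t : Eucl N => x - t) (-ContinuousLinearMap.id ℝ (Eucl N)) t := by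
      simpa using (hasFDerivAt_id t).const_sub x
    have h2 := ((hρ1.differentiable one_ne_zero (x - t)).hasFDerivAt).comp t h1
    rw [show ψ = ρ ∘ fun t => x - t from rfl, h2.fderiv]
    simp
  have h1 := hw ψ ⟨hψd, hψc, subset_univ _⟩
  simp only [Measure.restrict_univ] at h1
  have h2 : (∫ t, ρ t • g (x - t)) = ∫ t, ψ t • g t := by
    have := integral_sub_left_eq_self (fun t => ρ (x - t) • g t) volume x
    rw [← this]
    simp
  rw [h2]
  have h3 : ∫ t, ψ t • g t = ∫ t, u t • gradient ρ (x - t) := by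
    rw [← neg_eq_iff_eq_neg.2 h1, ← integral_neg]
    simp_rw [hgr, smul_neg, neg_neg]
  rw [h3]
  refine ext_inner_right ℝ fun v => ?_
  rw [inner_gradient_eq, (hρc.hasFDerivAt_convolution_right _ hu hρ1 x).fderiv,
    convolution_precompR_apply _ hu (hρc.fderiv ℝ) (hρ1.continuous_fderiv one_ne_zero)]
  have hgc : Continuous fun t => gradient ρ (x - t) :=
    (continuous_gradient_of_contDiff hρ1).comp (by fun_prop)
  have hgs : HasCompactSupport (gradient ρ) :=
    HasCompactSupport.mono' hρc (support_gradient_subset ρ)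
  have hint : Integrable (fun t => u t • gradient ρ (x - t)) volume :=
    hu.integrable_smul_right_of_hasCompactSupport hgc
      (hgs.comp_homeomorph (Homeomorph.subLeft x))
  rw [real_inner_comm, ← integral_inner hint]
  simp_rw [real_inner_smul_right, real_inner_comm _ v, inner_gradient_eq]
  rfl

lemma exists_test_approx {r : ℝ} (hr : 1 ≤ r) {Ω K : Set (Eucl N)} (hΩ : IsOpen Ω)
    (hK : IsCompact K) (hKΩ : K ⊆ Ω) {u : Eucl N → ℝ} {g : Eucl N → Eucl N}
    (hu : MemLp u (ENNReal.ofReal r) volume) (hg : MemLp g (ENNReal.ofReal r) volume)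
    (hw : IsWeakGradient univ u g) (hs : Function.support u ⊆ K) :
    ∃ φ : ℕ → Eucl N → ℝ, (∀ n, IsTestFunction Ω (φ n)) ∧
      Tendsto (fun n => eLpNorm (φ n - u) (ENNReal.ofReal r) volume) atTop (𝓝 0) ∧
      Tendsto (fun n => eLpNorm (gradient (φ n) - g) (ENNReal.ofReal r) volume) atTop (𝓝 0) := by
  have hul := hu.locallyIntegrable (by simpa using hr : 1 ≤ ENNReal.ofReal r)
  obtain ⟨δ, hδ, hδΩ⟩ := hK.exists_cthickening_subset_open hΩ hKΩ
  -- Discarding the first `n₀` bumps leaves radii below `δ`, so that all the mollified functions are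
  -- supported in the `δ`-thickening of `K`, inside `Ω`.
  obtain ⟨n₀, hn₀⟩ := eventually_atTop.1
    (tendsto_one_div_add_atTop_nhds_zero_nat.eventually (gt_mem_nhds hδ))
  let ρ (n : ℕ) := (shrinkingBump N (n + n₀)).normed (volume : Measure (Eucl N))
  refine ⟨fun n => u ⋆[ContinuousLinearMap.mul ℝ ℝ, volume] ρ n, fun n => ?_, ?_, ?_⟩
  · have hsub : Function.support (u ⋆[ContinuousLinearMap.mul ℝ ℝ, volume] ρ n)
        ⊆ Metric.cthickening δ K := by
      refine (support_convolution_subset (ContinuousLinearMap.mul ℝ ℝ)).trans ?_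
      rintro _ ⟨y, hy, z, hz, rfl⟩
      rw [ContDiffBump.support_normed_eq, mem_ball_zero_iff] at hz
      have hz' : ‖z‖ < δ := hz.trans (hn₀ (n + n₀) (by omega))
      refine Metric.thickening_subset_cthickening δ K ?_
      rw [Metric.mem_thickening_iff]
      exact ⟨y, hs hy, by simpa [dist_eq_norm] using hz'⟩
    have ht : tsupport (u ⋆[ContinuousLinearMap.mul ℝ ℝ, volume] ρ n) ⊆ Metric.cthickening δ K :=
      closure_minimal hsub Metric.isClosed_cthickening
    refine ⟨(ContDiffBump.hasCompactSupport_normed _).contDiff_convolution_right _ hul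
      (ContDiffBump.contDiff_normed _), ?_, ht.trans hδΩ⟩
    exact HasCompactSupport.of_support_subset_isCompact hK.cthickening hsub
  · refine ((tendsto_eLpNorm_mollify_sub hr hu).comp (tendsto_add_atTop_nat n₀)).congr fun n => ?_
    simp only [Function.comp]
    congr 1
    ext x
    simp only [Pi.sub_apply, convolution_eq_swap]
    congr 2
    ext t
    simp [ρ, mul_comm]
  · refine ((tendsto_eLpNorm_mollify_sub hr hg).comp (tendsto_add_atTop_nat n₀)).congr fun n => ?_
    simp only [Function.comp]
    congr 1
    ext1 x
    simp only [Pi.sub_apply]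
    rw [gradient_mollify _ hul hw]

end Approximation

end

/-! ### The energy spaces with explicit gradients -/

section EnergySpace

variable {N : ℕ} {Ω : Set (Eucl N)} {p : ℝ} {u v : Eucl N → ℝ} {g k : Eucl N → Eucl N}

/-- `u ∈ L^p(Ω)` has the weak gradient `g ∈ L^p(Ω)`. -/
structure HasSobolevGradient (Ω : Set (Eucl N)) (p : ℝ) (u : Eucl N → ℝ) (g : Eucl N → Eucl N) :
    Prop where
  memLp : MemLp u (ENNReal.ofReal p) (volume.restrict Ω)
  memLp_grad : MemLp g (ENNReal.ofReal p) (volume.restrict Ω)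
  isWeakGradient : IsWeakGradient Ω u g

/-- `(u, g)` is the `W^{1,p}`-limit of test functions and their gradients. -/
def ApproxByTest (Ω : Set (Eucl N)) (p : ℝ) (u : Eucl N → ℝ) (g : Eucl N → Eucl N) : Prop :=
  ∃ φ : ℕ → Eucl N → ℝ, (∀ n, IsTestFunction Ω (φ n)) ∧
    Tendsto (fun n => eLpNorm (φ n - u) (ENNReal.ofReal p) (volume.restrict Ω)) atTop (𝓝 0) ∧
    Tendsto (fun n => eLpNorm (gradient (φ n) - g) (ENNReal.ofReal p) (volume.restrict Ω))
      atTop (𝓝 0)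

/-- `u` belongs to the energy space and `g` is its weak gradient. -/
structure InEnergySpace (B : BoundaryCondition) (Ω : Set (Eucl N)) (p : ℝ) (u : Eucl N → ℝ)
    (g : Eucl N → Eucl N) : Prop extends HasSobolevGradient Ω p u g where
  approx : B = BoundaryCondition.dirichlet → ApproxByTest Ω p u g

lemma IsTestFunction.contDiff_one {φ : Eucl N → ℝ} (h : IsTestFunction Ω φ) : ContDiff ℝ 1 φ :=
  h.1.of_le (by exact_mod_cast le_top)

lemma hasCompactSupport_gradient {φ : Eucl N → ℝ} (h : HasCompactSupport φ) :
    HasCompactSupport (gradient φ) :=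
  HasCompactSupport.mono' h (support_gradient_subset φ)

lemma exists_bound_of_contDiff {φ : Eucl N → ℝ} (h : ContDiff ℝ 1 φ) (hc : HasCompactSupport φ) :
    ∃ C : ℝ, 0 ≤ C ∧ (∀ x, ‖φ x‖ ≤ C) ∧ ∀ x, ‖gradient φ x‖ ≤ C := by
  obtain ⟨C₁, h₁⟩ := hc.exists_bound_of_continuous h.continuous
  obtain ⟨C₂, h₂⟩ := (hasCompactSupport_gradient hc).exists_bound_of_continuous
    (continuous_gradient_of_contDiff h)
  exact ⟨max C₁ C₂, (norm_nonneg _).trans ((h₁ 0).trans (le_max_left _ _)),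
    fun x => (h₁ x).trans (le_max_left _ _), fun x => (h₂ x).trans (le_max_right _ _)⟩

/-- On a finite measure space `L^p` convergence implies `L¹` convergence. This passes to the limit
in both sides of the weak gradient identity. -/
lemma tendsto_integral_of_norm_sub_le {α E F ι : Type*} [MeasurableSpace α] {μ : Measure α}
    [IsFiniteMeasure μ] [NormedAddCommGroup E] [NormedAddCommGroup F] [NormedSpace ℝ F]
    {l : Filter ι} (hp : 1 ≤ p) {G : ι → α → F} {G₀ : α → F} {f : ι → α → E} {f₀ : α → E} {C : ℝ}
    (hG : ∀ i, Integrable (G i) μ) (hG₀ : Integrable G₀ μ)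
    (hf : ∀ i, AEStronglyMeasurable (f i - f₀) μ)
    (hle : ∀ i, ∀ᵐ x ∂μ, ‖G i x - G₀ x‖ ≤ C * ‖f i x - f₀ x‖)
    (h : Tendsto (fun i => eLpNorm (f i - f₀) (ENNReal.ofReal p) μ) l (𝓝 0)) :
    Tendsto (fun i => ∫ x, G i x ∂μ) l (𝓝 (∫ x, G₀ x ∂μ)) := by
  refine tendsto_integral_of_L1' G₀ hG₀.aestronglyMeasurable (Eventually.of_forall hG) ?_
  set c := μ univ ^ (1 / (1 : ENNReal).toReal - 1 / (ENNReal.ofReal p).toReal) with hc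
  have hp1 : 1 ≤ ENNReal.ofReal p := by simpa using hp
  have hcfin : c ≠ ⊤ := by
    refine ENNReal.rpow_ne_top_of_nonneg ?_ (measure_ne_top _ _)
    rw [ENNReal.toReal_one, ENNReal.toReal_ofReal (by linarith), sub_nonneg]
    exact one_div_le_one_div_of_le one_pos hp
  have hbd (i : ι) : eLpNorm (G i - G₀) 1 μ
      ≤ ENNReal.ofReal C * (eLpNorm (f i - f₀) (ENNReal.ofReal p) μ * c) :=
    (eLpNorm_le_mul_eLpNorm_of_ae_le_mul (hle i) 1).trans
      (mul_le_mul_right (eLpNorm_le_eLpNorm_mul_rpow_measure_univ hp1 (hf i)) _)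
  have hlim : Tendsto (fun i => ENNReal.ofReal C *
      (eLpNorm (f i - f₀) (ENNReal.ofReal p) μ * c)) l (𝓝 0) := by
    have := ENNReal.Tendsto.const_mul (a := ENNReal.ofReal C)
      (ENNReal.Tendsto.mul_const h (Or.inr hcfin)) (Or.inr ENNReal.ofReal_ne_top)
    simpa using this
  exact tendsto_of_tendsto_of_tendsto_of_le_of_le tendsto_const_nhds hlim
    (fun _ => zero_le) hbd

lemma gradient_const_mul (c : ℝ) {φ : Eucl N → ℝ} (h : ContDiff ℝ 1 φ) (x : Eucl N) :
    gradient (fun x => c * φ x) x = c • gradient φ x := by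
  refine ext_inner_right ℝ fun w => ?_
  rw [real_inner_smul_left, inner_gradient_eq, inner_gradient_eq,
    fderiv_const_mul (h.differentiable one_ne_zero x)]
  simp

lemma InEnergySpace.const_mul {B : BoundaryCondition} (h : InEnergySpace B Ω p u g) (c : ℝ) :
    InEnergySpace B Ω p (fun x => c * u x) (fun x => c • g x) := by
  refine ⟨⟨h.memLp.const_mul c, h.memLp_grad.const_smul c, fun φ hφ => ?_⟩, fun hB => ?_⟩
  · have := h.isWeakGradient φ hφ
    simp_rw [mul_smul, smul_comm _ c]
    rw [integral_smul, integral_smul, this, smul_neg]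
  · obtain ⟨φ, hφ, h1, h2⟩ := h.approx hB
    have hlim {f : ℕ → ENNReal} (hf : Tendsto f atTop (𝓝 0)) :
        Tendsto (fun n => ‖c‖ₑ * f n) atTop (𝓝 0) := by
      have := ENNReal.Tendsto.const_mul hf (a := ‖c‖ₑ) (Or.inr (by simp))
      simpa using this
    refine ⟨fun n x => c * φ n x, fun n => ⟨contDiff_const.mul (hφ n).1, (hφ n).2.1.mul_left,
      (closure_mono (Function.support_const_smul_subset c (φ n))).trans (hφ n).2.2⟩,
      (hlim h1).congr fun n => ?_, (hlim h2).congr fun n => ?_⟩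
    · rw [← eLpNorm_const_smul]
      congr 1; ext x; simp [mul_sub]
    · rw [← eLpNorm_const_smul]
      congr 1; ext1 x; simp [gradient_const_mul c (hφ n).contDiff_one, smul_sub]

/-- Both integrands vanish off `Ω` because of the two supports, so integration by parts on the whole
space applies in each direction `w`. -/
lemma isWeakGradient_gradient {f : Eucl N → ℝ} (hf : ContDiff ℝ 1 f)
    (hs : tsupport f ⊆ Ω) : IsWeakGradient Ω f (gradient f) := by
  intro φ hφ
  have hφ1 := hφ.contDiff_one
  have hgc := hasCompactSupport_gradient hφ.2.1
  have i1 : Integrable (fun x => f x • gradient φ x) volume :=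
    (hf.continuous.smul (continuous_gradient_of_contDiff hφ1)).integrable_of_hasCompactSupport
      hgc.smul_left
  have i2 : Integrable (fun x => φ x • gradient f x) volume :=
    (hφ1.continuous.smul (continuous_gradient_of_contDiff hf)).integrable_of_hasCompactSupport
      hφ.2.1.smul_right
  rw [setIntegral_eq_integral_of_forall_compl_eq_zero, setIntegral_eq_integral_of_forall_compl_eq_zero]
  · refine ext_inner_right ℝ fun w => ?_
    rw [inner_neg_left, real_inner_comm, ← integral_inner i1, real_inner_comm w,
      ← integral_inner i2]
    simp_rw [real_inner_smul_right, real_inner_comm _ w, inner_gradient_eq]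
    have j1 : Integrable (fun x => f x * fderiv ℝ φ x w) volume := by
      refine (i1.inner_const w).congr (Eventually.of_forall fun x => ?_)
      simp only [real_inner_smul_left, inner_gradient_eq]
    have j2 : Integrable (fun x => fderiv ℝ f x w * φ x) volume := by
      refine (i2.inner_const w).congr (Eventually.of_forall fun x => ?_)
      simp only [real_inner_smul_left, inner_gradient_eq, mul_comm]
    have j3 : Integrable (fun x => f x * φ x) volume :=
      (hf.continuous.mul hφ1.continuous).integrable_of_hasCompactSupport hφ.2.1.mul_left
    rw [integral_mul_fderiv_eq_neg_fderiv_mul_of_integrable j2 j1 j3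
      (fun x _ => hf.differentiable one_ne_zero x) (fun x _ => hφ1.differentiable one_ne_zero x)]
    simp_rw [mul_comm]
  · intro x hx
    rw [image_eq_zero_of_notMem_tsupport fun h => hx (hφ.2.2 h), zero_smul]
  · intro x hx
    rw [image_eq_zero_of_notMem_tsupport fun h => hx (hs h), zero_smul]

lemma approxByTest_of_global (hp : 1 ≤ p) (hΩ : IsOpen Ω) {K : Set (Eucl N)} (hK : IsCompact K)
    (hKΩ : K ⊆ Ω) (hu : MemLp u (ENNReal.ofReal p) volume)
    (hg : MemLp g (ENNReal.ofReal p) volume) (hw : IsWeakGradient univ u g)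
    (hs : Function.support u ⊆ K) : ApproxByTest Ω p u g := by
  obtain ⟨φ, hφ, h1, h2⟩ := exists_test_approx hp hΩ hK hKΩ hu hg hw hs
  refine ⟨φ, hφ, ?_, ?_⟩
  · exact tendsto_of_tendsto_of_tendsto_of_le_of_le tendsto_const_nhds h1 (fun _ => zero_le)
      fun n => eLpNorm_mono_measure _ Measure.restrict_le_self
  · exact tendsto_of_tendsto_of_tendsto_of_le_of_le tendsto_const_nhds h2 (fun _ => zero_le)
      fun n => eLpNorm_mono_measure _ Measure.restrict_le_self

/-- Membership is needed for functions that are only `C¹`, namely the compositions in the chain rule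
and the barrier; mollification supplies the smooth approximants. -/
lemma inEnergySpace_of_contDiff (hp : 1 ≤ p) (hΩ : IsOpen Ω) (B : BoundaryCondition)
    {f : Eucl N → ℝ} (hf : ContDiff ℝ 1 f) (hc : HasCompactSupport f) (hs : tsupport f ⊆ Ω) :
    InEnergySpace B Ω p f (gradient f) := by
  have h1 : MemLp f (ENNReal.ofReal p) volume :=
    hf.continuous.memLp_of_hasCompactSupport hc
  have h2 : MemLp (gradient f) (ENNReal.ofReal p) volume :=
    (continuous_gradient_of_contDiff hf).memLp_of_hasCompactSupport
      (hasCompactSupport_gradient hc)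
  refine ⟨⟨h1.restrict Ω, h2.restrict Ω, isWeakGradient_gradient hf hs⟩, fun _ => ?_⟩
  exact approxByTest_of_global hp hΩ hc hs h1 h2 (isWeakGradient_gradient hf (subset_univ _))
    (subset_tsupport f)

lemma IsWeakGradient.congr {u' : Eucl N → ℝ} {g' : Eucl N → Eucl N} (h : IsWeakGradient Ω u g)
    (hu : u =ᵐ[volume.restrict Ω] u') (hg : g =ᵐ[volume.restrict Ω] g') :
    IsWeakGradient Ω u' g' := by
  intro φ hφ
  have h1 : (fun x => u x • gradient φ x) =ᵐ[volume.restrict Ω] fun x => u' x • gradient φ x :=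
    hu.mono fun x hx => by simp only [hx]
  have h2 : (fun x => φ x • g x) =ᵐ[volume.restrict Ω] fun x => φ x • g' x :=
    hg.mono fun x hx => by simp only [hx]
  rw [← integral_congr_ae h1, h φ hφ, integral_congr_ae h2]

lemma HasSobolevGradient.congr {u' : Eucl N → ℝ} {g' : Eucl N → Eucl N}
    (h : HasSobolevGradient Ω p u g) (hu : u =ᵐ[volume.restrict Ω] u')
    (hg : g =ᵐ[volume.restrict Ω] g') : HasSobolevGradient Ω p u' g' :=
  ⟨h.memLp.ae_eq hu, h.memLp_grad.ae_eq hg, h.isWeakGradient.congr hu hg⟩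

lemma InEnergySpace.congr {B : BoundaryCondition} {u' : Eucl N → ℝ} {g' : Eucl N → Eucl N}
    (h : InEnergySpace B Ω p u g) (hu : u =ᵐ[volume.restrict Ω] u')
    (hg : g =ᵐ[volume.restrict Ω] g') : InEnergySpace B Ω p u' g' := by
  refine ⟨h.toHasSobolevGradient.congr hu hg, fun hB => ?_⟩
  obtain ⟨φ, hφ, h1, h2⟩ := h.approx hB
  refine ⟨φ, hφ, h1.congr fun n => ?_, h2.congr fun n => ?_⟩
  · exact eLpNorm_congr_ae (hu.mono fun x hx => by simp [hx])
  · exact eLpNorm_congr_ae (hg.mono fun x hx => by simp [hx])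

/-- This is the fundamental lemma of the calculus of variations applied to `g - g'`. -/
lemma IsWeakGradient.ae_eq (hΩ : IsOpen Ω) {g' : Eucl N → Eucl N} (h : IsWeakGradient Ω u g)
    (h' : IsWeakGradient Ω u g') (hg : LocallyIntegrableOn g Ω volume)
    (hg' : LocallyIntegrableOn g' Ω volume) : g =ᵐ[volume.restrict Ω] g' := by
  have key := hΩ.ae_eq_zero_of_integral_contDiff_smul_eq_zero (hg.sub hg') fun φ hd hc hs => by
    have hφ : IsTestFunction Ω φ := ⟨hd, hc, hs⟩
    have hint {f : Eucl N → Eucl N} (hf : LocallyIntegrableOn f Ω volume) :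
        Integrable (fun x => φ x • f x) (volume.restrict Ω) := by
      have h1 : IntegrableOn (fun x => φ x • f x) (tsupport φ) volume :=
        (hf.integrableOn_compact_subset hs hc).continuousOn_smul hd.continuous.continuousOn hc
      rw [integrableOn_iff_integrable_of_support_subset] at h1
      · exact h1.restrict
      · intro x hx
        refine subset_tsupport φ ?_
        intro h0
        simp [h0] at hx
    have h1 : ∫ x in Ω, φ x • (g - g') x = 0 := by
      simp only [Pi.sub_apply, smul_sub]
      rw [integral_sub (hint hg) (hint hg'), ← neg_eq_iff_eq_neg.2 (h φ hφ),
        ← neg_eq_iff_eq_neg.2 (h' φ hφ), sub_self]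
    rw [← h1, setIntegral_eq_integral_of_forall_compl_eq_zero]
    intro x hx
    rw [image_eq_zero_of_notMem_tsupport fun h => hx (hs h), zero_smul]
  rw [EventuallyEq, ae_restrict_iff' hΩ.measurableSet]
  filter_upwards [key] with x hx hxΩ
  exact sub_eq_zero.1 (hx hxΩ)

variable [IsFiniteMeasure (volume.restrict Ω)]

lemma integrable_smul_gradient (hp : 1 ≤ p) {φ : Eucl N → ℝ} (h : ContDiff ℝ 1 φ)
    (hc : HasCompactSupport φ) (hu : MemLp u (ENNReal.ofReal p) (volume.restrict Ω)) :
    Integrable (fun x => u x • gradient φ x) (volume.restrict Ω) := by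
  obtain ⟨C, -, -, hC⟩ := exists_bound_of_contDiff h hc
  exact (hu.integrable (by simpa using hp)).smul_bdd C
    (continuous_gradient_of_contDiff h).aestronglyMeasurable (Eventually.of_forall hC)

lemma integrable_test_smul {E : Type*} [NormedAddCommGroup E] [NormedSpace ℝ E] (hp : 1 ≤ p)
    {φ : Eucl N → ℝ} (h : ContDiff ℝ 1 φ)
    (hc : HasCompactSupport φ) {g : Eucl N → E}
    (hg : MemLp g (ENNReal.ofReal p) (volume.restrict Ω)) :
    Integrable (fun x => φ x • g x) (volume.restrict Ω) := by
  obtain ⟨C, -, hC, -⟩ := exists_bound_of_contDiff h hc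
  exact (hg.integrable (by simpa using hp)).bdd_smul C
    h.continuous.aestronglyMeasurable (Eventually.of_forall hC)

lemma locallyIntegrableOn_of_memLp (hp : 1 ≤ p) {E : Type*} [NormedAddCommGroup E]
    {g : Eucl N → E} (hg : MemLp g (ENNReal.ofReal p) (volume.restrict Ω)) :
    LocallyIntegrableOn g Ω volume :=
  IntegrableOn.locallyIntegrableOn (hg.integrable (by simpa using hp))

lemma HasSobolevGradient.ae_eq (hp : 1 ≤ p) (hΩ : IsOpen Ω) {g' : Eucl N → Eucl N}
    (h : HasSobolevGradient Ω p u g) (h' : HasSobolevGradient Ω p u g') :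
    g =ᵐ[volume.restrict Ω] g' :=
  h.isWeakGradient.ae_eq hΩ h'.isWeakGradient (locallyIntegrableOn_of_memLp hp h.memLp_grad)
    (locallyIntegrableOn_of_memLp hp h'.memLp_grad)

/-- `weakGrad` is an arbitrary choice among representatives. This lemma frees the argument from that
choice: later computations use whichever gradient is at hand. -/
lemma HasSobolevGradient.weakGrad_ae_eq (hp : 1 ≤ p) (hΩ : IsOpen Ω)
    (h : HasSobolevGradient Ω p u g) : weakGrad Ω u =ᵐ[volume.restrict Ω] g := by
  have hex : ∃ g : Eucl N → Eucl N, LocallyIntegrableOn g Ω volume ∧ IsWeakGradient Ω u g :=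
    ⟨g, locallyIntegrableOn_of_memLp hp h.memLp_grad, h.isWeakGradient⟩
  rw [weakGrad, dif_pos hex]
  exact hex.choose_spec.2.ae_eq hΩ h.isWeakGradient hex.choose_spec.1
    (locallyIntegrableOn_of_memLp hp h.memLp_grad)

lemma mem_energySpace_iff (hp : 1 ≤ p) (hΩ : IsOpen Ω) {B : BoundaryCondition} :
    u ∈ energySpace B Ω p ↔ ∃ g, InEnergySpace B Ω p u g := by
  have hW : u ∈ W1p Ω p ↔ ∃ g, HasSobolevGradient Ω p u g :=
    ⟨fun ⟨h1, g, h2, h3⟩ => ⟨g, h1, h2, h3⟩, fun ⟨g, h⟩ => ⟨h.1, g, h.2, h.3⟩⟩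
  cases B with
  | neumann =>
    simp only [energySpace, hW]
    exact ⟨fun ⟨g, h⟩ => ⟨g, h, by simp⟩, fun ⟨g, h⟩ => ⟨g, h.1⟩⟩
  | dirichlet =>
    simp only [energySpace, W01p, Set.mem_ofPred_eq, hW]
    constructor
    · rintro ⟨⟨g, h⟩, happ⟩
      refine ⟨g, h, fun _ => ?_⟩
      have hpos (n : ℕ) : (0 : ENNReal) < ((n : ENNReal) + 1)⁻¹ := by
        simp
      choose φ hφ h1 h2 using fun n : ℕ => happ _ (hpos n)
      have hlim : Tendsto (fun n : ℕ => ((n : ENNReal) + 1)⁻¹) atTop (𝓝 0) := by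
        have := (ENNReal.tendsto_inv_nat_nhds_zero).comp (tendsto_add_atTop_nat 1)
        refine this.congr fun n => by simp
      refine ⟨φ, hφ, ?_, ?_⟩
      · refine tendsto_of_tendsto_of_tendsto_of_le_of_le tendsto_const_nhds hlim
          (fun _ => zero_le) fun n => ?_
        rw [eLpNorm_sub_comm]
        exact (h1 n).le
      · refine tendsto_of_tendsto_of_tendsto_of_le_of_le tendsto_const_nhds hlim
          (fun _ => zero_le) fun n => ?_
        rw [eLpNorm_sub_comm]
        refine le_trans (le_of_eq ?_) (h2 n).le
        exact eLpNorm_congr_ae ((h.weakGrad_ae_eq hp hΩ).mono fun x hx => by simp [hx])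
    · rintro ⟨g, h⟩
      refine ⟨⟨g, h.1⟩, fun ε hε => ?_⟩
      obtain ⟨φ, hφ, h1, h2⟩ := h.approx rfl
      obtain ⟨n, hn1, hn2⟩ := ((h1.eventually (gt_mem_nhds hε)).and
        (h2.eventually (gt_mem_nhds hε))).exists
      refine ⟨φ n, hφ n, ?_, ?_⟩
      · rw [eLpNorm_sub_comm] at hn1
        exact hn1
      · rw [eLpNorm_sub_comm] at hn2
        refine lt_of_le_of_lt (le_of_eq ?_) hn2
        exact eLpNorm_congr_ae
          ((h.toHasSobolevGradient.weakGrad_ae_eq hp hΩ).mono fun x hx => by simp [hx])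

lemma InEnergySpace.mem_energySpace (hp : 1 ≤ p) (hΩ : IsOpen Ω) {B : BoundaryCondition}
    (h : InEnergySpace B Ω p u g) : u ∈ energySpace B Ω p := (mem_energySpace_iff hp hΩ).2 ⟨g, h⟩

lemma inEnergySpace_weakGrad (hp : 1 ≤ p) (hΩ : IsOpen Ω) {B : BoundaryCondition}
    (h : u ∈ energySpace B Ω p) : InEnergySpace B Ω p u (weakGrad Ω u) := by
  obtain ⟨g, hg⟩ := (mem_energySpace_iff hp hΩ).1 h
  exact hg.congr (EventuallyEq.refl _ _) (hg.toHasSobolevGradient.weakGrad_ae_eq hp hΩ).symm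

lemma gradient_add' {φ ψ : Eucl N → ℝ} (h : ContDiff ℝ 1 φ) (h' : ContDiff ℝ 1 ψ) (x : Eucl N) :
    gradient (fun x => φ x + ψ x) x = gradient φ x + gradient ψ x := by
  refine ext_inner_right ℝ fun w => ?_
  rw [inner_add_left, inner_gradient_eq, inner_gradient_eq, inner_gradient_eq,
    fderiv_fun_add (h.differentiable one_ne_zero x) (h'.differentiable one_ne_zero x)]
  simp

lemma gradient_mul' {φ ψ : Eucl N → ℝ} (h : ContDiff ℝ 1 φ) (h' : ContDiff ℝ 1 ψ) (x : Eucl N) :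
    gradient (fun x => φ x * ψ x) x = φ x • gradient ψ x + ψ x • gradient φ x := by
  refine ext_inner_right ℝ fun w => ?_
  rw [inner_add_left, real_inner_smul_left, real_inner_smul_left, inner_gradient_eq,
    inner_gradient_eq, inner_gradient_eq,
    fderiv_fun_mul (h.differentiable one_ne_zero x) (h'.differentiable one_ne_zero x)]
  simp

lemma InEnergySpace.add (hp : 1 ≤ p) {B : BoundaryCondition} (h : InEnergySpace B Ω p u g)
    (h' : InEnergySpace B Ω p v k) :
    InEnergySpace B Ω p (fun x => u x + v x) (fun x => g x + k x) := by
  refine ⟨⟨h.memLp.add h'.memLp, h.memLp_grad.add h'.memLp_grad, fun φ hφ => ?_⟩, fun hB => ?_⟩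
  · have h1 := hφ.contDiff_one
    simp_rw [add_smul, smul_add]
    rw [integral_add (integrable_smul_gradient hp h1 hφ.2.1 h.memLp)
      (integrable_smul_gradient hp h1 hφ.2.1 h'.memLp),
      integral_add (integrable_test_smul hp h1 hφ.2.1 h.memLp_grad)
      (integrable_test_smul hp h1 hφ.2.1 h'.memLp_grad), h.isWeakGradient φ hφ,
      h'.isWeakGradient φ hφ, neg_add]
  · obtain ⟨φ, hφ, h1, h2⟩ := h.approx hB
    obtain ⟨ψ, hψ, h3, h4⟩ := h'.approx hB
    have hp' : 1 ≤ ENNReal.ofReal p := by simpa using hp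
    have hlim {f g : ℕ → ENNReal} (hf : Tendsto f atTop (𝓝 0)) (hg : Tendsto g atTop (𝓝 0)) :
        Tendsto (fun n => f n + g n) atTop (𝓝 0) := by simpa using hf.add hg
    refine ⟨fun n x => φ n x + ψ n x, fun n => ⟨(hφ n).1.add (hψ n).1,
      (hφ n).2.1.add (hψ n).2.1, ?_⟩, ?_, ?_⟩
    · exact (tsupport_add (φ n) (ψ n)).trans (union_subset (hφ n).2.2 (hψ n).2.2)
    · refine tendsto_of_tendsto_of_tendsto_of_le_of_le tendsto_const_nhds (hlim h1 h3)
        (fun _ => zero_le) fun n => ?_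
      refine le_trans (le_of_eq ?_) (eLpNorm_add_le
        ((hφ n).1.continuous.aestronglyMeasurable.sub h.memLp.aestronglyMeasurable)
        ((hψ n).1.continuous.aestronglyMeasurable.sub h'.memLp.aestronglyMeasurable) hp')
      congr 1; ext x; simp; ring
    · refine tendsto_of_tendsto_of_tendsto_of_le_of_le tendsto_const_nhds (hlim h2 h4)
        (fun _ => zero_le) fun n => ?_
      refine le_trans (le_of_eq ?_) (eLpNorm_add_le
        ((continuous_gradient_of_contDiff (hφ n).contDiff_one).aestronglyMeasurable.sub
          h.memLp_grad.aestronglyMeasurable)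
        ((continuous_gradient_of_contDiff (hψ n).contDiff_one).aestronglyMeasurable.sub
          h'.memLp_grad.aestronglyMeasurable) hp')
      congr 1; ext1 x
      simp only [Pi.sub_apply, Pi.add_apply, gradient_add' (hφ n).contDiff_one (hψ n).contDiff_one]
      abel

lemma HasSobolevGradient.of_tendsto (hp : 1 ≤ p) {u' : ℕ → Eucl N → ℝ}
    {g' : ℕ → Eucl N → Eucl N} (h : ∀ n, HasSobolevGradient Ω p (u' n) (g' n))
    (hu : MemLp u (ENNReal.ofReal p) (volume.restrict Ω))
    (hg : MemLp g (ENNReal.ofReal p) (volume.restrict Ω))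
    (hul : Tendsto (fun n => eLpNorm (u' n - u) (ENNReal.ofReal p) (volume.restrict Ω)) atTop (𝓝 0))
    (hgl : Tendsto (fun n => eLpNorm (g' n - g) (ENNReal.ofReal p) (volume.restrict Ω))
      atTop (𝓝 0)) : HasSobolevGradient Ω p u g := by
  refine ⟨hu, hg, fun φ hφ => ?_⟩
  have hφ1 := hφ.contDiff_one
  obtain ⟨C, -, hC1, hC2⟩ := exists_bound_of_contDiff hφ1 hφ.2.1
  have l1 : Tendsto (fun n => ∫ x in Ω, u' n x • gradient φ x) atTop
      (𝓝 (∫ x in Ω, u x • gradient φ x)) := by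
    refine tendsto_integral_of_norm_sub_le (C := C) hp
      (fun n => integrable_smul_gradient hp hφ1 hφ.2.1 (h n).memLp)
      (integrable_smul_gradient hp hφ1 hφ.2.1 hu)
      (fun n => ((h n).memLp.sub hu).aestronglyMeasurable)
      (fun n => Eventually.of_forall fun x => ?_) hul
    rw [← sub_smul, norm_smul, mul_comm]
    exact mul_le_mul_of_nonneg_right (hC2 x) (norm_nonneg _)
  have l2 : Tendsto (fun n => ∫ x in Ω, φ x • g' n x) atTop (𝓝 (∫ x in Ω, φ x • g x)) := by
    refine tendsto_integral_of_norm_sub_le (C := C) hp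
      (fun n => integrable_test_smul hp hφ1 hφ.2.1 (h n).memLp_grad)
      (integrable_test_smul hp hφ1 hφ.2.1 hg)
      (fun n => ((h n).memLp_grad.sub hg).aestronglyMeasurable)
      (fun n => Eventually.of_forall fun x => ?_) hgl
    rw [← smul_sub, norm_smul]
    exact mul_le_mul_of_nonneg_right (hC1 x) (norm_nonneg _)
  exact tendsto_nhds_unique l1 (l2.neg.congr fun n => ((h n).isWeakGradient φ hφ).symm)

/-- In the Dirichlet case a test function within `1 / (n + 1)` of the `n`-th term is selected, and
the triangle inequality concludes. Through this closedness the absolute value and the vanishing of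
gradients on zero sets are obtained from `C¹` approximations. -/
lemma InEnergySpace.of_tendsto (hp : 1 ≤ p) {B : BoundaryCondition} {u' : ℕ → Eucl N → ℝ}
    {g' : ℕ → Eucl N → Eucl N} (h : ∀ n, InEnergySpace B Ω p (u' n) (g' n))
    (hu : MemLp u (ENNReal.ofReal p) (volume.restrict Ω))
    (hg : MemLp g (ENNReal.ofReal p) (volume.restrict Ω))
    (hul : Tendsto (fun n => eLpNorm (u' n - u) (ENNReal.ofReal p) (volume.restrict Ω)) atTop (𝓝 0))
    (hgl : Tendsto (fun n => eLpNorm (g' n - g) (ENNReal.ofReal p) (volume.restrict Ω))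
      atTop (𝓝 0)) : InEnergySpace B Ω p u g := by
  refine ⟨HasSobolevGradient.of_tendsto hp (fun n => (h n).1) hu hg hul hgl, fun hB => ?_⟩
  have hp' : 1 ≤ ENNReal.ofReal p := by simpa using hp
  have hpos (n : ℕ) : (0 : ENNReal) < ((n : ENNReal) + 1)⁻¹ := by simp
  have hlim : Tendsto (fun n : ℕ => ((n : ENNReal) + 1)⁻¹) atTop (𝓝 0) := by
    have := (ENNReal.tendsto_inv_nat_nhds_zero).comp (tendsto_add_atTop_nat 1)
    refine this.congr fun n => by simp
  have hex (n : ℕ) : ∃ φ, IsTestFunction Ω φ ∧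
      eLpNorm (φ - u' n) (ENNReal.ofReal p) (volume.restrict Ω) < ((n : ENNReal) + 1)⁻¹ ∧
      eLpNorm (gradient φ - g' n) (ENNReal.ofReal p) (volume.restrict Ω)
        < ((n : ENNReal) + 1)⁻¹ := by
    obtain ⟨φ, hφ, h1, h2⟩ := (h n).approx hB
    obtain ⟨m, hm1, hm2⟩ := ((h1.eventually (gt_mem_nhds (hpos n))).and
        (h2.eventually (gt_mem_nhds (hpos n)))).exists
    exact ⟨φ m, hφ m, hm1, hm2⟩
  choose φ hφ h1 h2 using hex
  refine ⟨φ, hφ, ?_, ?_⟩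
  · have := hlim.add hul
    rw [add_zero] at this
    refine tendsto_of_tendsto_of_tendsto_of_le_of_le tendsto_const_nhds this
      (fun _ => zero_le) fun n => ?_
    have e : φ n - u = (φ n - u' n) + (u' n - u) := by abel
    rw [e]
    exact (eLpNorm_add_le ((hφ n).1.continuous.aestronglyMeasurable.sub
      (h n).memLp.aestronglyMeasurable) ((h n).memLp.sub hu).aestronglyMeasurable hp').trans
      (add_le_add_left (h1 n).le _)
  · have := hlim.add hgl
    rw [add_zero] at this
    refine tendsto_of_tendsto_of_tendsto_of_le_of_le tendsto_const_nhds this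
      (fun _ => zero_le) fun n => ?_
    have e : gradient (φ n) - g = (gradient (φ n) - g' n) + (g' n - g) := by abel
    rw [e]
    exact (eLpNorm_add_le
      ((continuous_gradient_of_contDiff (hφ n).contDiff_one).aestronglyMeasurable.sub
      (h n).memLp_grad.aestronglyMeasurable)
      ((h n).memLp_grad.sub hg).aestronglyMeasurable hp').trans
      (add_le_add_left (h2 n).le _)

/-- A cutoff function turns a Sobolev function on `Ω` into one on the whole space with compact
support in `Ω`, which mollification approximates. Hence the product satisfies even the Dirichlet
condition, whatever `B` is. -/
lemma HasSobolevGradient.cutoff_mul (hp : 1 ≤ p) (hΩ : IsOpen Ω) (B : BoundaryCondition)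
    (h : HasSobolevGradient Ω p u g) {χ : Eucl N → ℝ} (hχ : IsTestFunction Ω χ) :
    InEnergySpace B Ω p (fun x => χ x * u x) (fun x => χ x • g x + u x • gradient χ x) := by
  have hχ1 := hχ.contDiff_one
  have hzero : ∀ x ∉ Ω, χ x = 0 := fun x hx =>
    image_eq_zero_of_notMem_tsupport fun h => hx (hχ.2.2 h)
  have hzero' : ∀ x ∉ Ω, gradient χ x = 0 := fun x hx => by
    by_contra hne
    exact hx (hχ.2.2 (support_gradient_subset χ hne))
  obtain ⟨C, -, hC1, hC2⟩ := exists_bound_of_contDiff hχ1 hχ.2.1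
  have m1 : MemLp (fun x => χ x * u x) (ENNReal.ofReal p) (volume.restrict Ω) :=
    h.memLp.of_le_mul (c := C)
      (hχ1.continuous.aestronglyMeasurable.mul h.memLp.aestronglyMeasurable)
      (Eventually.of_forall fun x => by
        rw [norm_mul]; exact mul_le_mul_of_nonneg_right (hC1 x) (norm_nonneg _))
  have m2 : MemLp (fun x => χ x • g x + u x • gradient χ x) (ENNReal.ofReal p)
      (volume.restrict Ω) := by
    refine MemLp.add ?_ ?_
    · refine h.memLp_grad.of_le_mul (c := C)
        (hχ1.continuous.aestronglyMeasurable.smul h.memLp_grad.aestronglyMeasurable)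
        (Eventually.of_forall fun x => ?_)
      rw [norm_smul]
      exact mul_le_mul_of_nonneg_right (hC1 x) (norm_nonneg _)
    · refine h.memLp.of_le_mul (c := C) (h.memLp.aestronglyMeasurable.smul
        (continuous_gradient_of_contDiff hχ1).aestronglyMeasurable)
        (Eventually.of_forall fun x => ?_)
      rw [norm_smul, mul_comm]
      exact mul_le_mul_of_nonneg_right (hC2 x) (norm_nonneg _)
  have hext {E : Type} [NormedAddCommGroup E] {f : Eucl N → E} (hf : ∀ x ∉ Ω, f x = 0)
      (hm : MemLp f (ENNReal.ofReal p) (volume.restrict Ω)) :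
      MemLp f (ENNReal.ofReal p) volume := by
    rw [← memLp_indicator_iff_restrict hΩ.measurableSet] at hm
    rwa [indicator_eq_self.2 fun x hx => by_contra fun hn => hx (hf x hn)] at hm
  have M1 := hext (fun x hx => by simp [hzero x hx]) m1
  have M2 := hext (fun x hx => by simp [hzero x hx, hzero' x hx]) m2
  -- Here `φ` need not be supported in `Ω`, since `χ φ` is. The identity thus gives the weak
  -- gradient both in `Ω` and on the whole space.
  have hw (φ : Eucl N → ℝ) (hφ : ContDiff ℝ ∞ φ) (hφc : HasCompactSupport φ) :
      ∫ x in Ω, (χ x * u x) • gradient φ x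
        = - ∫ x in Ω, φ x • (χ x • g x + u x • gradient χ x) := by
    have hφ1 : ContDiff ℝ 1 φ := hφ.of_le (by exact_mod_cast le_top)
    have htest : IsTestFunction Ω (fun x => χ x * φ x) :=
      ⟨hχ.1.mul hφ, hχ.2.1.mul_right, (tsupport_mul_subset_left).trans hχ.2.2⟩
    have := h.isWeakGradient _ htest
    simp_rw [gradient_mul' hχ1 hφ1] at this
    have k1 : Integrable (fun x => (χ x * u x) • gradient φ x) (volume.restrict Ω) :=
      integrable_smul_gradient hp hφ1 hφc m1
    have hφu : MemLp (fun x => φ x * u x) (ENNReal.ofReal p) (volume.restrict Ω) := by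
      obtain ⟨C', -, hC', -⟩ := exists_bound_of_contDiff hφ1 hφc
      exact h.memLp.of_le_mul (c := C')
        (hφ1.continuous.aestronglyMeasurable.mul h.memLp.aestronglyMeasurable)
        (Eventually.of_forall fun x => by
          rw [norm_mul]; exact mul_le_mul_of_nonneg_right (hC' x) (norm_nonneg _))
    have k2 : Integrable (fun x => (φ x * u x) • gradient χ x) (volume.restrict Ω) :=
      integrable_smul_gradient hp hχ1 hχ.2.1 hφu
    have k3 : Integrable (fun x => (χ x * φ x) • g x) (volume.restrict Ω) :=
      integrable_test_smul hp htest.contDiff_one htest.2.1 h.memLp_grad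
    have e1 : ∀ x, u x • (χ x • gradient φ x + φ x • gradient χ x)
        = (χ x * u x) • gradient φ x + (φ x * u x) • gradient χ x := fun x => by module
    have e2 : ∀ x, φ x • (χ x • g x + u x • gradient χ x)
        = (χ x * φ x) • g x + (φ x * u x) • gradient χ x := fun x => by module
    simp_rw [e1] at this
    simp_rw [e2]
    rw [integral_add k1 k2] at this
    rw [integral_add k3 k2, neg_add, ← this]
    abel
  refine ⟨⟨m1, m2, fun φ hφ => hw φ hφ.1 hφ.2.1⟩, fun _ => ?_⟩
  refine approxByTest_of_global hp hΩ hχ.2.1 hχ.2.2 M1 M2 (fun φ hφ => ?_) ?_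
  · have := hw φ hφ.1 hφ.2.1
    rw [setIntegral_eq_integral_of_forall_compl_eq_zero,
      setIntegral_eq_integral_of_forall_compl_eq_zero] at this
    · simpa using this
    · intro x hx; simp [hzero x hx, hzero' x hx]
    · intro x hx; simp [hzero x hx]
  · intro x hx
    refine subset_tsupport χ ?_
    intro h0
    simp [h0] at hx

end EnergySpace

/-! ### Chain rule for `C¹` functions of two Sobolev functions -/

section ChainRule

/-- `F` is a `C^1` function of two variables vanishing at the origin, with partial derivatives
`F₁`, `F₂` bounded by `C`. -/
structure C1Bounded (F F₁ F₂ : ℝ → ℝ → ℝ) (C : ℝ) : Prop where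
  hasFDerivAt : ∀ s t, HasFDerivAt (fun z : ℝ × ℝ => F z.1 z.2)
    (F₁ s t • ContinuousLinearMap.fst ℝ ℝ ℝ + F₂ s t • ContinuousLinearMap.snd ℝ ℝ ℝ) (s, t)
  continuous_fst : Continuous fun z : ℝ × ℝ => F₁ z.1 z.2
  continuous_snd : Continuous fun z : ℝ × ℝ => F₂ z.1 z.2
  bound_fst : ∀ s t, |F₁ s t| ≤ C
  bound_snd : ∀ s t, |F₂ s t| ≤ C
  zero : F 0 0 = 0

variable {F F₁ F₂ : ℝ → ℝ → ℝ} {C : ℝ}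

lemma C1Bounded.of_single {f f' : ℝ → ℝ} (hf : ∀ s, HasDerivAt f (f' s) s) (hc : Continuous f')
    (hb : ∀ s, |f' s| ≤ C) (h0 : f 0 = 0) :
    C1Bounded (fun s _ => f s) (fun s _ => f' s) (fun _ _ => 0) C where
  hasFDerivAt s t := by
    have := (hf s).comp_hasFDerivAt (s, t) (hasFDerivAt_fst (𝕜 := ℝ) (E := ℝ) (F := ℝ) (p := (s, t)))
    simp only [zero_smul, add_zero]
    exact this
  continuous_fst := hc.comp _root_.continuous_fst
  continuous_snd := continuous_const
  bound_fst s _ := hb s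
  bound_snd s _ := by simpa using (abs_nonneg _).trans (hb s)
  zero := h0

lemma C1Bounded.contDiff (h : C1Bounded F F₁ F₂ C) :
    ContDiff ℝ 1 fun z : ℝ × ℝ => F z.1 z.2 := by
  rw [contDiff_one_iff_hasFDerivAt]
  exact ⟨fun z => F₁ z.1 z.2 • ContinuousLinearMap.fst ℝ ℝ ℝ
    + F₂ z.1 z.2 • ContinuousLinearMap.snd ℝ ℝ ℝ,
    (h.continuous_fst.smul continuous_const).add (h.continuous_snd.smul continuous_const),
    fun z => h.hasFDerivAt z.1 z.2⟩

lemma C1Bounded.abs_sub_le (h : C1Bounded F F₁ F₂ C) (s t s' t' : ℝ) :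
    |F s t - F s' t'| ≤ 2 * C * (|s - s'| + |t - t'|) := by
  have hC : 0 ≤ C := (abs_nonneg _).trans (h.bound_fst 0 0)
  have hb : ∀ z ∈ (univ : Set (ℝ × ℝ)), ‖F₁ z.1 z.2 • ContinuousLinearMap.fst ℝ ℝ ℝ
      + F₂ z.1 z.2 • ContinuousLinearMap.snd ℝ ℝ ℝ‖ ≤ 2 * C := by
    intro z _
    refine (norm_add_le _ _).trans ?_
    rw [norm_smul, norm_smul]
    have h1 := ContinuousLinearMap.norm_fst_le ℝ ℝ ℝ
    have h2 := ContinuousLinearMap.norm_snd_le ℝ ℝ ℝ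
    have h3 := h.bound_fst z.1 z.2
    have h4 := h.bound_snd z.1 z.2
    have h5 : ‖F₁ z.1 z.2‖ * ‖ContinuousLinearMap.fst ℝ ℝ ℝ‖ ≤ C * 1 :=
      mul_le_mul h3 h1 (norm_nonneg _) hC
    have h6 : ‖F₂ z.1 z.2‖ * ‖ContinuousLinearMap.snd ℝ ℝ ℝ‖ ≤ C * 1 :=
      mul_le_mul h4 h2 (norm_nonneg _) hC
    linarith
  have := convex_univ.norm_image_sub_le_of_norm_hasFDerivWithin_le (𝕜 := ℝ)
    (f := fun z : ℝ × ℝ => F z.1 z.2) (fun z _ => (h.hasFDerivAt z.1 z.2).hasFDerivWithinAt) hb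
    (mem_univ (s', t')) (mem_univ (s, t))
  refine this.trans ?_
  have : ‖(s, t) - (s', t')‖ ≤ |s - s'| + |t - t'| := by
    rw [Prod.mk_sub_mk, Prod.norm_mk]
    exact max_le (le_add_of_nonneg_right (abs_nonneg _)) (le_add_of_nonneg_left (abs_nonneg _))
  gcongr

variable {N : ℕ} {Ω : Set (Eucl N)} {p : ℝ} {u v : Eucl N → ℝ} {g k : Eucl N → Eucl N}

lemma C1Bounded.hasGradientAt (h : C1Bounded F F₁ F₂ C) {φ ψ : Eucl N → ℝ} (hφ : ContDiff ℝ 1 φ)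
    (hψ : ContDiff ℝ 1 ψ) (x : Eucl N) :
    gradient (fun x => F (φ x) (ψ x)) x
      = F₁ (φ x) (ψ x) • gradient φ x + F₂ (φ x) (ψ x) • gradient ψ x := by
  refine ext_inner_right ℝ fun w => ?_
  have h1 := (hφ.differentiable one_ne_zero x).hasFDerivAt
  have h2 := (hψ.differentiable one_ne_zero x).hasFDerivAt
  have h3 := (h.hasFDerivAt (φ x) (ψ x)).comp x (h1.prodMk h2)
  rw [inner_add_left, real_inner_smul_left, real_inner_smul_left, inner_gradient_eq,
    inner_gradient_eq, inner_gradient_eq]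
  rw [show (fun x => F (φ x) (ψ x)) = (fun z : ℝ × ℝ => F z.1 z.2) ∘ fun x => (φ x, ψ x) from rfl,
    h3.fderiv]
  simp

lemma C1Bounded.inEnergySpace_of_contDiff (hp : 1 ≤ p) (hΩ : IsOpen Ω) (B : BoundaryCondition)
    (h : C1Bounded F F₁ F₂ C) {φ ψ : Eucl N → ℝ}
    (hφ : IsTestFunction Ω φ) (hψ : IsTestFunction Ω ψ) :
    InEnergySpace B Ω p (fun x => F (φ x) (ψ x))
      (fun x => F₁ (φ x) (ψ x) • gradient φ x + F₂ (φ x) (ψ x) • gradient ψ x) := by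
  have hd : ContDiff ℝ 1 fun x => F (φ x) (ψ x) :=
    h.contDiff.comp (hφ.contDiff_one.prodMk hψ.contDiff_one)
  have hsub : Function.support (fun x => F (φ x) (ψ x)) ⊆ tsupport φ ∪ tsupport ψ := by
    intro x hx
    by_contra hn
    rw [mem_union, not_or] at hn
    apply hx
    simp only [image_eq_zero_of_notMem_tsupport hn.1, image_eq_zero_of_notMem_tsupport hn.2, h.zero]
  have hcl : IsCompact (tsupport φ ∪ tsupport ψ) := hφ.2.1.isCompact.union hψ.2.1.isCompact
  have := SubhomPLap.inEnergySpace_of_contDiff hp hΩ B hd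
    (HasCompactSupport.of_support_subset_isCompact hcl hsub)
    ((closure_minimal hsub hcl.isClosed).trans (union_subset hφ.2.2 hψ.2.2))
  rwa [show gradient (fun x => F (φ x) (ψ x)) = _ from
    funext (h.hasGradientAt hφ.contDiff_one hψ.contDiff_one)] at this

/-- The difference splits as `a n • (f n - f₀) + (a n - a₀) • f₀`. The first part is small because
the coefficients are bounded; the second by dominated convergence, so a.e. convergence of the
coefficients suffices. -/
lemma tendsto_eLpNorm_smul_sub {α E : Type*} [MeasurableSpace α] {μ : Measure α}
    [NormedAddCommGroup E] [NormedSpace ℝ E] (hp : 1 ≤ p) {a : ℕ → α → ℝ} {a₀ : α → ℝ}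
    {f : ℕ → α → E} {f₀ : α → E} (ha : ∀ n, AEStronglyMeasurable (a n) μ)
    (ha₀ : AEStronglyMeasurable a₀ μ) (hb : ∀ n x, |a n x| ≤ C) (hb₀ : ∀ x, |a₀ x| ≤ C)
    (hf : ∀ n, AEStronglyMeasurable (f n) μ) (hf₀ : MemLp f₀ (ENNReal.ofReal p) μ)
    (hal : ∀ᵐ x ∂μ, Tendsto (fun n => a n x) atTop (𝓝 (a₀ x)))
    (hfl : Tendsto (fun n => eLpNorm (f n - f₀) (ENNReal.ofReal p) μ) atTop (𝓝 0)) :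
    Tendsto (fun n => eLpNorm (fun x => a n x • f n x - a₀ x • f₀ x) (ENNReal.ofReal p) μ)
      atTop (𝓝 0) := by
  have h1 : Tendsto (fun n => eLpNorm (fun x => (a n x - a₀ x) • f₀ x) (ENNReal.ofReal p) μ)
      atTop (𝓝 0) := by
    refine tendsto_eLpNorm_zero_of_dominated (by linarith) (G := fun x => 2 * C * ‖f₀ x‖)
      (fun n => ((ha n).sub ha₀).smul hf₀.aestronglyMeasurable)
      (hf₀.norm.const_mul _) (fun n => Eventually.of_forall fun x => ?_) ?_
    · rw [norm_smul]
      gcongr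
      have := abs_sub (a n x) (a₀ x)
      rw [Real.norm_eq_abs]
      linarith [hb n x, hb₀ x]
    · filter_upwards [hal] with x hx
      have := (hx.sub_const (a₀ x)).smul_const (f₀ x)
      simpa using this
  have h2 : Tendsto (fun n => ENNReal.ofReal C * eLpNorm (f n - f₀) (ENNReal.ofReal p) μ)
      atTop (𝓝 0) := by
    simpa using ENNReal.Tendsto.const_mul hfl (a := ENNReal.ofReal C) (Or.inr ENNReal.ofReal_ne_top)
  have h3 := h2.add h1
  rw [add_zero] at h3
  refine tendsto_of_tendsto_of_tendsto_of_le_of_le tendsto_const_nhds h3 (fun _ => zero_le)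
    fun n => ?_
  have e : (fun x => a n x • f n x - a₀ x • f₀ x)
      = (fun x => a n x • (f n - f₀) x) + fun x => (a n x - a₀ x) • f₀ x := by
    ext1 x; simp only [Pi.add_apply, Pi.sub_apply]; module
  rw [e]
  refine (eLpNorm_add_le ((ha n).smul ((hf n).sub hf₀.aestronglyMeasurable))
    (((ha n).sub ha₀).smul hf₀.aestronglyMeasurable) (by simpa using hp)).trans ?_
  refine add_le_add ?_ le_rfl
  refine eLpNorm_le_mul_eLpNorm_of_ae_le_mul (Eventually.of_forall fun x => ?_) _
  refine (norm_smul (a n x) ((f n - f₀) x)).trans_le ?_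
  exact mul_le_mul_of_nonneg_right (hb n x) (norm_nonneg _)

lemma C1Bounded.memLp {α : Type*} [MeasurableSpace α] {μ : Measure α} (h : C1Bounded F F₁ F₂ C)
    {u v : α → ℝ} {r : ENNReal} (hu : MemLp u r μ) (hv : MemLp v r μ) :
    MemLp (fun x => F (u x) (v x)) r μ := by
  refine (hu.norm.add hv.norm).of_le_mul (c := 2 * C)
    (h.contDiff.continuous.comp_aestronglyMeasurable (hu.1.prodMk hv.1))
    (Eventually.of_forall fun x => ?_)
  have := h.abs_sub_le (u x) (v x) 0 0
  rw [h.zero, sub_zero, sub_zero, sub_zero] at this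
  rw [Pi.add_apply, Real.norm_of_nonneg (r := ‖u x‖ + ‖v x‖) (by positivity)]
  exact this

lemma memLp_bdd_smul {α E : Type*} [MeasurableSpace α] {μ : Measure α}
    [NormedAddCommGroup E] [NormedSpace ℝ E] {a : α → ℝ} {f : α → E} {r : ENNReal}
    (ha : AEStronglyMeasurable a μ) (hb : ∀ x, |a x| ≤ C) (hf : MemLp f r μ) :
    MemLp (fun x => a x • f x) r μ :=
  hf.of_le_mul (c := C) (ha.smul hf.1) (Eventually.of_forall fun x => by
    rw [norm_smul]; exact mul_le_mul_of_nonneg_right (hb x) (norm_nonneg _))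

lemma exists_cutoff (hΩ : IsOpen Ω) {K : Set (Eucl N)} (hK : IsCompact K) (hKΩ : K ⊆ Ω) :
    ∃ χ : Eucl N → ℝ, IsTestFunction Ω χ ∧ ∀ x ∈ K, χ x = 1 ∧ gradient χ x = 0 := by
  obtain ⟨L, hL, hKL, hLΩ⟩ := exists_compact_between hK hΩ hKΩ
  obtain ⟨f, hf1, hf0, -⟩ := exists_contMDiffMap_one_nhds_of_subset_interior (n := (⊤ : ℕ∞))
    (modelWithCornersSelf ℝ (Eucl N)) hK.isClosed hKL
  have hs : Function.support f ⊆ L := fun x hx => by_contra fun hn => hx (hf0 x hn)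
  refine ⟨f, ⟨f.contMDiff.contDiff, HasCompactSupport.of_support_subset_isCompact hL hs,
    (closure_minimal hs hL.isClosed).trans hLΩ⟩, fun x hx => ?_⟩
  have h1 : ∀ᶠ y in 𝓝 x, f y = 1 := hf1.filter_mono (nhds_le_nhdsSet hx)
  refine ⟨h1.self_of_nhds, ?_⟩
  have h2 : f =ᶠ[𝓝 x] fun _ => (1 : ℝ) := h1
  rw [h2.gradient_eq, gradient_fun_const]

variable [IsFiniteMeasure (volume.restrict Ω)]

/-- The chain rule is classical for test functions and passes to the limit: `F` is Lipschitz, and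
its partial derivatives are bounded and continuous. Since the compositions have compact support in
`Ω`, the conclusion holds for either `B`. -/
lemma C1Bounded.inEnergySpace_of_approx (hp : 1 ≤ p) (hΩ : IsOpen Ω) (B : BoundaryCondition)
    (h : C1Bounded F F₁ F₂ C) (hu : MemLp u (ENNReal.ofReal p) (volume.restrict Ω))
    (hv : MemLp v (ENNReal.ofReal p) (volume.restrict Ω))
    (hg : MemLp g (ENNReal.ofReal p) (volume.restrict Ω))
    (hk : MemLp k (ENNReal.ofReal p) (volume.restrict Ω))
    (hua : ApproxByTest Ω p u g) (hva : ApproxByTest Ω p v k) :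
    InEnergySpace B Ω p (fun x => F (u x) (v x))
      (fun x => F₁ (u x) (v x) • g x + F₂ (u x) (v x) • k x) := by
  set μ := volume.restrict Ω with hμ
  have hp0 : ENNReal.ofReal p ≠ 0 := by simp; linarith
  have hp1 : 1 ≤ ENNReal.ofReal p := by simpa using hp
  obtain ⟨φ, hφ, hφu, hφg⟩ := hua
  obtain ⟨ψ, hψ, hψv, hψk⟩ := hva
  have cm {f : Eucl N → ℝ} (hf : Continuous f) : AEStronglyMeasurable f μ := hf.aestronglyMeasurable
  -- Two successive extractions give a common subsequence along which both approximations converge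
  -- a.e., as the coefficients `F₁` and `F₂` require.
  obtain ⟨ns, hns, hnsl⟩ := (tendstoInMeasure_of_tendsto_eLpNorm hp0
    (fun n => cm (hφ n).1.continuous) hu.1 hφu).exists_seq_tendsto_ae
  obtain ⟨ms, hms, hmsl⟩ := (tendstoInMeasure_of_tendsto_eLpNorm hp0
    (fun n => cm (hψ (ns n)).1.continuous) hv.1
    (hψv.comp hns.tendsto_atTop)).exists_seq_tendsto_ae
  set js : ℕ → ℕ := fun n => ns (ms n) with hjs
  have hjs' : Tendsto js atTop atTop := hns.tendsto_atTop.comp hms.tendsto_atTop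
  have hae : ∀ᵐ x ∂μ, Tendsto (fun n => (φ (js n) x, ψ (js n) x)) atTop (𝓝 (u x, v x)) := by
    filter_upwards [hnsl, hmsl] with x hx hx'
    exact (hx.comp hms.tendsto_atTop).prodMk_nhds hx'
  have hpm : AEStronglyMeasurable (fun x => (u x, v x)) μ := hu.1.prodMk hv.1
  have hpn (n : ℕ) : AEStronglyMeasurable (fun x => (φ (js n) x, ψ (js n) x)) μ :=
    (cm (hφ _).1.continuous).prodMk (cm (hψ _).1.continuous)
  have hgm (n : ℕ) : AEStronglyMeasurable (gradient (φ (js n))) μ :=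
    (continuous_gradient_of_contDiff (hφ _).contDiff_one).aestronglyMeasurable
  have hkm (n : ℕ) : AEStronglyMeasurable (gradient (ψ (js n))) μ :=
    (continuous_gradient_of_contDiff (hψ _).contDiff_one).aestronglyMeasurable
  have m1 : MemLp (fun x => F₁ (u x) (v x) • g x) (ENNReal.ofReal p) μ :=
    memLp_bdd_smul (h.continuous_fst.comp_aestronglyMeasurable hpm) (fun x => h.bound_fst _ _) hg
  have m2 : MemLp (fun x => F₂ (u x) (v x) • k x) (ENNReal.ofReal p) μ :=
    memLp_bdd_smul (h.continuous_snd.comp_aestronglyMeasurable hpm) (fun x => h.bound_snd _ _) hk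
  refine InEnergySpace.of_tendsto hp
    (fun n => h.inEnergySpace_of_contDiff hp hΩ B (hφ (js n)) (hψ (js n)))
    (h.memLp hu hv) (m1.add m2) ?_ ?_
  · have h1 := (hφu.comp hjs').add (hψv.comp hjs')
    rw [add_zero] at h1
    have h2 := ENNReal.Tendsto.const_mul h1 (a := ENNReal.ofReal (2 * C))
      (Or.inr ENNReal.ofReal_ne_top)
    rw [mul_zero] at h2
    refine tendsto_of_tendsto_of_tendsto_of_le_of_le tendsto_const_nhds h2 (fun _ => zero_le)
      fun n => ?_
    have a1 : AEStronglyMeasurable (φ (js n) - u) μ := (cm (hφ _).1.continuous).sub hu.1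
    have a2 : AEStronglyMeasurable (ψ (js n) - v) μ := (cm (hψ _).1.continuous).sub hv.1
    have h3 : eLpNorm (fun x => ‖(φ (js n) - u) x‖ + ‖(ψ (js n) - v) x‖) (ENNReal.ofReal p) μ
        ≤ eLpNorm (φ (js n) - u) (ENNReal.ofReal p) μ
          + eLpNorm (ψ (js n) - v) (ENNReal.ofReal p) μ := by
      refine (eLpNorm_add_le a1.norm a2.norm hp1).trans ?_
      rw [eLpNorm_norm, eLpNorm_norm]
    refine le_trans ?_ (mul_le_mul_right h3 _)
    refine eLpNorm_le_mul_eLpNorm_of_ae_le_mul (Eventually.of_forall fun x => ?_) _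
    rw [Real.norm_of_nonneg (r := ‖(φ (js n) - u) x‖ + ‖(ψ (js n) - v) x‖) (by positivity)]
    exact h.abs_sub_le _ _ _ _
  · have t1 := tendsto_eLpNorm_smul_sub (C := C) hp
      (fun n => h.continuous_fst.comp_aestronglyMeasurable (hpn n))
      (h.continuous_fst.comp_aestronglyMeasurable hpm) (fun n x => h.bound_fst _ _)
      (fun x => h.bound_fst _ _) hgm hg
      (hae.mono fun x hx => (h.continuous_fst.tendsto (u x, v x)).comp hx) (hφg.comp hjs')
    have t2 := tendsto_eLpNorm_smul_sub (C := C) hp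
      (fun n => h.continuous_snd.comp_aestronglyMeasurable (hpn n))
      (h.continuous_snd.comp_aestronglyMeasurable hpm) (fun n x => h.bound_snd _ _)
      (fun x => h.bound_snd _ _) hkm hk
      (hae.mono fun x hx => (h.continuous_snd.tendsto (u x, v x)).comp hx) (hψk.comp hjs')
    have t3 := t1.add t2
    rw [add_zero] at t3
    refine tendsto_of_tendsto_of_tendsto_of_le_of_le tendsto_const_nhds t3 (fun _ => zero_le)
      fun n => ?_
    refine le_trans (le_of_eq ?_) (eLpNorm_add_le
      (((h.continuous_fst.comp_aestronglyMeasurable (hpn n)).smul (hgm n)).sub m1.1)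
      (((h.continuous_snd.comp_aestronglyMeasurable (hpn n)).smul (hkm n)).sub m2.1) hp1)
    congr 1
    ext1 x
    simp only [Pi.sub_apply, Pi.add_apply]
    abel

/-- Chain rule in the energy space. -/
lemma InEnergySpace.comp (hp : 1 ≤ p) (hΩ : IsOpen Ω) {B : BoundaryCondition}
    (h : C1Bounded F F₁ F₂ C) (hu : InEnergySpace B Ω p u g) (hv : InEnergySpace B Ω p v k) :
    InEnergySpace B Ω p (fun x => F (u x) (v x))
      (fun x => F₁ (u x) (v x) • g x + F₂ (u x) (v x) • k x) := by
  cases B with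
  | dirichlet =>
    exact h.inEnergySpace_of_approx hp hΩ _ hu.memLp hv.memLp hu.memLp_grad hv.memLp_grad
      (hu.approx rfl) (hv.approx rfl)
  | neumann =>
    have hpm : AEStronglyMeasurable (fun x => (u x, v x)) (volume.restrict Ω) :=
      hu.memLp.1.prodMk hv.memLp.1
    refine ⟨⟨h.memLp hu.memLp hv.memLp, MemLp.add
      (memLp_bdd_smul (h.continuous_fst.comp_aestronglyMeasurable hpm) (fun x => h.bound_fst _ _)
        hu.memLp_grad)
      (memLp_bdd_smul (h.continuous_snd.comp_aestronglyMeasurable hpm) (fun x => h.bound_snd _ _)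
        hv.memLp_grad), fun φ hφ => ?_⟩, by simp⟩
    -- The weak gradient identity is local: against `φ`, the functions `u` and `v` may be replaced
    -- by `χ u` and `χ v` with `χ = 1` and `∇χ = 0` on the support of `φ`, and these are limits of
    -- test functions.
    obtain ⟨χ, hχ, hχ1⟩ := exists_cutoff hΩ hφ.2.1 hφ.2.2
    have cu := hu.cutoff_mul hp hΩ BoundaryCondition.dirichlet hχ
    have cv := hv.cutoff_mul hp hΩ BoundaryCondition.dirichlet hχ
    have key := (h.inEnergySpace_of_approx hp hΩ BoundaryCondition.dirichlet cu.memLp cv.memLp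
      cu.memLp_grad cv.memLp_grad (cu.approx rfl) (cv.approx rfl)).isWeakGradient φ hφ
    have e1 : ∀ x, F (u x) (v x) • gradient φ x
        = F (χ x * u x) (χ x * v x) • gradient φ x := fun x => by
      by_cases hx : x ∈ tsupport φ
      · simp only [(hχ1 x hx).1, one_mul]
      · rw [Function.notMem_support.1 fun h' => hx (support_gradient_subset φ h'), smul_zero, smul_zero]
    have e2 : ∀ x, φ x • (F₁ (u x) (v x) • g x + F₂ (u x) (v x) • k x)
        = φ x • (F₁ (χ x * u x) (χ x * v x) • (χ x • g x + u x • gradient χ x)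
          + F₂ (χ x * u x) (χ x * v x) • (χ x • k x + v x • gradient χ x)) := fun x => by
      by_cases hx : x ∈ tsupport φ
      · simp only [(hχ1 x hx).1, (hχ1 x hx).2, one_mul, one_smul, smul_zero, add_zero]
      · rw [image_eq_zero_of_notMem_tsupport hx, zero_smul, zero_smul]
    simp_rw [e1, e2]
    exact key

lemma InEnergySpace.comp_single (hp : 1 ≤ p) (hΩ : IsOpen Ω) {B : BoundaryCondition}
    {f f' : ℝ → ℝ} (hf : ∀ s, HasDerivAt f (f' s) s) (hc : Continuous f')
    (hb : ∀ s, |f' s| ≤ C) (h0 : f 0 = 0) (hu : InEnergySpace B Ω p u g) :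
    InEnergySpace B Ω p (fun x => f (u x)) (fun x => f' (u x) • g x) := by
  simpa using hu.comp hp hΩ (C1Bounded.of_single hf hc hb h0) hu

end ChainRule

/-! ### Absolute value, positive part and gradients on zero sets -/

section Lattice

variable {N : ℕ} {Ω : Set (Eucl N)} {p : ℝ} {u v : Eucl N → ℝ} {g k : Eucl N → Eucl N}
  [IsFiniteMeasure (volume.restrict Ω)] {B : BoundaryCondition}

/-- The shift by `δ` makes this smooth approximation of `|s|` vanish at 0, as the chain rule
demands. -/
lemma hasDerivAt_sqrt_sq_add {δ : ℝ} (hδ : 0 < δ) (s : ℝ) :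
    HasDerivAt (fun s => √(s ^ 2 + δ ^ 2) - δ) (s / √(s ^ 2 + δ ^ 2)) s := by
  have h1 : HasDerivAt (fun s : ℝ => s ^ 2 + δ ^ 2) (2 * s) s := by
    simpa using (hasDerivAt_pow 2 s).add_const (δ ^ 2)
  have h2 := (h1.sqrt (by positivity)).sub_const δ
  convert! h2 using 1
  field_simp

lemma abs_div_sqrt_le_one {δ : ℝ} (s : ℝ) : |s / √(s ^ 2 + δ ^ 2)| ≤ 1 := by
  rw [abs_div, abs_of_nonneg (Real.sqrt_nonneg _)]
  refine div_le_one_of_le₀ (Real.abs_le_sqrt ?_) (Real.sqrt_nonneg _)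
  nlinarith [sq_nonneg δ]

lemma abs_sqrt_sq_add_sub_le {δ : ℝ} (hδ : 0 ≤ δ) (s : ℝ) :
    |√(s ^ 2 + δ ^ 2) - δ - abs s| ≤ δ := by
  have h1 : |s| ≤ √(s ^ 2 + δ ^ 2) := Real.abs_le_sqrt (by nlinarith [sq_nonneg δ])
  have h2 : √(s ^ 2 + δ ^ 2) ≤ |s| + δ := by
    rw [Real.sqrt_le_left (by positivity)]
    nlinarith [abs_nonneg s, sq_abs s, mul_nonneg (abs_nonneg s) hδ]
  rw [abs_le]
  constructor <;> linarith

lemma tendsto_div_sqrt_sign (s : ℝ) :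
    Tendsto (fun n : ℕ => s / √(s ^ 2 + (1 / ((n : ℝ) + 1)) ^ 2)) atTop (𝓝 (Real.sign s)) := by
  rcases eq_or_ne s 0 with rfl | hs
  · simp
  · have h1 : Tendsto (fun n : ℕ => √(s ^ 2 + (1 / ((n : ℝ) + 1)) ^ 2)) atTop (𝓝 |s|) := by
      have := (((tendsto_one_div_add_atTop_nhds_zero_nat (𝕜 := ℝ)).pow 2).const_add (s ^ 2)).sqrt
      simpa [Real.sqrt_sq_eq_abs] using this
    have h2 := (tendsto_const_nhds (x := s)).div h1 (abs_ne_zero.2 hs)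
    have h3 : s / |s| = Real.sign s := by
      rcases lt_or_gt_of_ne hs with h | h
      · rw [abs_of_neg h, Real.sign_of_neg h, div_neg, div_self hs]
      · rw [abs_of_pos h, Real.sign_of_pos h, div_self hs]
    rwa [h3] at h2

lemma abs_sign_le_one (s : ℝ) : |Real.sign s| ≤ 1 := by
  rcases Real.sign_apply_eq s with h | h | h <;> simp [h]

lemma InEnergySpace.abs (hp : 1 ≤ p) (hΩ : IsOpen Ω) (h : InEnergySpace B Ω p u g) :
    InEnergySpace B Ω p (fun x => |u x|) (fun x => Real.sign (u x) • g x) := by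
  have hδ (n : ℕ) : (0 : ℝ) < 1 / ((n : ℝ) + 1) := by positivity
  have hδ1 (n : ℕ) : 1 / ((n : ℝ) + 1) ≤ 1 := by
    rw [div_le_one (by positivity)]
    linarith [(Nat.cast_nonneg n : (0 : ℝ) ≤ n)]
  have hcd (n : ℕ) : Continuous fun s : ℝ => s / √(s ^ 2 + (1 / ((n : ℝ) + 1)) ^ 2) :=
    continuous_id.div (by fun_prop) fun s => (Real.sqrt_pos.2 (by positivity)).ne'
  have hn (n : ℕ) := h.comp_single hp hΩ (hasDerivAt_sqrt_sq_add (hδ n)) (hcd n)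
    abs_div_sqrt_le_one (by rw [zero_pow two_ne_zero, zero_add, Real.sqrt_sq (hδ n).le, sub_self])
  have hsm : Measurable Real.sign := by
    unfold Real.sign
    exact Measurable.ite measurableSet_Iio measurable_const
      (Measurable.ite measurableSet_Ioi measurable_const measurable_const)
  have hum := h.memLp.1
  have hsg : AEStronglyMeasurable (fun x => Real.sign (u x)) (volume.restrict Ω) :=
    (hsm.comp_aemeasurable hum.aemeasurable).aestronglyMeasurable
  refine InEnergySpace.of_tendsto hp hn h.memLp.norm
    (memLp_bdd_smul hsg (fun x => abs_sign_le_one _) h.memLp_grad) ?_ ?_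
  · refine tendsto_eLpNorm_zero_of_dominated (by linarith) (G := fun _ => 1)
      (fun n => (hn n).memLp.1.sub h.memLp.norm.1) (memLp_const _)
      (fun n => Eventually.of_forall fun x => ?_) (Eventually.of_forall fun x => ?_)
    · exact (abs_sqrt_sq_add_sub_le (hδ n).le (u x)).trans (hδ1 n)
    · rw [tendsto_zero_iff_norm_tendsto_zero]
      exact squeeze_zero (fun _ => norm_nonneg _)
        (fun n => abs_sqrt_sq_add_sub_le (hδ n).le (u x)) tendsto_one_div_add_atTop_nhds_zero_nat
  · refine tendsto_eLpNorm_smul_sub (f := fun _ => g) hp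
      (fun n => (hcd n).comp_aestronglyMeasurable hum) hsg (fun n x => abs_div_sqrt_le_one _)
      (fun x => abs_sign_le_one _) (fun _ => h.memLp_grad.1) h.memLp_grad
      (Eventually.of_forall fun x => tendsto_div_sqrt_sign _) ?_
    simp

/-- The weak gradient vanishes a.e. on the zero set. -/
lemma InEnergySpace.grad_eq_zero (hp : 1 ≤ p) (hΩ : IsOpen Ω) (h : InEnergySpace B Ω p u g) :
    ∀ᵐ x ∂(volume.restrict Ω), u x = 0 → g x = 0 := by
  have hδ (n : ℕ) : (0 : ℝ) < 1 / ((n : ℝ) + 1) := by positivity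
  have hδ1 (n : ℕ) : 1 / ((n : ℝ) + 1) ≤ 1 := by
    rw [div_le_one (by positivity)]
    linarith [(Nat.cast_nonneg n : (0 : ℝ) ≤ n)]
  -- The functions `arctan((n+1)s)/(n+1)` tend to 0 uniformly, while their derivatives stay bounded
  -- and tend to the indicator of `{0}`. In the limit `1_{u = 0} g` is a weak gradient of the zero
  -- function, hence null.
  have hder (n : ℕ) (s : ℝ) : HasDerivAt
      (fun s => 1 / ((n : ℝ) + 1) * Real.arctan (((n : ℝ) + 1) * s))
      (1 / (1 + (((n : ℝ) + 1) * s) ^ 2)) s := by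
    have h1 : HasDerivAt (fun s : ℝ => ((n : ℝ) + 1) * s) ((n : ℝ) + 1) s := by
      simpa using (hasDerivAt_id s).const_mul ((n : ℝ) + 1)
    have h2 := (h1.arctan).const_mul (1 / ((n : ℝ) + 1))
    convert! h2 using 1
    field_simp
  have hcd (n : ℕ) : Continuous fun s : ℝ => 1 / (1 + (((n : ℝ) + 1) * s) ^ 2) :=
    continuous_const.div (by fun_prop) fun s => by positivity
  have hb (n : ℕ) (s : ℝ) : |1 / (1 + (((n : ℝ) + 1) * s) ^ 2)| ≤ 1 := by
    rw [abs_of_nonneg (by positivity)]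
    exact div_le_one_of_le₀ (by nlinarith [sq_nonneg (((n : ℝ) + 1) * s)]) (by positivity)
  have hn (n : ℕ) := h.comp_single hp hΩ (hder n) (hcd n) (hb n) (by simp)
  let ind : ℝ → ℝ := fun s => if s = 0 then 1 else 0
  have hindm : Measurable ind :=
    Measurable.ite (measurableSet_singleton 0) measurable_const measurable_const
  have hindb (s : ℝ) : |ind s| ≤ 1 := by
    by_cases hs : s = 0 <;> simp [ind, hs]
  have hum := h.memLp.1
  have hsg : AEStronglyMeasurable (fun x => ind (u x)) (volume.restrict Ω) :=
    (hindm.comp_aemeasurable hum.aemeasurable).aestronglyMeasurable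
  have h0 : InEnergySpace B Ω p (fun _ => (0 : ℝ)) (fun x => ind (u x) • g x) := by
    refine InEnergySpace.of_tendsto hp hn (memLp_const 0)
      (memLp_bdd_smul hsg (fun x => hindb _) h.memLp_grad) ?_ ?_
    · have hle (n : ℕ) (x : Eucl N) :
          ‖1 / ((n : ℝ) + 1) * Real.arctan (((n : ℝ) + 1) * u x) - 0‖
            ≤ 1 / ((n : ℝ) + 1) * (Real.pi / 2) := by
        rw [sub_zero, norm_mul, Real.norm_of_nonneg (hδ n).le, Real.norm_eq_abs]
        gcongr
        exact abs_le.2 ⟨(Real.neg_pi_div_two_lt_arctan _).le, (Real.arctan_lt_pi_div_two _).le⟩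
      refine tendsto_eLpNorm_zero_of_dominated (by linarith) (G := fun _ => Real.pi / 2)
        (fun n => (hn n).memLp.1.sub aestronglyMeasurable_const) (memLp_const _)
        (fun n => Eventually.of_forall fun x => ?_) (Eventually.of_forall fun x => ?_)
      · exact (hle n x).trans (mul_le_of_le_one_left (by positivity) (hδ1 n))
      · rw [tendsto_zero_iff_norm_tendsto_zero]
        refine squeeze_zero (fun _ => norm_nonneg _) (fun n => hle n x) ?_
        simpa using (tendsto_one_div_add_atTop_nhds_zero_nat (𝕜 := ℝ)).mul_const (Real.pi / 2)
    · refine tendsto_eLpNorm_smul_sub (f := fun _ => g) (a₀ := fun x => ind (u x)) hp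
        (fun n => (hcd n).comp_aestronglyMeasurable hum) hsg (fun n x => hb n _)
        (fun x => hindb _) (fun _ => h.memLp_grad.1) h.memLp_grad
        (Eventually.of_forall fun x => ?_) ?_
      · by_cases hx : u x = 0
        · simp [hx, ind]
        · simp only [ind, hx, if_false]
          have h1 : Tendsto (fun n : ℕ => ((n : ℝ) + 1) ^ 2) atTop atTop :=
            (tendsto_pow_atTop two_ne_zero).comp
              (tendsto_atTop_add_const_right _ _ tendsto_natCast_atTop_atTop)
          have h2 : Tendsto (fun n : ℕ => 1 + (((n : ℝ) + 1) * u x) ^ 2) atTop atTop := by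
            refine tendsto_atTop_add_const_left _ _ ?_
            simp_rw [mul_pow]
            exact h1.atTop_mul_const (by positivity)
          simp only [one_div]
          exact h2.inv_tendsto_atTop
      · simp
  have hz : InEnergySpace B Ω p (fun _ => (0 : ℝ)) (fun _ => (0 : Eucl N)) := by
    simpa using h.const_mul 0
  filter_upwards [h0.toHasSobolevGradient.ae_eq hp hΩ hz.toHasSobolevGradient] with x hx hux
  simpa [ind, hux] using hx

lemma InEnergySpace.sub (hp : 1 ≤ p) (h : InEnergySpace B Ω p u g)
    (h' : InEnergySpace B Ω p v k) :
    InEnergySpace B Ω p (fun x => u x - v x) (fun x => g x - k x) := by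
  have := h.add hp (h'.const_mul (-1))
  simpa [← sub_eq_add_neg] using this

/-- The positive part is `(u + |u|)/2`. On `{u = 0}` this formula produces `g / 2`, which vanishes
a.e. there. -/
lemma InEnergySpace.posPart (hp : 1 ≤ p) (hΩ : IsOpen Ω) (h : InEnergySpace B Ω p u g) :
    InEnergySpace B Ω p (fun x => max (u x) 0) (fun x => if 0 < u x then g x else 0) := by
  refine ((h.add hp (h.abs hp hΩ)).const_mul (1 / 2)).congr
    (Eventually.of_forall fun x => ?_) ?_
  · rcases le_total 0 (u x) with h | h
    · simp only [abs_of_nonneg h, max_eq_left h]; ring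
    · simp only [abs_of_nonpos h, max_eq_right h]; ring
  · filter_upwards [h.grad_eq_zero hp hΩ] with x hx
    rcases lt_trichotomy (u x) 0 with h | h | h
    · simp [Real.sign_of_neg h, h.not_gt]
    · simp [h, hx h]
    · simp only [Real.sign_of_pos h, h, if_true]
      module

end Lattice

/-! ### The functionals in terms of explicit gradients; continuity of `∫ a|u|^q` -/

section Functionals

variable {N : ℕ} {Ω : Set (Eucl N)} {p q lam : ℝ} {a u v : Eucl N → ℝ} {g k : Eucl N → Eucl N}
  {B : BoundaryCondition}

lemma integral_congr_weakGrad {r : Eucl N → Eucl N → ℝ}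
    (h : weakGrad Ω u =ᵐ[volume.restrict Ω] g) :
    ∫ x in Ω, r x (weakGrad Ω u x) = ∫ x in Ω, r x (g x) :=
  integral_congr_ae (h.mono fun x hx => by simp only [hx])

variable [IsFiniteMeasure (volume.restrict Ω)]

lemma integrable_abs_rpow (hq : 0 < q) (hqp : q ≤ p) {f : Eucl N → ℝ}
    (hf : MemLp f (ENNReal.ofReal p) (volume.restrict Ω)) :
    Integrable (fun x => |f x| ^ q) (volume.restrict Ω) :=
  integrable_norm_rpow_real hq (hf.mono_exponent (ENNReal.ofReal_le_ofReal hqp))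

lemma integrable_weight (hq : 0 < q) (hqp : q ≤ p) {M : ℝ}
    (ham : AEStronglyMeasurable a (volume.restrict Ω))
    (haM : ∀ᵐ x ∂(volume.restrict Ω), |a x| ≤ M) {f : Eucl N → ℝ}
    (hf : MemLp f (ENNReal.ofReal p) (volume.restrict Ω)) :
    Integrable (fun x => a x * |f x| ^ q) (volume.restrict Ω) :=
  (integrable_abs_rpow hq hqp hf).bdd_mul ham haM

lemma HasSobolevGradient.energyE_eq (hp : 1 ≤ p) (hΩ : IsOpen Ω)
    (h : HasSobolevGradient Ω p u g) :
    energyE Ω p lam u = (∫ x in Ω, ‖g x‖ ^ p) + -lam * ∫ x in Ω, |u x| ^ p := by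
  have hp0 : 0 < p := by linarith
  rw [energyE, integral_congr_weakGrad (r := fun x w => ‖w‖ ^ p - lam * |u x| ^ p)
    (h.weakGrad_ae_eq hp hΩ), integral_sub (integrable_norm_rpow_real hp0 h.memLp_grad)
    ((integrable_abs_rpow hp0 le_rfl h.memLp).const_mul lam), integral_const_mul]
  ring

lemma HasSobolevGradient.energyI_eq (hp : 1 ≤ p) (hq : 0 < q) (hqp : q ≤ p) (hΩ : IsOpen Ω)
    {M : ℝ} (ham : AEStronglyMeasurable a (volume.restrict Ω))
    (haM : ∀ᵐ x ∂(volume.restrict Ω), |a x| ≤ M)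
    (h : HasSobolevGradient Ω p u g) :
    energyI Ω p q lam a u = energyE Ω p lam u / p - weightInt Ω q a u / q := by
  have hp0 : 0 < p := by linarith
  have i1 := integrable_norm_rpow_real hp0 h.memLp_grad
  have i2 := integrable_abs_rpow hp0 le_rfl h.memLp
  have i3 := integrable_weight hq hqp ham haM h.memLp
  have i4 : Integrable (fun x => 1 / p * ‖g x‖ ^ p - lam / p * |u x| ^ p) (volume.restrict Ω) :=
    (i1.const_mul _).sub (i2.const_mul _)
  rw [h.energyE_eq hp hΩ, energyI, integral_congr_weakGrad
    (r := fun x w => 1 / p * ‖w‖ ^ p - lam / p * |u x| ^ p - 1 / q * (a x * |u x| ^ q))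
    (h.weakGrad_ae_eq hp hΩ), integral_sub i4
    (i3.const_mul _), integral_sub (i1.const_mul _) (i2.const_mul _), integral_const_mul,
    integral_const_mul, integral_const_mul, weightInt]
  ring

/-- A nonnegative weight is absorbed into the function, `b |f|^q = |b^(1/q) f|^q`, so the integral
is a power of an `L^q` norm. A weight of changing sign is then split into its two parts. -/
lemma tendsto_integral_weight_of_nonneg {ι : Type*} {l : Filter ι} (hq : 1 ≤ q) (hqp : q ≤ p)
    {b : Eucl N → ℝ} {M : ℝ} (hbm : AEStronglyMeasurable b (volume.restrict Ω))
    (hb0 : ∀ x, 0 ≤ b x) (hbM : ∀ᵐ x ∂(volume.restrict Ω), b x ≤ M)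
    {f : ι → Eucl N → ℝ} {f₀ : Eucl N → ℝ}
    (hf : ∀ i, MemLp (f i) (ENNReal.ofReal p) (volume.restrict Ω))
    (hf₀ : MemLp f₀ (ENNReal.ofReal p) (volume.restrict Ω))
    (h : Tendsto (fun i => eLpNorm (f i - f₀) (ENNReal.ofReal p) (volume.restrict Ω)) l (𝓝 0)) :
    Tendsto (fun i => ∫ x in Ω, b x * |f i x| ^ q) l (𝓝 (∫ x in Ω, b x * |f₀ x| ^ q)) := by
  have hq0 : 0 < q := by linarith
  have hle : ENNReal.ofReal q ≤ ENNReal.ofReal p := ENNReal.ofReal_le_ofReal hqp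
  have hcm : AEStronglyMeasurable (fun x => b x ^ (1 / q)) (volume.restrict Ω) :=
    (hbm.aemeasurable.pow_const _).aestronglyMeasurable
  have hcb : ∀ᵐ x ∂(volume.restrict Ω), ‖b x ^ (1 / q)‖ ≤ M ^ (1 / q) := by
    filter_upwards [hbM] with x hx
    rw [Real.norm_of_nonneg (Real.rpow_nonneg (hb0 x) _)]
    exact Real.rpow_le_rpow (hb0 x) hx (by positivity)
  have hmul {w : Eucl N → ℝ} (hw : MemLp w (ENNReal.ofReal q) (volume.restrict Ω)) :
      MemLp (fun x => b x ^ (1 / q) * w x) (ENNReal.ofReal q) (volume.restrict Ω) :=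
    hw.of_le_mul (c := M ^ (1 / q)) (hcm.mul hw.1) (hcb.mono fun x hx => by
      rw [norm_mul]; exact mul_le_mul_of_nonneg_right hx (norm_nonneg _))
  have key : ∀ w : Eucl N → ℝ, ∫ x in Ω, b x * |w x| ^ q
      = ∫ x in Ω, ‖b x ^ (1 / q) * w x‖ ^ q := fun w => by
    refine integral_congr_ae (Eventually.of_forall fun x => ?_)
    simp only
    rw [norm_mul, Real.norm_of_nonneg (Real.rpow_nonneg (hb0 x) _),
      Real.mul_rpow (Real.rpow_nonneg (hb0 x) _) (norm_nonneg _), ← Real.rpow_mul (hb0 x),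
      one_div, inv_mul_cancel₀ hq0.ne', Real.rpow_one, Real.norm_eq_abs]
  simp_rw [key]
  refine tendsto_integral_norm_rpow hq (fun i => hmul ((hf i).mono_exponent hle))
    (hmul (hf₀.mono_exponent hle)) ?_
  set c := (volume.restrict Ω) univ ^
    (1 / (ENNReal.ofReal q).toReal - 1 / (ENNReal.ofReal p).toReal) with hc
  have hcfin : c ≠ ⊤ := by
    refine ENNReal.rpow_ne_top_of_nonneg ?_ (measure_ne_top _ _)
    rw [ENNReal.toReal_ofReal hq0.le, ENNReal.toReal_ofReal (by linarith), sub_nonneg]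
    exact one_div_le_one_div_of_le hq0 hqp
  have hlim : Tendsto (fun i => ENNReal.ofReal (M ^ (1 / q)) *
      (eLpNorm (f i - f₀) (ENNReal.ofReal p) (volume.restrict Ω) * c)) l (𝓝 0) := by
    have := ENNReal.Tendsto.const_mul (a := ENNReal.ofReal (M ^ (1 / q)))
      (ENNReal.Tendsto.mul_const h (Or.inr hcfin)) (Or.inr ENNReal.ofReal_ne_top)
    simpa using this
  refine tendsto_of_tendsto_of_tendsto_of_le_of_le tendsto_const_nhds hlim (fun _ => zero_le)
    fun i => ?_
  refine (eLpNorm_le_mul_eLpNorm_of_ae_le_mul (g := f i - f₀) (c := M ^ (1 / q))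
    (hcb.mono fun x hx => ?_) _).trans
    (mul_le_mul_right (eLpNorm_le_eLpNorm_mul_rpow_measure_univ hle ((hf i).sub hf₀).1) _)
  rw [Pi.sub_apply, ← mul_sub, norm_mul]
  exact mul_le_mul_of_nonneg_right hx (norm_nonneg _)

lemma tendsto_weightInt {ι : Type*} {l : Filter ι} (hq : 1 ≤ q) (hqp : q ≤ p) {M : ℝ}
    (ham : AEStronglyMeasurable a (volume.restrict Ω))
    (haM : ∀ᵐ x ∂(volume.restrict Ω), |a x| ≤ M)
    {f : ι → Eucl N → ℝ} {f₀ : Eucl N → ℝ}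
    (hf : ∀ i, MemLp (f i) (ENNReal.ofReal p) (volume.restrict Ω))
    (hf₀ : MemLp f₀ (ENNReal.ofReal p) (volume.restrict Ω))
    (h : Tendsto (fun i => eLpNorm (f i - f₀) (ENNReal.ofReal p) (volume.restrict Ω)) l (𝓝 0)) :
    Tendsto (fun i => weightInt Ω q a (f i)) l (𝓝 (weightInt Ω q a f₀)) := by
  have hq0 : 0 < q := by linarith
  have pm : AEStronglyMeasurable (fun x => max (a x) 0) (volume.restrict Ω) :=
    ham.sup aestronglyMeasurable_const
  have nm : AEStronglyMeasurable (fun x => max (-a x) 0) (volume.restrict Ω) :=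
    ham.neg.sup aestronglyMeasurable_const
  have pM : ∀ᵐ x ∂(volume.restrict Ω), max (a x) 0 ≤ M :=
    haM.mono fun x hx => max_le ((le_abs_self _).trans hx) ((abs_nonneg _).trans hx)
  have nM : ∀ᵐ x ∂(volume.restrict Ω), max (-a x) 0 ≤ M :=
    haM.mono fun x hx => max_le ((neg_le_abs _).trans hx) ((abs_nonneg _).trans hx)
  have key {w : Eucl N → ℝ} (hw : MemLp w (ENNReal.ofReal p) (volume.restrict Ω)) :
      weightInt Ω q a w = (∫ x in Ω, max (a x) 0 * |w x| ^ q)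
        - ∫ x in Ω, max (-a x) 0 * |w x| ^ q := by
    rw [← integral_sub, weightInt]
    · refine integral_congr_ae (Eventually.of_forall fun x => ?_)
      simp only
      rcases le_total 0 (a x) with h0 | h0
      · rw [max_eq_left h0, max_eq_right (by linarith)]; ring
      · rw [max_eq_right h0, max_eq_left (by linarith)]; ring
    · refine integrable_weight hq0 hqp pm (M := M) (pM.mono fun x hx => ?_) hw
      rwa [abs_of_nonneg (le_max_right _ _)]
    · refine integrable_weight hq0 hqp nm (M := M) (nM.mono fun x hx => ?_) hw
      rwa [abs_of_nonneg (le_max_right _ _)]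
  rw [key hf₀]
  simp_rw [fun i => key (hf i)]
  exact (tendsto_integral_weight_of_nonneg hq hqp pm (fun x => le_max_right _ _) pM hf hf₀ h).sub
    (tendsto_integral_weight_of_nonneg hq hqp nm (fun x => le_max_right _ _) nM hf hf₀ h)

end Functionals

/-! ### Hidden convexity: the regularized `q`-mean -/

section HiddenConvexity

variable {p q δ : ℝ}

/-- A regularized `q`-mean of `|s|` and `|t|`. -/
def qMean (q δ s t : ℝ) : ℝ := ((|s| ^ q + |t| ^ q) / 2 + δ) ^ (1 / q) - δ ^ (1 / q)

/-- The partial derivative of `qMean q δ` in its first variable. -/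
def qMeanFst (q δ s t : ℝ) : ℝ :=
  1 / q * ((|s| ^ q + |t| ^ q) / 2 + δ) ^ (1 / q - 1) * (q * |s| ^ (q - 2) * s / 2)

lemma qMean_base_pos (hδ : 0 < δ) (s t : ℝ) : 0 < (|s| ^ q + |t| ^ q) / 2 + δ := by positivity

lemma continuous_abs_rpow_mul (hq : 1 < q) : Continuous fun s : ℝ => q * |s| ^ (q - 2) * s := by
  have h := (contDiff_one_iff_deriv.1 (contDiff_norm_rpow (E := ℝ) hq)).2
  convert! h using 1
  ext s
  rw [(hasDerivAt_norm_rpow s hq).deriv]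
  rfl

lemma continuous_qMeanFst (hq : 1 < q) (hδ : 0 < δ) :
    Continuous fun z : ℝ × ℝ => qMeanFst q δ z.1 z.2 := by
  unfold qMeanFst
  have h1 : Continuous fun z : ℝ × ℝ => (|z.1| ^ q + |z.2| ^ q) / 2 + δ :=
    (((continuous_fst.abs.rpow_const fun _ => Or.inr (by linarith)).add
      (continuous_snd.abs.rpow_const fun _ => Or.inr (by linarith))).div_const 2).add
      continuous_const
  exact (continuous_const.mul (h1.rpow_const fun z => Or.inl (qMean_base_pos hδ _ _).ne')).mul
    (((continuous_abs_rpow_mul hq).comp continuous_fst).div_const 2)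

/-- With `α = |s| / w^(1/q)` and `β` its counterpart for `t`, the partial derivatives become pure
powers, and `α^q + β^q ≤ 2`. This is the form that Hölder's inequality can use. -/
lemma abs_qMeanFst (hq : 1 < q) (hδ : 0 < δ) (s t : ℝ) :
    |qMeanFst q δ s t| = (|s| / ((|s| ^ q + |t| ^ q) / 2 + δ) ^ (1 / q)) ^ (q - 1) / 2 := by
  have hw := qMean_base_pos (q := q) hδ s t
  set w := (|s| ^ q + |t| ^ q) / 2 + δ with hwdef
  have hq0 : q ≠ 0 := by linarith
  have e1 : w ^ (1 / q - 1) = ((w ^ (1 / q)) ^ (q - 1))⁻¹ := by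
    rw [← Real.rpow_mul hw.le, ← Real.rpow_neg hw.le]
    congr 1
    field_simp
    ring
  have e2 : |s| ^ (q - 2) * |s| = |s| ^ (q - 1) := by
    rcases eq_or_ne s 0 with rfl | hs
    · simp [Real.zero_rpow (by linarith : q - 1 ≠ 0)]
    · have hs' : 0 < |s| := abs_pos.2 hs
      rw [← Real.rpow_add_one hs'.ne']
      congr 1; ring
  have e3 : qMeanFst q δ s t = w ^ (1 / q - 1) / 2 * (|s| ^ (q - 2) * s) := by
    rw [qMeanFst, ← hwdef]
    field_simp
  have e4 : abs (|s| ^ (q - 2) * s) = |s| ^ (q - 1) := by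
    rw [abs_mul, abs_of_nonneg (by positivity : 0 ≤ |s| ^ (q - 2)), e2]
  rw [e3, abs_mul, e4, abs_of_pos (by positivity), e1, Real.div_rpow (abs_nonneg _) (by positivity)]
  ring

lemma div_qMean_rpow (hq : 1 < q) (hδ : 0 < δ) (s t : ℝ) :
    (|s| / ((|s| ^ q + |t| ^ q) / 2 + δ) ^ (1 / q)) ^ q
      = |s| ^ q / ((|s| ^ q + |t| ^ q) / 2 + δ) := by
  have hw := qMean_base_pos (q := q) hδ s t
  rw [Real.div_rpow (abs_nonneg _) (by positivity), ← Real.rpow_mul hw.le, one_div,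
    inv_mul_cancel₀ (by linarith), Real.rpow_one]

lemma abs_qMeanFst_le (hq : 1 < q) (hδ : 0 < δ) (s t : ℝ) : |qMeanFst q δ s t| ≤ 1 := by
  rw [abs_qMeanFst hq hδ]
  have hw := qMean_base_pos (q := q) hδ s t
  have h1 := div_qMean_rpow hq hδ s t
  set α := |s| / ((|s| ^ q + |t| ^ q) / 2 + δ) ^ (1 / q) with hα
  have hα0 : 0 ≤ α := by positivity
  have h2 : α ^ q ≤ 2 := by
    rw [h1, div_le_iff₀ hw]
    have : 0 ≤ |t| ^ q := by positivity
    linarith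
  have h3 : α ^ (q - 1) ≤ 2 := by
    rcases le_total α 1 with h | h
    · linarith [Real.rpow_le_one hα0 h (by linarith : 0 ≤ q - 1)]
    · exact (Real.rpow_le_rpow_of_exponent_le h (by linarith)).trans h2
  linarith

lemma hasFDerivAt_qMean (hq : 1 < q) (hδ : 0 < δ) (s t : ℝ) :
    HasFDerivAt (fun z : ℝ × ℝ => qMean q δ z.1 z.2)
      (qMeanFst q δ s t • ContinuousLinearMap.fst ℝ ℝ ℝ
        + qMeanFst q δ t s • ContinuousLinearMap.snd ℝ ℝ ℝ) (s, t) := by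
  have hw := qMean_base_pos (q := q) hδ s t
  have h1 : HasFDerivAt (fun z : ℝ × ℝ => |z.1| ^ q)
      ((q * |s| ^ (q - 2) * s) • ContinuousLinearMap.fst ℝ ℝ ℝ) (s, t) := by
    have := (hasDerivAt_norm_rpow s hq).comp_hasFDerivAt (s, t)
      (hasFDerivAt_fst (𝕜 := ℝ) (E := ℝ) (F := ℝ) (p := (s, t)))
    exact this
  have h2 : HasFDerivAt (fun z : ℝ × ℝ => |z.2| ^ q)
      ((q * |t| ^ (q - 2) * t) • ContinuousLinearMap.snd ℝ ℝ ℝ) (s, t) := by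
    have := (hasDerivAt_norm_rpow t hq).comp_hasFDerivAt (s, t)
      (hasFDerivAt_snd (𝕜 := ℝ) (E := ℝ) (F := ℝ) (p := (s, t)))
    exact this
  have h3 : HasFDerivAt (fun z : ℝ × ℝ => (|z.1| ^ q + |z.2| ^ q) / 2 + δ)
      ((2⁻¹ : ℝ) • ((q * |s| ^ (q - 2) * s) • ContinuousLinearMap.fst ℝ ℝ ℝ
        + (q * |t| ^ (q - 2) * t) • ContinuousLinearMap.snd ℝ ℝ ℝ)) (s, t) := by
    simp_rw [div_eq_mul_inv]
    exact ((h1.add h2).mul_const (2⁻¹ : ℝ)).add_const δ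
  have h4 := ((Real.hasDerivAt_rpow_const (p := 1 / q) (Or.inl hw.ne')).comp_hasFDerivAt
    (s, t) h3).sub_const (δ ^ (1 / q))
  refine HasFDerivAt.congr_fderiv (f := fun z : ℝ × ℝ => qMean q δ z.1 z.2) h4 ?_
  rw [smul_smul, smul_add, smul_smul, smul_smul, qMeanFst, qMeanFst, add_comm (|t| ^ q)]
  congr 2 <;> ring

/-- The shift `δ` keeps the base of the root away from 0, and subtracting `δ^(1/q)` restores the
value 0 at the origin; hence the chain rule applies, under the Dirichlet condition too. -/
lemma c1Bounded_qMean (hq : 1 < q) (hδ : 0 < δ) :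
    C1Bounded (qMean q δ) (qMeanFst q δ) (fun s t => qMeanFst q δ t s) 1 := by
  have h2 : Continuous fun z : ℝ × ℝ => qMeanFst q δ z.2 z.1 := by
    have := (continuous_qMeanFst hq hδ).comp (continuous_swap (X := ℝ) (Y := ℝ))
    exact this
  have h0 : qMean q δ 0 0 = 0 := by
    have : q ≠ 0 := by linarith
    simp [qMean, Real.zero_rpow this]
  exact ⟨hasFDerivAt_qMean hq hδ, continuous_qMeanFst hq hδ, h2, abs_qMeanFst_le hq hδ,
    fun s t => abs_qMeanFst_le hq hδ t s, h0⟩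

/-- Hölder with exponents `q/(q-1)` and `q`: the hypothesis on `α`, `β` costs a factor `2^(q-1)`,
and division by `2^q` leaves exactly the mean. -/
lemma weighted_mean_rpow_le (hq : 1 < q) {α β x y : ℝ} (hα : 0 ≤ α) (hβ : 0 ≤ β) (hx : 0 ≤ x)
    (hy : 0 ≤ y) (h : α ^ q + β ^ q ≤ 2) :
    ((α ^ (q - 1) * x + β ^ (q - 1) * y) / 2) ^ q ≤ (x ^ q + y ^ q) / 2 := by
  have hq0 : 0 < q := by linarith
  have hconj := (Real.HolderConjugate.conjExponent hq).symm
  have H := Real.inner_le_Lp_mul_Lq_of_nonneg (Finset.univ : Finset (Fin 2)) hconj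
    (f := ![α ^ (q - 1), β ^ (q - 1)]) (g := ![x, y])
    (fun i _ => by fin_cases i <;> simp <;> positivity)
    (fun i _ => by fin_cases i <;> simp <;> assumption)
  simp only [Fin.sum_univ_two, Matrix.cons_val_zero, Matrix.cons_val_one] at H
  have e (z : ℝ) (hz : 0 ≤ z) : (z ^ (q - 1)) ^ q.conjExponent = z ^ q := by
    rw [← Real.rpow_mul hz, Real.conjExponent]
    congr 1
    have : q - 1 ≠ 0 := by linarith
    field_simp
  rw [e α hα, e β hβ] at H
  have h1 : 0 ≤ α ^ (q - 1) * x + β ^ (q - 1) * y := by positivity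
  have h2 : (α ^ q + β ^ q) ^ (1 / q.conjExponent) ≤ 2 ^ (1 / q.conjExponent) :=
    Real.rpow_le_rpow (by positivity) h (one_div_nonneg.2 hconj.nonneg)
  have h3 : α ^ (q - 1) * x + β ^ (q - 1) * y
      ≤ 2 ^ (1 / q.conjExponent) * (x ^ q + y ^ q) ^ (1 / q) :=
    H.trans (mul_le_mul_of_nonneg_right h2 (by positivity))
  have h4 : (α ^ (q - 1) * x + β ^ (q - 1) * y) ^ q ≤ 2 ^ (q - 1) * (x ^ q + y ^ q) := by
    refine (Real.rpow_le_rpow h1 h3 hq0.le).trans_eq ?_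
    rw [Real.mul_rpow (by positivity) (by positivity), ← Real.rpow_mul (by norm_num),
      ← Real.rpow_mul (by positivity), one_div_mul_cancel hq0.ne', Real.rpow_one]
    congr 2
    rw [Real.conjExponent]
    have : q - 1 ≠ 0 := by linarith
    field_simp
  rw [Real.div_rpow h1 (by norm_num), div_le_iff₀ (by positivity)]
  refine h4.trans_eq ?_
  rw [Real.rpow_sub_one (by norm_num)]
  ring

/-- The pointwise source of hidden convexity. Hölder gives the estimate with exponent `q`, and
convexity of `t^(p/q)` raises it to `p`; this is where `q ≤ p` is essential. -/
lemma norm_qMean_gradient_le {E : Type*} [NormedAddCommGroup E] [NormedSpace ℝ E] (hq : 1 < q)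
    (hqp : q ≤ p) (hδ : 0 < δ) (s t : ℝ) (x y : E) :
    ‖qMeanFst q δ s t • x + qMeanFst q δ t s • y‖ ^ p ≤ (‖x‖ ^ p + ‖y‖ ^ p) / 2 := by
  have hq0 : 0 < q := by linarith
  have hw := qMean_base_pos (q := q) hδ s t
  have hsym : (|t| ^ q + |s| ^ q) / 2 + δ = (|s| ^ q + |t| ^ q) / 2 + δ := by ring
  have a1 := abs_qMeanFst hq hδ s t
  have a2 := abs_qMeanFst hq hδ t s
  have b1 := div_qMean_rpow hq hδ s t
  have b2 := div_qMean_rpow hq hδ t s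
  rw [hsym] at a2 b2
  set w := (|s| ^ q + |t| ^ q) / 2 + δ with hwdef
  set α := |s| / w ^ (1 / q)
  set β := |t| / w ^ (1 / q)
  have hα : 0 ≤ α := by positivity
  have hβ : 0 ≤ β := by positivity
  have hab : α ^ q + β ^ q ≤ 2 := by
    rw [b1, b2, ← add_div, div_le_iff₀ hw]
    linarith
  have h1 : ‖qMeanFst q δ s t • x + qMeanFst q δ t s • y‖
      ≤ (α ^ (q - 1) * ‖x‖ + β ^ (q - 1) * ‖y‖) / 2 := by
    refine (norm_add_le _ _).trans_eq ?_
    rw [norm_smul, norm_smul, Real.norm_eq_abs, Real.norm_eq_abs, a1, a2]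
    ring
  have h2 := weighted_mean_rpow_le hq hα hβ (norm_nonneg x) (norm_nonneg y) hab
  have h3 := (Real.rpow_le_rpow (norm_nonneg _) h1 hq0.le).trans h2
  have h4 := Real.rpow_le_rpow (Real.rpow_nonneg (norm_nonneg _) q) h3
    (div_nonneg (hq0.le.trans hqp) hq0.le : 0 ≤ p / q)
  rw [← Real.rpow_mul (norm_nonneg _), mul_div_cancel₀ _ hq0.ne'] at h4
  refine h4.trans ((rpow_midpoint_le ((one_le_div hq0).2 hqp) (by positivity)
    (by positivity)).trans_eq ?_)
  rw [← Real.rpow_mul (norm_nonneg _), ← Real.rpow_mul (norm_nonneg _),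
    mul_div_cancel₀ _ hq0.ne']

lemma qMean_nonneg (hq : 1 < q) (hδ : 0 < δ) (s t : ℝ) : 0 ≤ qMean q δ s t := by
  unfold qMean
  rw [sub_nonneg]
  refine Real.rpow_le_rpow hδ.le ?_ (one_div_nonneg.2 (by linarith))
  have : 0 ≤ (|s| ^ q + |t| ^ q) / 2 := by positivity
  linarith

/-- Subadditivity of `t^(1/q)`. The regularized means stay below the true mean, which serves as a
majorant for all `δ` at once. -/
lemma qMean_le (hq : 1 < q) (hδ : 0 < δ) (s t : ℝ) :
    qMean q δ s t ≤ ((|s| ^ q + |t| ^ q) / 2) ^ (1 / q) := by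
  unfold qMean
  rw [sub_le_iff_le_add]
  exact Real.rpow_add_le_add_rpow (by positivity) hδ.le (by positivity)
    ((div_le_one (by linarith)).2 hq.le)

lemma tendsto_qMean (hq : 1 < q) (s t : ℝ) :
    Tendsto (fun n : ℕ => qMean q (1 / ((n : ℝ) + 1)) s t) atTop
      (𝓝 (((|s| ^ q + |t| ^ q) / 2) ^ (1 / q))) := by
  have h0 := tendsto_one_div_add_atTop_nhds_zero_nat (𝕜 := ℝ)
  have hq' : 0 < 1 / q := by positivity
  have h1 := (h0.const_add ((|s| ^ q + |t| ^ q) / 2)).rpow_const (p := 1 / q) (Or.inr hq'.le)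
  have h2 := h0.rpow_const (p := 1 / q) (Or.inr hq'.le)
  have h3 := h1.sub h2
  rw [Real.zero_rpow hq'.ne', add_zero, sub_zero] at h3
  exact h3

end HiddenConvexity

/-! ### The midpoint inequality -/

section MidpointInequality

variable {N : ℕ} {Ω : Set (Eucl N)} {p q lam m M : ℝ} {a u v : Eucl N → ℝ}
  {g k : Eucl N → Eucl N} {B : BoundaryCondition} [IsFiniteMeasure (volume.restrict Ω)]

/-- The inequality behind both existence and uniqueness. The competitor is the `q`-mean of `u` and
`v`: in the limit it keeps the constraint value 1, its gradient energy is at most the average, and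
the slack in the zero-order term is the convexity defect of `t^(p/q)`. The mean itself is never
placed in the energy space; its regularizations are estimated and only the numbers pass to the
limit. -/
lemma midpoint_inequality (hΩ : IsOpen Ω) (hq : 1 < q) (hqp : q < p) (hlam : lam < 0)
    (ham : AEStronglyMeasurable a (volume.restrict Ω))
    (haM : ∀ᵐ x ∂(volume.restrict Ω), |a x| ≤ M)
    (hm : ∀ w f, InEnergySpace B Ω p w f → 0 < weightInt Ω q a w →
      m * weightInt Ω q a w ^ (p / q) ≤ energyE Ω p lam w)
    (hu : InEnergySpace B Ω p u g) (hv : InEnergySpace B Ω p v k)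
    (hu1 : weightInt Ω q a u = 1) (hv1 : weightInt Ω q a v = 1) :
    -lam * ∫ x in Ω, midDefect (p / q) (|u x| ^ q) (|v x| ^ q)
      ≤ (energyE Ω p lam u + energyE Ω p lam v) / 2 - m := by
  have hq0 : 0 < q := by linarith
  have hp : 1 ≤ p := by linarith
  have hp0 : 0 < p := by linarith
  have hδ (n : ℕ) : (0 : ℝ) < 1 / ((n : ℝ) + 1) := by positivity
  set w : ℕ → Eucl N → ℝ := fun n x => qMean q (1 / ((n : ℝ) + 1)) (u x) (v x) with hw
  set z : Eucl N → ℝ := fun x => ((|u x| ^ q + |v x| ^ q) / 2) ^ (1 / q) with hz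
  have hwE (n : ℕ) := InEnergySpace.comp hp hΩ (c1Bounded_qMean hq (hδ n)) hu hv
  have iu := integrable_abs_rpow hp0 le_rfl hu.memLp
  have iv := integrable_abs_rpow hp0 le_rfl hv.memLp
  have ig := integrable_norm_rpow_real hp0 hu.memLp_grad
  have ik := integrable_norm_rpow_real hp0 hv.memLp_grad
  have iuq := integrable_weight hq0 hqp.le ham haM hu.memLp
  have ivq := integrable_weight hq0 hqp.le ham haM hv.memLp
  have hz0 (x : Eucl N) : 0 ≤ z x := by positivity
  have hzp (x : Eucl N) : z x ^ p = ((|u x| ^ q + |v x| ^ q) / 2) ^ (p / q) := by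
    simp only [hz]
    rw [← Real.rpow_mul (by positivity)]
    congr 1; ring
  have hzq (x : Eucl N) : z x ^ q = (|u x| ^ q + |v x| ^ q) / 2 := by
    simp only [hz]
    rw [← Real.rpow_mul (by positivity), one_div_mul_cancel hq0.ne', Real.rpow_one]
  have hpq (s : ℝ) : (|s| ^ q) ^ (p / q) = |s| ^ p := by
    rw [← Real.rpow_mul (abs_nonneg _), mul_div_cancel₀ _ hq0.ne']
  have hzle (x : Eucl N) : z x ^ p ≤ (|u x| ^ p + |v x| ^ p) / 2 := by
    rw [hzp, ← hpq (u x), ← hpq (v x)]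
    exact rpow_midpoint_le ((one_le_div hq0).2 hqp.le) (by positivity) (by positivity)
  have hzm : AEStronglyMeasurable z (volume.restrict Ω) := by
    have h1 := hu.memLp.1.aemeasurable
    have h2 := hv.memLp.1.aemeasurable
    have h3 (f : Eucl N → ℝ) (hf : AEMeasurable f (volume.restrict Ω)) :
        AEMeasurable (fun x => |f x| ^ q) (volume.restrict Ω) := (hf.norm).pow_const q
    exact ((((h3 _ h1).add (h3 _ h2)).div_const 2).pow_const _).aestronglyMeasurable
  have iz : Integrable (fun x => z x ^ p) (volume.restrict Ω) := by
    refine ((iu.add iv).div_const 2).mono' (hzm.aemeasurable.pow_const p).aestronglyMeasurable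
      (Eventually.of_forall fun x => ?_)
    rw [Real.norm_of_nonneg (Real.rpow_nonneg (hz0 x) _)]
    exact hzle x
  -- limit of the constraint
  have hA : Tendsto (fun n => weightInt Ω q a (w n)) atTop (𝓝 1) := by
    have h1 : ∫ x in Ω, a x * z x ^ q = 1 := by
      have : ∀ x, a x * z x ^ q = (a x * |u x| ^ q + a x * |v x| ^ q) / 2 := fun x => by
        rw [hzq]; ring
      simp_rw [this]
      rw [integral_div, integral_add iuq ivq]
      change (weightInt Ω q a u + weightInt Ω q a v) / 2 = 1
      rw [hu1, hv1]; norm_num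
    rw [← h1]
    have iuq' := integrable_abs_rpow hq0 hqp.le hu.memLp
    have ivq' := integrable_abs_rpow hq0 hqp.le hv.memLp
    refine tendsto_integral_of_dominated_convergence
      (fun x => M * ((|u x| ^ q + |v x| ^ q) / 2))
      (fun n => (integrable_weight hq0 hqp.le ham haM (hwE n).memLp).1)
      (((iuq'.add ivq').div_const 2).const_mul M) (fun n => ?_)
      (Eventually.of_forall fun x => ?_)
    · filter_upwards [haM] with x hx
      rw [norm_mul, Real.norm_eq_abs, ← hzq]
      refine mul_le_mul hx ?_ (norm_nonneg _) ((abs_nonneg _).trans hx)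
      rw [Real.norm_of_nonneg (by positivity), abs_of_nonneg (qMean_nonneg hq (hδ n) _ _)]
      exact Real.rpow_le_rpow (qMean_nonneg hq (hδ n) _ _) (qMean_le hq (hδ n) _ _) hq0.le
    · refine Tendsto.const_mul (a x) ?_
      have := ((tendsto_qMean hq (u x) (v x)).abs).rpow_const (p := q) (Or.inr hq0.le)
      rwa [abs_of_nonneg (hz0 x)] at this
  -- the energy bound
  have hEn (n : ℕ) : energyE Ω p lam (w n) ≤ ((∫ x in Ω, ‖g x‖ ^ p) + ∫ x in Ω, ‖k x‖ ^ p) / 2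
      + -lam * ∫ x in Ω, z x ^ p := by
    rw [(hwE n).toHasSobolevGradient.energyE_eq hp hΩ]
    refine add_le_add ?_ (mul_le_mul_of_nonneg_left ?_ (by linarith))
    · rw [← integral_add ig ik, ← integral_div]
      exact integral_mono (integrable_norm_rpow_real hp0 (hwE n).memLp_grad)
        ((ig.add ik).div_const 2)
        fun x => norm_qMean_gradient_le hq hqp.le (hδ n) _ _ _ _
    · refine integral_mono (integrable_abs_rpow hp0 le_rfl (hwE n).memLp) iz fun x => ?_
      simp only
      rw [abs_of_nonneg (qMean_nonneg hq (hδ n) _ _)]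
      exact Real.rpow_le_rpow (qMean_nonneg hq (hδ n) _ _) (qMean_le hq (hδ n) _ _) hp0.le
  -- The constraint value of `w n` is 1 only asymptotically, hence the homogeneous form of `hm`,
  -- usable as soon as that value is positive.
  have hlim : m ≤ ((∫ x in Ω, ‖g x‖ ^ p) + ∫ x in Ω, ‖k x‖ ^ p) / 2
      + -lam * ∫ x in Ω, z x ^ p := by
    have h1 := (hA.rpow_const (p := p / q) (Or.inr (by positivity))).const_mul m
    rw [Real.one_rpow, mul_one] at h1
    refine le_of_tendsto h1 ?_
    filter_upwards [hA.eventually (lt_mem_nhds one_pos)] with n hn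
    exact (hm _ _ (hwE n) hn).trans (hEn n)
  have hD : ∫ x in Ω, midDefect (p / q) (|u x| ^ q) (|v x| ^ q)
      = ((∫ x in Ω, |u x| ^ p) + ∫ x in Ω, |v x| ^ p) / 2 - ∫ x in Ω, z x ^ p := by
    have iuv : Integrable (fun x => (|u x| ^ p + |v x| ^ p) / 2) (volume.restrict Ω) :=
      (iu.add iv).div_const 2
    rw [← integral_add iu iv, ← integral_div, ← integral_sub iuv iz]
    refine integral_congr_ae (Eventually.of_forall fun x => ?_)
    simp only [midDefect]
    rw [hzp, Real.norm_of_nonneg (by positivity), Real.norm_of_nonneg (by positivity),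
      Real.norm_of_nonneg (by positivity), hpq, hpq, smul_eq_mul]
    congr 2
    ring
  rw [hD, hu.toHasSobolevGradient.energyE_eq hp hΩ, hv.toHasSobolevGradient.energyE_eq hp hΩ]
  linarith

end MidpointInequality

/-! ### Existence, uniqueness and positivity of `m_+` -/

section Minimizer

variable {N : ℕ} {Ω : Set (Eucl N)} {p q lam M : ℝ} {a u v : Eucl N → ℝ}
  {g k : Eucl N → Eucl N} {B : BoundaryCondition}

/-- The standing assumptions on the exponents, the parameter and the weight. -/
structure Admissible (Ω : Set (Eucl N)) (p q lam : ℝ) (a : Eucl N → ℝ) (M : ℝ) : Prop where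
  isOpen : IsOpen Ω
  one_lt : 1 < q
  lt : q < p
  lam_neg : lam < 0
  aesm : AEStronglyMeasurable a (volume.restrict Ω)
  bound : ∀ᵐ x ∂(volume.restrict Ω), |a x| ≤ M

lemma Admissible.q_pos (D : Admissible Ω p q lam a M) : 0 < q := zero_lt_one.trans D.one_lt
lemma Admissible.one_lt_p (D : Admissible Ω p q lam a M) : 1 < p := D.one_lt.trans D.lt
lemma Admissible.p_pos (D : Admissible Ω p q lam a M) : 0 < p := zero_lt_one.trans D.one_lt_p

lemma weightInt_const_mul (c : ℝ) : weightInt Ω q a (fun x => c * u x)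
    = |c| ^ q * weightInt Ω q a u := by
  rw [weightInt, weightInt, ← integral_const_mul]
  refine integral_congr_ae (Eventually.of_forall fun x => ?_)
  simp only
  rw [abs_mul, Real.mul_rpow (abs_nonneg _) (abs_nonneg _)]
  ring

lemma weightInt_abs : weightInt Ω q a (fun x => |u x|) = weightInt Ω q a u := by
  simp [weightInt]

lemma weightInt_congr (h : u =ᵐ[volume.restrict Ω] v) : weightInt Ω q a u = weightInt Ω q a v :=
  integral_congr_ae (h.mono fun x hx => by simp only [hx])

lemma exists_bump_in_posSet {x₀ : Eucl N} (hpos : posSet Ω a ∈ 𝓝 x₀) :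
    ∃ φ : Eucl N → ℝ, IsTestFunction Ω φ ∧ tsupport φ ⊆ posSet Ω a ∧ (∀ x, 0 ≤ φ x) ∧
      φ x₀ = 1 := by
  obtain ⟨φ, h1, h2, h3, h4, h5⟩ := exists_contDiff_tsupport_subset (n := ⊤) hpos
  exact ⟨φ, ⟨h3, h2, h1.trans fun x hx => hx.1⟩, h1, fun x => (h4 ⟨x, rfl⟩).1, h5⟩

lemma weightInt_normalize (D : Admissible Ω p q lam a M) (h : 0 < weightInt Ω q a u) :
    weightInt Ω q a (fun x => weightInt Ω q a u ^ (-(1 / q)) * u x) = 1 := by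
  rw [weightInt_const_mul, abs_of_pos (by positivity), ← Real.rpow_mul h.le, neg_mul,
    one_div_mul_cancel D.q_pos.ne', Real.rpow_neg_one, inv_mul_cancel₀ h.ne']

lemma Admissible.one_lt_div (D : Admissible Ω p q lam a M) : 1 < p / q :=
  (_root_.one_lt_div D.q_pos).2 D.lt

lemma Admissible.memLp_rpow (D : Admissible Ω p q lam a M)
    (hu : MemLp u (ENNReal.ofReal p) (volume.restrict Ω)) :
    MemLp (fun x => |u x| ^ q) (ENNReal.ofReal (p / q)) (volume.restrict Ω) := by
  have := hu.norm_rpow_div (ENNReal.ofReal q)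
  rw [ENNReal.toReal_ofReal D.q_pos.le, ← ENNReal.ofReal_div_of_pos D.q_pos] at this
  exact this

variable [IsFiniteMeasure (volume.restrict Ω)]

lemma InEnergySpace.energyE_const_mul (D : Admissible Ω p q lam a M) (h : InEnergySpace B Ω p u g)
    (c : ℝ) : energyE Ω p lam (fun x => c * u x) = |c| ^ p * energyE Ω p lam u := by
  have hp := D.one_lt_p.le
  rw [(h.const_mul c).toHasSobolevGradient.energyE_eq hp D.isOpen,
    h.toHasSobolevGradient.energyE_eq hp D.isOpen]
  simp_rw [norm_smul, abs_mul, Real.norm_eq_abs, Real.mul_rpow (abs_nonneg c) (norm_nonneg _),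
    Real.mul_rpow (abs_nonneg c) (abs_nonneg _), integral_const_mul]
  ring

lemma InEnergySpace.energyE_nonneg (D : Admissible Ω p q lam a M) (h : InEnergySpace B Ω p u g) :
    0 ≤ energyE Ω p lam u := by
  rw [h.toHasSobolevGradient.energyE_eq D.one_lt_p.le D.isOpen]
  have h1 : 0 ≤ ∫ x in Ω, ‖g x‖ ^ p := integral_nonneg fun x => by positivity
  have h2 : 0 ≤ ∫ x in Ω, |u x| ^ p := integral_nonneg fun x => by positivity
  have := D.lam_neg
  nlinarith

lemma InEnergySpace.ae_eq_zero_of_energyE_nonpos (D : Admissible Ω p q lam a M)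
    (h : InEnergySpace B Ω p u g) (hE : energyE Ω p lam u ≤ 0) :
    u =ᵐ[volume.restrict Ω] fun _ => 0 := by
  rw [h.toHasSobolevGradient.energyE_eq D.one_lt_p.le D.isOpen] at hE
  have h1 : 0 ≤ ∫ x in Ω, ‖g x‖ ^ p := integral_nonneg fun x => by positivity
  have h2 : 0 ≤ ∫ x in Ω, |u x| ^ p := integral_nonneg fun x => by positivity
  have h3 : ∫ x in Ω, |u x| ^ p = 0 := by
    have := D.lam_neg
    nlinarith
  rw [integral_eq_zero_iff_of_nonneg (fun x => by positivity)
    (integrable_abs_rpow D.p_pos le_rfl h.memLp)] at h3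
  filter_upwards [h3] with x hx
  have : |u x| = 0 := (Real.rpow_eq_zero (abs_nonneg _) D.p_pos.ne').1 hx
  exact abs_eq_zero.1 this

lemma InEnergySpace.energyE_abs_le (D : Admissible Ω p q lam a M) (h : InEnergySpace B Ω p u g) :
    energyE Ω p lam (fun x => |u x|) ≤ energyE Ω p lam u := by
  have hp := D.one_lt_p.le
  have h' := h.abs hp D.isOpen
  rw [h'.toHasSobolevGradient.energyE_eq hp D.isOpen, h.toHasSobolevGradient.energyE_eq hp D.isOpen]
  simp only [abs_abs, add_le_add_iff_right]
  refine integral_mono (integrable_norm_rpow_real D.p_pos h'.memLp_grad)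
    (integrable_norm_rpow_real D.p_pos h.memLp_grad) fun x => ?_
  simp only
  rw [norm_smul, Real.norm_eq_abs]
  exact Real.rpow_le_rpow (by positivity)
    (mul_le_of_le_one_left (norm_nonneg _) (abs_sign_le_one _)) D.p_pos.le

lemma bddBelow_energyE (D : Admissible Ω p q lam a M) :
    BddBelow (energyE Ω p lam '' Splus B Ω p q a) := by
  refine ⟨0, ?_⟩
  rintro _ ⟨u, hu, rfl⟩
  exact (inEnergySpace_weakGrad D.one_lt_p.le D.isOpen hu.1).energyE_nonneg D

lemma InEnergySpace.mPlus_le (D : Admissible Ω p q lam a M) (h : InEnergySpace B Ω p u g)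
    (h1 : weightInt Ω q a u = 1) : mPlus B Ω p q lam a ≤ energyE Ω p lam u :=
  csInf_le (bddBelow_energyE D) ⟨u, ⟨h.mem_energySpace D.one_lt_p.le D.isOpen, h1⟩, rfl⟩

lemma InEnergySpace.energyE_normalize (D : Admissible Ω p q lam a M) (h : InEnergySpace B Ω p u g)
    (hA : 0 < weightInt Ω q a u) :
    energyE Ω p lam (fun x => weightInt Ω q a u ^ (-(1 / q)) * u x)
      = energyE Ω p lam u / weightInt Ω q a u ^ (p / q) := by
  rw [h.energyE_const_mul D, abs_of_pos (by positivity), ← Real.rpow_mul hA.le, neg_mul,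
    Real.rpow_neg hA.le, one_div_mul_eq_div, inv_mul_eq_div]

lemma InEnergySpace.mPlus_mul_le (D : Admissible Ω p q lam a M) (h : InEnergySpace B Ω p u g)
    (hA : 0 < weightInt Ω q a u) :
    mPlus B Ω p q lam a * weightInt Ω q a u ^ (p / q) ≤ energyE Ω p lam u := by
  have := (h.const_mul (weightInt Ω q a u ^ (-(1 / q)))).mPlus_le D (weightInt_normalize D hA)
  rwa [h.energyE_normalize D hA, le_div_iff₀ (by positivity)] at this

lemma InEnergySpace.midpoint (D : Admissible Ω p q lam a M) (hu : InEnergySpace B Ω p u g)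
    (hv : InEnergySpace B Ω p v k) (hu1 : weightInt Ω q a u = 1) (hv1 : weightInt Ω q a v = 1) :
    -lam * ∫ x in Ω, midDefect (p / q) (|u x| ^ q) (|v x| ^ q)
      ≤ (energyE Ω p lam u + energyE Ω p lam v) / 2 - mPlus B Ω p q lam a :=
  midpoint_inequality D.isOpen D.one_lt D.lt D.lam_neg D.aesm D.bound
    (fun _ _ hw hA => hw.mPlus_mul_le D hA) hu hv hu1 hv1

/-- For two minimizers the right side of the midpoint inequality is at most 0, so the defect of the
`q`-th powers vanishes a.e.; nonnegativity then allows taking roots. -/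
lemma InEnergySpace.ae_eq_of_minimizers (D : Admissible Ω p q lam a M)
    (hu : InEnergySpace B Ω p u g) (hv : InEnergySpace B Ω p v k)
    (hu0 : NonnegIn Ω u) (hv0 : NonnegIn Ω v)
    (hu1 : weightInt Ω q a u = 1) (hv1 : weightInt Ω q a v = 1)
    (huE : energyE Ω p lam u ≤ mPlus B Ω p q lam a)
    (hvE : energyE Ω p lam v ≤ mPlus B Ω p q lam a) : u =ᵐ[volume.restrict Ω] v := by
  have h := hu.midpoint D hv hu1 hv1
  have hr := D.one_lt_div
  have hnn : 0 ≤ ∫ x in Ω, midDefect (p / q) (|u x| ^ q) (|v x| ^ q) :=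
    integral_nonneg fun x => midDefect_nonneg hr.le _ _
  have h0 : ∫ x in Ω, midDefect (p / q) (|u x| ^ q) (|v x| ^ q) = 0 := by
    have := D.lam_neg
    nlinarith
  rw [integral_eq_zero_iff_of_nonneg (fun x => midDefect_nonneg hr.le _ _)
    (MemLp.integrable_midDefect hr.le (D.memLp_rpow hu.memLp) (D.memLp_rpow hv.memLp))] at h0
  filter_upwards [h0, hu0, hv0] with x hx h1 h2
  have h3 := eq_of_midDefect_nonpos hr hx.le
  rw [abs_of_nonneg h1, abs_of_nonneg h2] at h3
  exact (Real.rpow_left_inj h1 h2 D.q_pos.ne').1 h3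

/-- Superadditivity of `t^q` on `[0, ∞)`. It converts Cauchy `q`-th powers in `L^(p/q)` into Cauchy
functions in `L^p`. -/
lemma abs_sub_rpow_le (hq : 1 ≤ q) {s t : ℝ} (hs : 0 ≤ s) (ht : 0 ≤ t) :
    |s - t| ^ q ≤ |s ^ q - t ^ q| := by
  wlog h : t ≤ s generalizing s t
  · rw [abs_sub_comm, abs_sub_comm (s ^ q)]
    exact this ht hs (le_of_not_ge h)
  rw [abs_of_nonneg (sub_nonneg.2 h)]
  have h1 := Real.add_rpow_le_rpow_add (sub_nonneg.2 h) ht hq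
  rw [sub_add_cancel] at h1
  exact (by linarith : (s - t) ^ q ≤ s ^ q - t ^ q).trans (le_abs_self _)

/-- A nonnegative minimizing sequence converges in the energy space. -/
lemma exists_minimizer_of_seq (D : Admissible Ω p q lam a M) {w : ℕ → Eucl N → ℝ}
    {f : ℕ → Eucl N → Eucl N} (hw : ∀ n, InEnergySpace B Ω p (w n) (f n))
    (hw0 : ∀ n, NonnegIn Ω (w n)) (hw1 : ∀ n, weightInt Ω q a (w n) = 1)
    (hE : Tendsto (fun n => energyE Ω p lam (w n)) atTop (𝓝 (mPlus B Ω p q lam a))) :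
    ∃ V G, InEnergySpace B Ω p V G ∧ NonnegIn Ω V ∧ weightInt Ω q a V = 1 ∧
      energyE Ω p lam V = mPlus B Ω p q lam a := by
  have hp := D.one_lt_p.le
  have hp0 := D.p_pos
  have hr := D.one_lt_div
  have hlam := D.lam_neg
  set m := mPlus B Ω p q lam a with hm
  obtain ⟨K, hK⟩ : ∃ K, ∀ n, energyE Ω p lam (w n) ≤ K := by
    obtain ⟨K, hK⟩ := hE.bddAbove_range
    exact ⟨K, fun n => hK ⟨n, rfl⟩⟩
  have hI1 (n : ℕ) : 0 ≤ ∫ x in Ω, ‖f n x‖ ^ p := integral_nonneg fun x => by positivity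
  have hI2 (n : ℕ) : 0 ≤ ∫ x in Ω, |w n x| ^ p := integral_nonneg fun x => by positivity
  have hEeq (n : ℕ) := (hw n).toHasSobolevGradient.energyE_eq (lam := lam) hp D.isOpen
  have hpq (s : ℝ) : (|s| ^ q) ^ (p / q) = |s| ^ p := by
    rw [← Real.rpow_mul (abs_nonneg _), mul_div_cancel₀ _ D.q_pos.ne']
  have hEE : Tendsto (fun z : ℕ × ℕ => (energyE Ω p lam (w z.1) + energyE Ω p lam (w z.2)) / 2 - m)
      (atTop ×ˢ atTop) (𝓝 0) := by
    have hfst : Tendsto (fun z : ℕ × ℕ => energyE Ω p lam (w z.1)) (atTop ×ˢ atTop) (𝓝 m) :=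
      hE.comp tendsto_fst
    have hsnd : Tendsto (fun z : ℕ × ℕ => energyE Ω p lam (w z.2)) (atTop ×ˢ atTop) (𝓝 m) :=
      hE.comp tendsto_snd
    have h1 := ((hfst.add hsnd).div_const 2).sub_const m
    have e : (m + m) / 2 - m = 0 := by ring
    rwa [e] at h1
  -- convergence of the functions
  have hc1 : Tendsto (fun z : ℕ × ℕ => ∫ x in Ω, midDefect (p / q) (|w z.1 x| ^ q) (|w z.2 x| ^ q))
      (atTop ×ˢ atTop) (𝓝 0) := by
    have h2 := hEE.div_const (-lam)
    rw [zero_div] at h2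
    refine squeeze_zero (fun z => integral_nonneg fun x => midDefect_nonneg hr.le _ _)
      (fun z => ?_) h2
    rw [le_div_iff₀ (by linarith), mul_comm]
    exact (hw z.1).midpoint D (hw z.2) (hw1 _) (hw1 _)
  -- An energy bound `K` controls `∫ |w n|^p` by `K / -lam`, since the gradient term is nonnegative;
  -- this is where a strictly negative `lam` gives coercivity.
  have hc2 := tendsto_integral_norm_sub_of_midDefect hr (fun n => D.memLp_rpow (hw n).memLp)
    (M := K / -lam) (fun n => by
      have : ∀ x, ‖|w n x| ^ q‖ ^ (p / q) = |w n x| ^ p := fun x => by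
        rw [Real.norm_of_nonneg (by positivity), hpq]
      simp_rw [this]
      rw [le_div_iff₀ (by linarith)]
      have := hK n
      rw [hEeq] at this
      linarith [hI1 n]) hc1
  have hc3 : Tendsto (fun z : ℕ × ℕ => ∫ x in Ω, ‖w z.1 x - w z.2 x‖ ^ p) (atTop ×ˢ atTop)
      (𝓝 0) := by
    refine squeeze_zero (fun z => integral_nonneg fun x => by positivity) (fun z => ?_) hc2
    refine integral_mono_ae (integrable_norm_rpow_real hp0 ((hw z.1).memLp.sub (hw z.2).memLp))
      (integrable_norm_rpow_real (by linarith)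
        ((D.memLp_rpow (hw z.1).memLp).sub (D.memLp_rpow (hw z.2).memLp))) ?_
    filter_upwards [hw0 z.1, hw0 z.2] with x h1 h2
    have h3 := abs_sub_rpow_le D.one_lt.le h1 h2
    have h4 := Real.rpow_le_rpow (by positivity) h3 (by linarith : 0 ≤ p / q)
    rw [hpq] at h4
    simpa only [Real.norm_eq_abs, abs_of_nonneg h1, abs_of_nonneg h2] using h4
  obtain ⟨V, hV, hVl⟩ := exists_limit_of_integral_cauchy hp (fun n => (hw n).memLp) hc3
  have hA : weightInt Ω q a V = 1 := by
    have := tendsto_weightInt D.one_lt.le D.lt.le D.aesm D.bound (fun n => (hw n).memLp) hV hVl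
    simp only [hw1] at this
    exact (tendsto_nhds_unique this tendsto_const_nhds)
  -- convergence of the gradients
  have hmid (z : ℕ × ℕ) := ((hw z.1).add hp (hw z.2)).const_mul (2⁻¹ : ℝ)
  have hAmid : Tendsto (fun z : ℕ × ℕ => weightInt Ω q a (fun x => (2⁻¹ : ℝ) * (w z.1 x + w z.2 x)))
      (atTop ×ˢ atTop) (𝓝 1) := by
    rw [← hA]
    refine tendsto_weightInt D.one_lt.le D.lt.le D.aesm D.bound (fun z => (hmid z).memLp) hV ?_
    have h1 := (hVl.comp tendsto_fst).add (hVl.comp tendsto_snd)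
      (x := (atTop : Filter ℕ) ×ˢ (atTop : Filter ℕ))
    rw [add_zero] at h1
    refine tendsto_of_tendsto_of_tendsto_of_le_of_le tendsto_const_nhds h1 (fun _ => zero_le)
      fun z => ?_
    have e : (fun x => (2⁻¹ : ℝ) * (w z.1 x + w z.2 x)) - V
        = (2⁻¹ : ℝ) • ((w z.1 - V) + (w z.2 - V)) := by
      ext x; simp; ring
    rw [e, eLpNorm_const_smul]
    refine le_trans (mul_le_of_le_one_left' ?_) (eLpNorm_add_le ((hw z.1).memLp.sub hV).1
      ((hw z.2).memLp.sub hV).1 (by simpa using hp))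
    rw [← ofReal_norm]
    norm_num
  -- The arithmetic midpoint has constraint value tending to 1, so its energy is at least a quantity
  -- tending to `m`. The zero-order terms are convex, so the gradient defect is bounded by the total
  -- energy defect and is squeezed to 0.
  have hc4 : Tendsto (fun z : ℕ × ℕ => ∫ x in Ω, midDefect p (f z.1 x) (f z.2 x)) (atTop ×ˢ atTop)
      (𝓝 0) := by
    have h1 : Tendsto (fun z : ℕ × ℕ => (energyE Ω p lam (w z.1) + energyE Ω p lam (w z.2)) / 2
        - m * weightInt Ω q a (fun x => (2⁻¹ : ℝ) * (w z.1 x + w z.2 x)) ^ (p / q))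
        (atTop ×ˢ atTop) (𝓝 0) := by
      have h2 := (hAmid.rpow_const (p := p / q) (Or.inr (by linarith))).const_mul m
      rw [Real.one_rpow, mul_one] at h2
      have h3 := (hEE.add_const m).sub h2
      simpa using h3
    refine tendsto_of_tendsto_of_tendsto_of_le_of_le' tendsto_const_nhds h1
      (Eventually.of_forall fun z => integral_nonneg fun x => midDefect_nonneg hp _ _) ?_
    filter_upwards [hAmid.eventually (lt_mem_nhds one_pos)] with z hz
    have h4 := (hmid z).mPlus_mul_le D hz
    rw [(hmid z).toHasSobolevGradient.energyE_eq hp D.isOpen] at h4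
    rw [hEeq, hEeq]
    have i1 := integrable_norm_rpow_real hp0 (hw z.1).memLp_grad
    have i2 := integrable_norm_rpow_real hp0 (hw z.2).memLp_grad
    have i3 := integrable_norm_rpow_real hp0 (hmid z).memLp_grad
    have j1 := integrable_abs_rpow hp0 le_rfl (hw z.1).memLp
    have j2 := integrable_abs_rpow hp0 le_rfl (hw z.2).memLp
    have j3 := integrable_abs_rpow hp0 le_rfl (hmid z).memLp
    have i12 : Integrable (fun x => (‖f z.1 x‖ ^ p + ‖f z.2 x‖ ^ p) / 2) (volume.restrict Ω) :=
      (i1.add i2).div_const 2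
    have e1 : ∫ x in Ω, midDefect p (f z.1 x) (f z.2 x)
        = ((∫ x in Ω, ‖f z.1 x‖ ^ p) + ∫ x in Ω, ‖f z.2 x‖ ^ p) / 2
          - ∫ x in Ω, ‖(2⁻¹ : ℝ) • (f z.1 x + f z.2 x)‖ ^ p := by
      rw [← integral_add i1 i2, ← integral_div, ← integral_sub i12 i3]
      rfl
    have e2 : ∫ x in Ω, |(2⁻¹ : ℝ) * (w z.1 x + w z.2 x)| ^ p
        ≤ ((∫ x in Ω, |w z.1 x| ^ p) + ∫ x in Ω, |w z.2 x| ^ p) / 2 := by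
      rw [← integral_add j1 j2, ← integral_div]
      refine integral_mono j3 ((j1.add j2).div_const 2) fun x => ?_
      have := midDefect_nonneg hp (w z.1 x) (w z.2 x)
      simp only [midDefect, Real.norm_eq_abs, smul_eq_mul] at this
      simp only
      linarith
    have e3 := mul_le_mul_of_nonneg_left e2 (by linarith : 0 ≤ -lam)
    rw [e1]
    linarith
  have hc5 := tendsto_integral_norm_sub_of_midDefect D.one_lt_p (fun n => (hw n).memLp_grad)
    (M := K) (fun n => by
      have := hK n
      rw [hEeq] at this
      have h2 := hI2 n
      nlinarith) hc4
  obtain ⟨G, hG, hGl⟩ := exists_limit_of_integral_cauchy hp (fun n => (hw n).memLp_grad) hc5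
  have hVG : InEnergySpace B Ω p V G := InEnergySpace.of_tendsto hp hw hV hG hVl hGl
  refine ⟨V, G, hVG, ?_, hA, ?_⟩
  · obtain ⟨ns, -, hns⟩ := (tendstoInMeasure_of_tendsto_eLpNorm (by simpa using hp0)
      (fun n => (hw n).memLp.1) hV.1 hVl).exists_seq_tendsto_ae
    filter_upwards [hns, ae_all_iff.2 hw0] with x hx h0
    exact ge_of_tendsto' hx fun n => h0 _
  · have h1 := tendsto_integral_norm_rpow hp (fun n => (hw n).memLp_grad) hG hGl
    have h2 := tendsto_integral_norm_rpow hp (fun n => (hw n).memLp) hV hVl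
    have h3 := h1.add (h2.const_mul (-lam))
    refine tendsto_nhds_unique ?_ hE
    rw [hVG.toHasSobolevGradient.energyE_eq hp D.isOpen]
    exact h3.congr fun n => (hEeq n).symm

lemma splus_nonempty (D : Admissible Ω p q lam a M) {x₀ : Eucl N}
    (hpos : posSet Ω a ∈ 𝓝 x₀) : (Splus B Ω p q a).Nonempty := by
  obtain ⟨φ, hφ, hsupp, hφ0, hφ1⟩ := exists_bump_in_posSet hpos
  have hE := inEnergySpace_of_contDiff D.one_lt_p.le D.isOpen B hφ.contDiff_one hφ.2.1 hφ.2.2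
  have hpt (x : Eucl N) (hx : φ x ≠ 0) : 0 < a x := (hsupp (subset_tsupport φ hx)).2
  have hA : 0 < weightInt Ω q a φ := by
    rw [weightInt, setIntegral_pos_iff_support_of_nonneg_ae (Eventually.of_forall fun x => ?_)
      (integrable_weight D.q_pos D.lt.le D.aesm D.bound hE.memLp)]
    · have hsub : {x | 0 < φ x} ⊆ Function.support (fun x => a x * |φ x| ^ q) ∩ Ω := by
        intro x hx
        refine ⟨?_, hφ.2.2 (subset_tsupport φ (ne_of_gt hx))⟩
        have h1 := hpt x (ne_of_gt hx)
        have h2 : 0 < |φ x| := abs_pos.2 (ne_of_gt hx)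
        exact (by positivity : 0 < a x * |φ x| ^ q).ne'
      refine lt_of_lt_of_le ?_ (measure_mono hsub)
      exact (isOpen_lt continuous_const hφ.1.continuous).measure_pos volume
        ⟨x₀, by simp [hφ1]⟩
    · by_cases hx : φ x = 0
      · simp [hx, Real.zero_rpow D.q_pos.ne']
      · have := hpt x hx
        simp only [Pi.zero_apply]
        positivity
  exact ⟨_, (hE.const_mul _).mem_energySpace D.one_lt_p.le D.isOpen, weightInt_normalize D hA⟩

/-- Absolute values keep the constraint and do not raise the energy, so a minimizing sequence may be
taken nonnegative. -/
lemma exists_minimizer (D : Admissible Ω p q lam a M) (hne : (Splus B Ω p q a).Nonempty) :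
    ∃ V G, InEnergySpace B Ω p V G ∧ NonnegIn Ω V ∧ weightInt Ω q a V = 1 ∧
      energyE Ω p lam V = mPlus B Ω p q lam a := by
  have hp := D.one_lt_p.le
  obtain ⟨e, -, hel, heS⟩ := exists_seq_tendsto_sInf (hne.image (energyE Ω p lam))
    (bddBelow_energyE D)
  choose w hw hwe using heS
  have hwE (n : ℕ) := inEnergySpace_weakGrad hp D.isOpen (hw n).1
  have hwA (n : ℕ) : weightInt Ω q a (fun x => |w n x|) = 1 := by
    rw [weightInt_abs]; exact (hw n).2
  refine exists_minimizer_of_seq D (fun n => (hwE n).abs hp D.isOpen)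
    (fun n => Eventually.of_forall fun x => abs_nonneg _) hwA ?_
  refine tendsto_of_tendsto_of_tendsto_of_le_of_le tendsto_const_nhds hel
    (fun n => ((hwE n).abs hp D.isOpen).mPlus_le D (hwA n)) fun n => ?_
  rw [← hwe n]
  exact (hwE n).energyE_abs_le D

/-- The infimum is attained, and with `lam < 0` a function of nonpositive energy vanishes a.e.,
which contradicts the constraint. -/
lemma mPlus_pos (D : Admissible Ω p q lam a M) (hV : InEnergySpace B Ω p u g)
    (hA : weightInt Ω q a u = 1) (hE : energyE Ω p lam u = mPlus B Ω p q lam a) :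
    0 < mPlus B Ω p q lam a := by
  by_contra hcon
  have h0 := hV.ae_eq_zero_of_energyE_nonpos D (hE.trans_le (not_lt.1 hcon))
  rw [weightInt_congr h0] at hA
  simp [weightInt, Real.zero_rpow D.q_pos.ne'] at hA

end Minimizer

/-! ### Integrability of the pairings and the optimal scaling -/

section PairingIntegrable

variable {α E : Type*} [MeasurableSpace α] {μ : Measure α} [NormedAddCommGroup E]

lemma integrable_rpow_mul_norm {r : ℝ} (hr : 1 < r) {F : Type*} [NormedAddCommGroup F]
    {u : α → E} {v : α → F}
    (hu : MemLp u (ENNReal.ofReal r) μ) (hv : MemLp v (ENNReal.ofReal r) μ) :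
    Integrable (fun x => ‖u x‖ ^ (r - 1) * ‖v x‖) μ := by
  have hr0 : 0 < r := by linarith
  refine ((integrable_norm_rpow_real hr0 hu).add (integrable_norm_rpow_real hr0 hv)).mono'
    ((hu.aestronglyMeasurable.norm.aemeasurable.pow_const _).aestronglyMeasurable.mul
      hv.aestronglyMeasurable.norm) (Eventually.of_forall fun x => ?_)
  rw [Real.norm_of_nonneg (by positivity)]
  exact rpow_mul_le_add hr (norm_nonneg _) (norm_nonneg _)

lemma integrable_rpow_inner [InnerProductSpace ℝ E] {r : ℝ} (hr : 1 < r) {u v : α → E}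
    (hu : MemLp u (ENNReal.ofReal r) μ) (hv : MemLp v (ENNReal.ofReal r) μ) :
    Integrable (fun x => ‖u x‖ ^ (r - 2) * inner ℝ (u x) (v x)) μ :=
  (integrable_rpow_mul_norm hr hu hv).mono'
    ((hu.aestronglyMeasurable.norm.aemeasurable.pow_const _).aestronglyMeasurable.mul
      (hu.aestronglyMeasurable.inner hv.aestronglyMeasurable))
    (Eventually.of_forall fun _ => abs_rpow_sub_two_mul_inner_le _ _)

end PairingIntegrable

lemma rpow_sub_two_mul_inner_of_nonneg {r : ℝ} (hr : 1 < r) {s : ℝ} (hs : 0 ≤ s) (t : ℝ) :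
    ‖s‖ ^ (r - 2) * inner ℝ s t = s ^ (r - 1) * t := by
  rw [Real.norm_of_nonneg hs]
  rcases hs.eq_or_lt with h | h
  · simp [← h, Real.zero_rpow (by linarith : r - 1 ≠ 0)]
  · have e : r - 1 = (r - 2) + 1 := by ring
    rw [e, Real.rpow_add_one h.ne']
    simp
    ring

/-- A strict tangent line inequality, which determines the optimal scaling. -/
lemma scaling_lt {p q m S A : ℝ} (hq : 0 < q) (hqp : q < p) (hS : 0 < S)
    (hmS : m * S ^ (p / q) = S) (hA : 0 < A) (hne : A ≠ S) :
    S * (1 / p - 1 / q) < m * A ^ (p / q) / p - A / q := by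
  have hp : 0 < p := hq.trans hqp
  have hr : 1 < p / q := (one_lt_div hq).2 hqp
  have hτ : 0 < A / S := by positivity
  -- Strict Bernoulli inequality for the ratio `A / S`, that is, the tangent to `t^(p/q)` at 1.
  have h1 := one_add_mul_self_lt_rpow_one_add (s := A / S - 1) (by linarith)
    (by rw [sub_ne_zero]; intro h; rw [div_eq_one_iff_eq hS.ne'] at h; exact hne h) hr
  rw [add_sub_cancel, Real.div_rpow hA.le hS.le] at h1
  have h2 : m * A ^ (p / q) = S * (A ^ (p / q) / S ^ (p / q)) := by
    have : 0 < S ^ (p / q) := by positivity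
    nth_rw 1 [← hmS]
    field_simp
  have h3 := mul_lt_mul_of_pos_left h1 (by positivity : 0 < S / p)
  have h4 : S / p * (1 + p / q * (A / S - 1)) = S * (1 / p - 1 / q) + A / q := by
    field_simp; ring
  have h5 : m * A ^ (p / q) / p = S / p * (A ^ (p / q) / S ^ (p / q)) := by
    rw [h2]; ring
  rw [h5]
  linarith

section Scaling

variable {p q m : ℝ}

lemma scaling_rpow_q (hm : 0 < m) :
    (m ^ (-(1 / (p - q)))) ^ q = m ^ (-(q / (p - q))) := by
  rw [← Real.rpow_mul hm.le]
  congr 1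
  ring

lemma scaling_rpow_p (hqp : q < p) (hm : 0 < m) :
    (m ^ (-(1 / (p - q)))) ^ p * m = m ^ (-(q / (p - q))) := by
  rw [← Real.rpow_mul hm.le, ← Real.rpow_add_one hm.ne']
  congr 1
  have : p - q ≠ 0 := by linarith
  field_simp
  ring

/-- The value `S = m^(-q/(p-q))` solves `m S^(p/q) = S`, the stationarity condition of `A ↦ m
A^(p/q)/p - A/q`. -/
lemma scaling_optimal (hq : 0 < q) (hqp : q < p) (hm : 0 < m) :
    m * (m ^ (-(q / (p - q)))) ^ (p / q) = m ^ (-(q / (p - q))) := by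
  rw [← scaling_rpow_q hm, ← Real.rpow_mul (by positivity), mul_div_cancel₀ _ hq.ne', mul_comm,
    scaling_rpow_p hqp hm, scaling_rpow_q hm]

end Scaling

/-! ### Minimizers of `I` and the Euler–Lagrange equation -/

section Minimizer

variable {N : ℕ} {Ω : Set (Eucl N)} {p q lam M : ℝ} {a u v V W φ : Eucl N → ℝ}
  {g k G H : Eucl N → Eucl N} {B : BoundaryCondition}

lemma weightInt_rescaled (hm : 0 < mPlus B Ω p q lam a) (hV1 : weightInt Ω q a V = 1) :
    weightInt Ω q a (fun x => mPlus B Ω p q lam a ^ (-(1 / (p - q))) * V x)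
      = mPlus B Ω p q lam a ^ (-(q / (p - q))) := by
  rw [weightInt_const_mul, hV1, abs_of_pos (by positivity), scaling_rpow_q hm, mul_one]

variable [IsFiniteMeasure (volume.restrict Ω)]

lemma InEnergySpace.energyI_eq' (D : Admissible Ω p q lam a M) (h : InEnergySpace B Ω p u g) :
    energyI Ω p q lam a u = energyE Ω p lam u / p - weightInt Ω q a u / q :=
  h.toHasSobolevGradient.energyI_eq D.one_lt_p.le D.q_pos D.lt.le D.isOpen D.aesm D.bound

lemma InEnergySpace.le_energyI (D : Admissible Ω p q lam a M) (h : InEnergySpace B Ω p u g)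
    (hm : 0 < mPlus B Ω p q lam a) (hA : 0 < weightInt Ω q a u) :
    mPlus B Ω p q lam a ^ (-(q / (p - q))) * (1 / p - 1 / q) ≤ energyI Ω p q lam a u := by
  have hopt := scaling_optimal D.q_pos D.lt hm
  have hE := div_le_div_of_nonneg_right (h.mPlus_mul_le D hA) D.p_pos.le
  rw [h.energyI_eq' D]
  rcases eq_or_ne (weightInt Ω q a u) (mPlus B Ω p q lam a ^ (-(q / (p - q)))) with he | he
  · rw [he, hopt] at hE
    rw [he]
    linear_combination hE
  · have := scaling_lt D.q_pos D.lt (by positivity) hopt hA he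
    linarith

lemma InEnergySpace.weightInt_eq_of_energyI_le (D : Admissible Ω p q lam a M)
    (h : InEnergySpace B Ω p u g) (hm : 0 < mPlus B Ω p q lam a) (hA : 0 < weightInt Ω q a u)
    (hI : energyI Ω p q lam a u ≤ mPlus B Ω p q lam a ^ (-(q / (p - q))) * (1 / p - 1 / q)) :
    weightInt Ω q a u = mPlus B Ω p q lam a ^ (-(q / (p - q))) := by
  by_contra he
  have := scaling_lt D.q_pos D.lt (by positivity) (scaling_optimal D.q_pos D.lt hm) hA he
  have hE := div_le_div_of_nonneg_right (h.mPlus_mul_le D hA) D.p_pos.le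
  rw [h.energyI_eq' D] at hI
  linarith

lemma InEnergySpace.energyE_rescaled (D : Admissible Ω p q lam a M)
    (hm : 0 < mPlus B Ω p q lam a) (hV : InEnergySpace B Ω p V G)
    (hVE : energyE Ω p lam V = mPlus B Ω p q lam a) :
    energyE Ω p lam (fun x => mPlus B Ω p q lam a ^ (-(1 / (p - q))) * V x)
      = mPlus B Ω p q lam a ^ (-(q / (p - q))) := by
  rw [hV.energyE_const_mul D, hVE, abs_of_pos (by positivity), scaling_rpow_p D.lt hm]

lemma InEnergySpace.energyI_rescaled (D : Admissible Ω p q lam a M)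
    (hm : 0 < mPlus B Ω p q lam a) (hV : InEnergySpace B Ω p V G) (hV1 : weightInt Ω q a V = 1)
    (hVE : energyE Ω p lam V = mPlus B Ω p q lam a) :
    energyI Ω p q lam a (fun x => mPlus B Ω p q lam a ^ (-(1 / (p - q))) * V x)
      = mPlus B Ω p q lam a ^ (-(q / (p - q))) * (1 / p - 1 / q) := by
  rw [(hV.const_mul _).energyI_eq' D, weightInt_rescaled hm hV1, hV.energyE_rescaled D hm hVE]
  ring

/-- Minimality fixes two numbers in turn: the strict tangent inequality fixes `∫ a|W|^q`, and then
the value of `I` bounds the energy. The normalized `W` is thus a minimizer on the constraint set,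
where uniqueness is known. -/
lemma InEnergySpace.ae_eq_rescaled (D : Admissible Ω p q lam a M)
    (hm : 0 < mPlus B Ω p q lam a) (hV : InEnergySpace B Ω p V G) (hV0 : NonnegIn Ω V)
    (hV1 : weightInt Ω q a V = 1) (hVE : energyE Ω p lam V = mPlus B Ω p q lam a)
    (hW : InEnergySpace B Ω p W H) (hW0 : NonnegIn Ω W) (hA : 0 < weightInt Ω q a W)
    (hI : energyI Ω p q lam a W ≤ mPlus B Ω p q lam a ^ (-(q / (p - q))) * (1 / p - 1 / q)) :
    W =ᵐ[volume.restrict Ω] fun x => mPlus B Ω p q lam a ^ (-(1 / (p - q))) * V x := by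
  have hWA := hW.weightInt_eq_of_energyI_le D hm hA hI
  have hSpos : 0 < mPlus B Ω p q lam a ^ (-(q / (p - q))) := by positivity
  have hWE : energyE Ω p lam W ≤ mPlus B Ω p q lam a ^ (-(q / (p - q))) := by
    rw [hW.energyI_eq' D, hWA] at hI
    have h1 : energyE Ω p lam W / p ≤ mPlus B Ω p q lam a ^ (-(q / (p - q))) / p := by
      linear_combination hI
    exact (div_le_div_iff_of_pos_right D.p_pos).1 h1
  have hn := hW.energyE_normalize D hA
  have hn1 := weightInt_normalize D hA
  rw [hWA] at hn hn1
  have hle : energyE Ω p lam (fun x => (mPlus B Ω p q lam a ^ (-(q / (p - q)))) ^ (-(1 / q)) * W x)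
      ≤ mPlus B Ω p q lam a := by
    rw [hn, div_le_iff₀ (by positivity), scaling_optimal D.q_pos D.lt hm]
    exact hWE
  have h0 : NonnegIn Ω (fun x => (mPlus B Ω p q lam a ^ (-(q / (p - q)))) ^ (-(1 / q)) * W x) :=
    hW0.mono fun x hx => mul_nonneg (by positivity) hx
  have hcW := hW.const_mul ((mPlus B Ω p q lam a ^ (-(q / (p - q)))) ^ (-(1 / q)))
  have key := hcW.ae_eq_of_minimizers D hV h0 hV0 hn1 hV1
    hle hVE.le
  filter_upwards [key] with x hx
  rw [← hx, ← mul_assoc]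
  have e : mPlus B Ω p q lam a ^ (-(1 / (p - q)))
      * (mPlus B Ω p q lam a ^ (-(q / (p - q)))) ^ (-(1 / q)) = 1 := by
    rw [← scaling_rpow_q hm, ← Real.rpow_mul (by positivity), mul_neg,
      mul_one_div_cancel D.q_pos.ne', Real.rpow_neg_one, mul_inv_cancel₀ (by positivity)]
  rw [e, one_mul]

/-- The condition `∫ a|u|^q > 0` persists for `u + t φ` with small `t`, so `t = 0` is a free local
minimum and no multiplier appears. -/
lemma InEnergySpace.eulerLagrange (D : Admissible Ω p q lam a M)
    (hU : InEnergySpace B Ω p u g) (hU0 : NonnegIn Ω u) (hA : 0 < weightInt Ω q a u)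
    (hmin : ∀ w H, InEnergySpace B Ω p w H → 0 < weightInt Ω q a w →
      energyI Ω p q lam a u ≤ energyI Ω p q lam a w) (hφ : InEnergySpace B Ω p φ k) :
    ∫ x in Ω, ‖g x‖ ^ (p - 2) * inner ℝ (g x) (k x)
      = ∫ x in Ω, (lam * u x ^ (p - 1) + a x * u x ^ (q - 1)) * φ x := by
  have hp := D.one_lt_p
  have hp0 := D.p_pos
  have hq0 := D.q_pos
  have hexp : ENNReal.ofReal q ≤ ENNReal.ofReal p := ENNReal.ofReal_le_ofReal D.lt.le
  have h1 := hasDerivAt_integral_norm_rpow hp (b := fun _ => (1 : ℝ)) (M := 1)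
    aestronglyMeasurable_const (by simp) hU.memLp_grad hφ.memLp_grad
  have h2 := hasDerivAt_integral_norm_rpow hp (b := fun _ => (1 : ℝ)) (M := 1)
    aestronglyMeasurable_const (by simp) hU.memLp hφ.memLp
  have h3 := hasDerivAt_integral_norm_rpow D.one_lt D.aesm D.bound (hU.memLp.mono_exponent hexp)
    (hφ.memLp.mono_exponent hexp)
  have hI (t : ℝ) : energyI Ω p q lam a (fun x => u x + t * φ x)
      = ((∫ x in Ω, 1 * ‖g x + t • k x‖ ^ p) + -lam * ∫ x in Ω, 1 * ‖u x + t • φ x‖ ^ p) / p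
        - (∫ x in Ω, a x * ‖u x + t • φ x‖ ^ q) / q := by
    have h := hU.add hp.le (hφ.const_mul t)
    rw [h.energyI_eq' D, h.toHasSobolevGradient.energyE_eq hp.le D.isOpen]
    simp only [one_mul, weightInt, Real.norm_eq_abs, smul_eq_mul]
  have hloc : IsLocalMin (fun t : ℝ => energyI Ω p q lam a (fun x => u x + t * φ x)) 0 := by
    have hc := h3.continuousAt
    have hpos : 0 < ∫ x in Ω, a x * ‖u x + (0 : ℝ) • φ x‖ ^ q := by
      simpa [weightInt] using hA
    filter_upwards [hc.eventually (lt_mem_nhds hpos)] with t ht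
    have := hmin _ _ (hU.add hp.le (hφ.const_mul t)) (by simpa [weightInt] using ht)
    simpa using this
  have hder := (((h1.add (h2.const_mul (-lam))).div_const p).sub (h3.div_const q))
  have hder' : HasDerivAt (fun t : ℝ => energyI Ω p q lam a (fun x => u x + t * φ x)) _ 0 :=
    hder.congr_of_eventuallyEq (Eventually.of_forall hI)
  have h0 := hloc.hasDerivAt_eq_zero hder'
  have i1 : Integrable (fun x => u x ^ (p - 1) * φ x) (volume.restrict Ω) := by
    refine (integrable_rpow_inner hp hU.memLp hφ.memLp).congr ?_
    filter_upwards [hU0] with x hx using rpow_sub_two_mul_inner_of_nonneg hp hx _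
  have i2 : Integrable (fun x => u x ^ (q - 1) * φ x) (volume.restrict Ω) := by
    refine (integrable_rpow_inner D.one_lt (hU.memLp.mono_exponent hexp)
      (hφ.memLp.mono_exponent hexp)).congr ?_
    filter_upwards [hU0] with x hx using rpow_sub_two_mul_inner_of_nonneg D.one_lt hx _
  have i3 : Integrable (fun x => a x * (u x ^ (q - 1) * φ x)) (volume.restrict Ω) :=
    i2.bdd_mul D.aesm D.bound
  have e1 : ∫ x in Ω, 1 * (p * ‖g x‖ ^ (p - 2) * inner ℝ (g x) (k x))
      = p * ∫ x in Ω, ‖g x‖ ^ (p - 2) * inner ℝ (g x) (k x) := by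
    rw [← integral_const_mul]
    congr 1; ext x; ring
  have e2 : ∫ x in Ω, 1 * (p * ‖u x‖ ^ (p - 2) * inner ℝ (u x) (φ x))
      = p * ∫ x in Ω, u x ^ (p - 1) * φ x := by
    rw [← integral_const_mul]
    refine integral_congr_ae ?_
    filter_upwards [hU0] with x hx
    rw [← rpow_sub_two_mul_inner_of_nonneg hp hx]; ring
  have e3 : ∫ x in Ω, a x * (q * ‖u x‖ ^ (q - 2) * inner ℝ (u x) (φ x))
      = q * ∫ x in Ω, a x * (u x ^ (q - 1) * φ x) := by
    rw [← integral_const_mul]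
    refine integral_congr_ae ?_
    filter_upwards [hU0] with x hx
    rw [← rpow_sub_two_mul_inner_of_nonneg D.one_lt hx]; ring
  have e4 : ∫ x in Ω, (lam * u x ^ (p - 1) + a x * u x ^ (q - 1)) * φ x
      = lam * (∫ x in Ω, u x ^ (p - 1) * φ x) + ∫ x in Ω, a x * (u x ^ (q - 1) * φ x) := by
    rw [← integral_const_mul, ← integral_add (i1.const_mul lam) i3]
    congr 1; ext x; ring
  rw [e1, e2, e3] at h0
  rw [e4]
  have hcan : ∀ A B C : ℝ, (p * A + -(lam * (p * B))) / p - q * C / q = A - (lam * B + C) := by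
    intro A B C; field_simp; ring
  rw [← neg_mul_eq_neg_mul, hcan] at h0
  linarith

lemma InEnergySpace.isSolution_iff (D : Admissible Ω p q lam a M) (hu : InEnergySpace B Ω p u g) :
    IsSolution B Ω p q lam a u ↔ NonnegIn Ω u ∧ ∀ φ k, InEnergySpace B Ω p φ k →
      ∫ x in Ω, ‖g x‖ ^ (p - 2) * inner ℝ (g x) (k x)
        = ∫ x in Ω, (lam * u x ^ (p - 1) + a x * u x ^ (q - 1)) * φ x := by
  have hp := D.one_lt_p.le
  have key (φ : Eucl N → ℝ) (k : Eucl N → Eucl N) (hφ : InEnergySpace B Ω p φ k) :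
      ∫ x in Ω, ‖weakGrad Ω u x‖ ^ (p - 2) * inner ℝ (weakGrad Ω u x) (weakGrad Ω φ x)
        = ∫ x in Ω, ‖g x‖ ^ (p - 2) * inner ℝ (g x) (k x) := by
    refine integral_congr_ae ?_
    filter_upwards [hu.weakGrad_ae_eq hp D.isOpen, hφ.weakGrad_ae_eq hp D.isOpen] with x h1 h2
    rw [h1, h2]
  constructor
  · rintro ⟨-, h0, h⟩
    refine ⟨h0, fun φ k hφ => ?_⟩
    rw [← key φ k hφ]
    exact h φ (hφ.mem_energySpace hp D.isOpen)
  · rintro ⟨h0, h⟩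
    refine ⟨hu.mem_energySpace hp D.isOpen, h0, fun φ hφ => ?_⟩
    have hφ' := inEnergySpace_weakGrad hp D.isOpen hφ
    rw [key φ _ hφ']
    exact h φ _ hφ'

end Minimizer

/-! ### Integration by parts against `C¹` fields -/

section IntegrationByParts

variable {N : ℕ} {Ω : Set (Eucl N)} {p : ℝ} {u : Eucl N → ℝ} {g : Eucl N → Eucl N}
  [IsFiniteMeasure (volume.restrict Ω)]

/-- The integration by parts formula extends from smooth to `C¹` test functions. -/
lemma HasSobolevGradient.integral_smul_gradient (hp : 1 ≤ p) (hΩ : IsOpen Ω)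
    (h : HasSobolevGradient Ω p u g) {φ : Eucl N → ℝ} (hφ : ContDiff ℝ 1 φ)
    (hc : HasCompactSupport φ) (hs : tsupport φ ⊆ Ω) :
    ∫ x in Ω, u x • gradient φ x = - ∫ x in Ω, φ x • g x := by
  obtain ⟨χ, hχ, hχ1⟩ := exists_cutoff hΩ hc hs
  have hw := h.cutoff_mul hp hΩ BoundaryCondition.dirichlet hχ
  obtain ⟨ψ, hψ, hψ1, hψ2⟩ := hw.approx rfl
  obtain ⟨C, -, hC1, hC2⟩ := exists_bound_of_contDiff hφ hc
  have hψe (n : ℕ) := inEnergySpace_of_contDiff hp hΩ BoundaryCondition.dirichlet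
    (hψ n).contDiff_one (hψ n).2.1 (hψ n).2.2
  have l1 : Tendsto (fun n => ∫ x in Ω, ψ n x • gradient φ x) atTop
      (𝓝 (∫ x in Ω, (χ x * u x) • gradient φ x)) := by
    refine tendsto_integral_of_norm_sub_le (C := C) hp
      (fun n => integrable_smul_gradient hp hφ hc (hψe n).memLp)
      (integrable_smul_gradient hp hφ hc hw.memLp)
      (fun n => ((hψe n).memLp.sub hw.memLp).aestronglyMeasurable)
      (fun n => Eventually.of_forall fun x => ?_) hψ1
    rw [← sub_smul, norm_smul, mul_comm]
    exact mul_le_mul_of_nonneg_right (hC2 x) (norm_nonneg _)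
  have l2 : Tendsto (fun n => ∫ x in Ω, φ x • gradient (ψ n) x) atTop
      (𝓝 (∫ x in Ω, φ x • (χ x • g x + u x • gradient χ x))) := by
    refine tendsto_integral_of_norm_sub_le (C := C) hp
      (fun n => integrable_test_smul hp hφ hc (hψe n).memLp_grad)
      (integrable_test_smul hp hφ hc hw.memLp_grad)
      (fun n => ((hψe n).memLp_grad.sub hw.memLp_grad).aestronglyMeasurable)
      (fun n => Eventually.of_forall fun x => ?_) hψ2
    rw [← smul_sub, norm_smul]
    exact mul_le_mul_of_nonneg_right (hC1 x) (norm_nonneg _)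
  -- The roles are exchanged: the `C¹` function `φ` has its classical gradient as weak gradient, and
  -- the smooth `ψ n` acts as the test function.
  have e (n : ℕ) : ∫ x in Ω, φ x • gradient (ψ n) x = - ∫ x in Ω, ψ n x • gradient φ x :=
    isWeakGradient_gradient hφ hs (ψ n) (hψ n)
  simp_rw [e] at l2
  have key := tendsto_nhds_unique l2 l1.neg
  have e1 (x : Eucl N) : (χ x * u x) • gradient φ x = u x • gradient φ x := by
    by_cases hx : x ∈ tsupport φ
    · rw [(hχ1 x hx).1, one_mul]
    · rw [Function.notMem_support.1 fun h' => hx (support_gradient_subset φ h'), smul_zero,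
        smul_zero]
  have e2 (x : Eucl N) : φ x • (χ x • g x + u x • gradient χ x) = φ x • g x := by
    by_cases hx : x ∈ tsupport φ
    · rw [(hχ1 x hx).1, (hχ1 x hx).2, one_smul, smul_zero, add_zero]
    · rw [image_eq_zero_of_notMem_tsupport hx, zero_smul, zero_smul]
  simp_rw [e1, e2] at key
  rw [key, neg_neg]

/-- The divergence theorem for a field `ζ(x) (x - x₀)`. -/
lemma HasSobolevGradient.integral_mul_inner_sub (hp : 1 ≤ p) (hΩ : IsOpen Ω)
    (h : HasSobolevGradient Ω p u g) {ζ : Eucl N → ℝ} (hζ : ContDiff ℝ 1 ζ)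
    (hc : HasCompactSupport ζ) (hs : tsupport ζ ⊆ Ω) (x₀ : Eucl N) :
    ∫ x in Ω, ζ x * inner ℝ (x - x₀) (g x)
      = - ∫ x in Ω, u x * (N * ζ x + inner ℝ (gradient ζ x) (x - x₀)) := by
  set e := EuclideanSpace.basisFun (Fin N) ℝ
  have hl (i : Fin N) : ContDiff ℝ 1 (fun x : Eucl N => inner ℝ (x - x₀) (e i)) :=
    (contDiff_id.sub contDiff_const).inner ℝ contDiff_const
  have hlg (i : Fin N) (x : Eucl N) :
      gradient (fun x : Eucl N => inner ℝ (x - x₀) (e i)) x = e i := by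
    refine ext_inner_right ℝ fun w => ?_
    rw [inner_gradient_eq]
    have h1 : HasFDerivAt (fun x : Eucl N => inner ℝ (e i) (x - x₀)) (innerSL ℝ (e i)) x :=
      (innerSL ℝ (e i)).hasFDerivAt.comp x ((hasFDerivAt_id x).sub_const x₀)
    simp_rw [real_inner_comm _ (e i)] at h1
    rw [h1.fderiv]
    rfl
  have hφ (i : Fin N) : ContDiff ℝ 1 (fun x : Eucl N => ζ x * inner ℝ (x - x₀) (e i)) :=
    hζ.mul (hl i)
  have hφc (i : Fin N) : HasCompactSupport (fun x : Eucl N => ζ x * inner ℝ (x - x₀) (e i)) :=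
    hc.mul_right
  have hφg (i : Fin N) (x : Eucl N) :
      gradient (fun x : Eucl N => ζ x * inner ℝ (x - x₀) (e i)) x
        = ζ x • e i + inner ℝ (x - x₀) (e i) • gradient ζ x := by
    rw [gradient_mul' hζ (hl i), hlg]
  have j1 (i : Fin N) : Integrable
      (fun x => inner ℝ (u x • (ζ x • e i + inner ℝ (x - x₀) (e i) • gradient ζ x)) (e i))
      (volume.restrict Ω) := by
    have := (integrable_smul_gradient hp (hφ i) (hφc i) h.memLp).inner_const (𝕜 := ℝ) (e i)
    simpa only [hφg] using this
  have j2 (i : Fin N) : Integrable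
      (fun x => inner ℝ ((ζ x * inner ℝ (x - x₀) (e i)) • g x) (e i)) (volume.restrict Ω) :=
    (integrable_test_smul hp (hφ i) (hφc i) h.memLp_grad).inner_const (𝕜 := ℝ) (e i)
  have key (i : Fin N) :
      ∫ x in Ω, inner ℝ (u x • (ζ x • e i + inner ℝ (x - x₀) (e i) • gradient ζ x)) (e i)
        = - ∫ x in Ω, inner ℝ ((ζ x * inner ℝ (x - x₀) (e i)) • g x) (e i) := by
    have h1 := h.integral_smul_gradient hp hΩ (hφ i) (hφc i)
      ((tsupport_mul_subset_left).trans hs)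
    have h2 := congrArg (fun z => inner ℝ (e i) z) h1
    simp only [inner_neg_right] at h2
    rw [← integral_inner (integrable_smul_gradient hp (hφ i) (hφc i) h.memLp),
      ← integral_inner (integrable_test_smul hp (hφ i) (hφc i) h.memLp_grad)] at h2
    simp only [hφg] at h2
    simpa only [real_inner_comm (e i)] using h2
  -- Summing the `i`-th components assembles the divergence of `ζ (x - x₀)`, namely `N ζ + ∇ζ · (x -
  -- x₀)`.
  have hsum := Finset.sum_congr (s₁ := Finset.univ) rfl fun i _ => key i
  rw [Finset.sum_neg_distrib, ← integral_finsetSum _ fun i _ => j1 i,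
    ← integral_finsetSum _ fun i _ => j2 i] at hsum
  have e1 (x : Eucl N) : ∑ i, inner ℝ ((ζ x * inner ℝ (x - x₀) (e i)) • g x) (e i)
      = ζ x * inner ℝ (x - x₀) (g x) := by
    rw [← e.sum_inner_mul_inner (x - x₀) (g x), Finset.mul_sum]
    refine Finset.sum_congr rfl fun i _ => ?_
    rw [real_inner_smul_left, real_inner_comm (g x), mul_assoc]
  have e2 (x : Eucl N) :
      ∑ i, inner ℝ (u x • (ζ x • e i + inner ℝ (x - x₀) (e i) • gradient ζ x)) (e i)
      = u x * (N * ζ x + inner ℝ (gradient ζ x) (x - x₀)) := by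
    rw [real_inner_comm, ← e.sum_inner_mul_inner (x - x₀) (gradient ζ x)]
    have h3 (i : Fin N) :
        inner ℝ (u x • (ζ x • e i + inner ℝ (x - x₀) (e i) • gradient ζ x)) (e i)
        = u x * ζ x + u x * (inner ℝ (x - x₀) (e i) * inner ℝ (e i) (gradient ζ x)) := by
      rw [real_inner_smul_left, inner_add_left, real_inner_smul_left, real_inner_smul_left,
        real_inner_self_eq_norm_sq, e.norm_eq_one, real_inner_comm (e i) (gradient ζ x)]
      ring
    simp_rw [h3]
    rw [Finset.sum_add_distrib, mul_add, Finset.mul_sum, Finset.sum_const, Finset.card_univ,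
      Fintype.card_fin, nsmul_eq_mul]
    ring
  simp_rw [e1, e2] at hsum
  linarith

end IntegrationByParts

/-! ### The radial barrier -/

section Barrier

lemma hasDerivAt_max_rpow {b : ℝ} (hb : 1 < b) (t : ℝ) :
    HasDerivAt (fun t : ℝ => (max t 0) ^ b) (b * (max t 0) ^ (b - 1)) t := by
  have hc1 : Continuous fun t : ℝ => (max t 0) ^ b :=
    (continuous_id.max continuous_const).rpow_const fun _ => Or.inr (by linarith)
  have hc2 : Continuous fun t : ℝ => b * (max t 0) ^ (b - 1) :=
    continuous_const.mul
      ((continuous_id.max continuous_const).rpow_const fun _ => Or.inr (by linarith))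
  have hne : ∀ t : ℝ, t ≠ 0 →
      HasDerivAt (fun t : ℝ => (max t 0) ^ b) (b * (max t 0) ^ (b - 1)) t := by
    intro t ht
    rcases lt_or_gt_of_ne ht with h | h
    · rw [max_eq_right h.le, Real.zero_rpow (by linarith), mul_zero]
      refine (hasDerivAt_const t (0 : ℝ)).congr_of_eventuallyEq ?_
      filter_upwards [gt_mem_nhds h] with s hs
      rw [max_eq_right (le_of_lt hs), Real.zero_rpow (by linarith)]
    · rw [max_eq_left h.le]
      refine (Real.hasDerivAt_rpow_const (Or.inl h.ne')).congr_of_eventuallyEq ?_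
      filter_upwards [lt_mem_nhds h] with s hs
      rw [max_eq_left (le_of_lt hs)]
  rcases eq_or_ne t 0 with rfl | ht
  -- At 0 the derivative is the limit of the derivatives at nearby points.
  · exact hasDerivAt_of_hasDerivAt_of_ne' (fun y hy => hne y hy) hc1.continuousAt hc2.continuousAt 0
  · exact hne t ht

lemma contDiff_max_rpow {b : ℝ} (hb : 1 < b) : ContDiff ℝ 1 (fun t : ℝ => (max t 0) ^ b) := by
  rw [contDiff_one_iff_deriv]
  refine ⟨fun t => (hasDerivAt_max_rpow hb t).differentiableAt, ?_⟩
  rw [show deriv (fun t : ℝ => (max t 0) ^ b) = fun t => b * (max t 0) ^ (b - 1) from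
    funext fun t => (hasDerivAt_max_rpow hb t).deriv]
  exact continuous_const.mul
    ((continuous_id.max continuous_const).rpow_const fun _ => Or.inr (by linarith))

variable {N : ℕ}

/-- The radial profile `(R ^ s - |x - x₀| ^ s)₊`. -/
def radialProfile (x₀ : Eucl N) (R s : ℝ) (x : Eucl N) : ℝ := max (R ^ s - ‖x - x₀‖ ^ s) 0

variable {x₀ : Eucl N} {R s b : ℝ}

lemma radialProfile_nonneg (x : Eucl N) : 0 ≤ radialProfile x₀ R s x := le_max_right _ _

lemma radialProfile_le_one (hR : 0 ≤ R) (hR1 : R ≤ 1) (hs : 0 ≤ s) (x : Eucl N) :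
    radialProfile x₀ R s x ≤ 1 := by
  refine max_le ?_ zero_le_one
  have h1 : R ^ s ≤ 1 := Real.rpow_le_one hR hR1 hs
  have h2 : 0 ≤ ‖x - x₀‖ ^ s := by positivity
  linarith

lemma radialProfile_self (hR : 0 < R) (hs : 0 < s) : 0 < radialProfile x₀ R s x₀ := by
  simp [radialProfile, Real.zero_rpow hs.ne']
  positivity

lemma mem_ball_of_radialProfile_ne_zero (hR : 0 ≤ R) (hs : 0 < s) {x : Eucl N}
    (h : radialProfile x₀ R s x ≠ 0) : x ∈ Metric.ball x₀ R := by
  by_contra hx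
  rw [mem_ball_iff_norm, not_lt] at hx
  refine h (max_eq_right ?_)
  have := Real.rpow_le_rpow hR hx hs.le
  linarith

lemma contDiff_radialProfile_rpow (hs : 1 < s) (hb : 1 < b) :
    ContDiff ℝ 1 (fun x => radialProfile x₀ R s x ^ b) := by
  have h1 : ContDiff ℝ 1 (fun x : Eucl N => R ^ s - ‖x - x₀‖ ^ s) :=
    contDiff_const.sub ((contDiff_norm_rpow hs).comp (contDiff_id.sub contDiff_const))
  exact (contDiff_max_rpow hb).comp h1

lemma gradient_radialProfile_rpow (hs : 1 < s) (hb : 1 < b) (x : Eucl N) :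
    gradient (fun x => radialProfile x₀ R s x ^ b) x
      = (-(b * radialProfile x₀ R s x ^ (b - 1) * (s * ‖x - x₀‖ ^ (s - 2)))) • (x - x₀) := by
  have h0 : HasFDerivAt (fun x : Eucl N => x - x₀) (ContinuousLinearMap.id ℝ (Eucl N)) x :=
    (hasFDerivAt_id x).sub_const x₀
  have h1 : HasFDerivAt (fun x : Eucl N => R ^ s - ‖x - x₀‖ ^ s) _ x :=
    ((hasFDerivAt_norm_rpow (x - x₀) hs).comp x h0).const_sub (R ^ s)
  have h2 := (hasDerivAt_max_rpow hb (R ^ s - ‖x - x₀‖ ^ s)).comp_hasFDerivAt x h1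
  have e : (fun x : Eucl N => radialProfile x₀ R s x ^ b)
      = (fun t : ℝ => (max t 0) ^ b) ∘ fun x => R ^ s - ‖x - x₀‖ ^ s := rfl
  rw [e]
  refine ext_inner_right ℝ fun w => ?_
  rw [inner_gradient_eq, h2.fderiv, real_inner_smul_left]
  simp [radialProfile, inner_sub_left]
  ring

lemma support_radialProfile_rpow (hR : 0 ≤ R) (hs : 0 < s) (hb : b ≠ 0) :
    Function.support (fun x => radialProfile x₀ R s x ^ b) ⊆ Metric.ball x₀ R := by
  intro x hx
  refine mem_ball_of_radialProfile_ne_zero hR hs fun h => hx ?_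
  simp only [h, Real.zero_rpow hb]

lemma tsupport_radialProfile_rpow (hR : 0 ≤ R) (hs : 0 < s) (hb : b ≠ 0) :
    tsupport (fun x => radialProfile x₀ R s x ^ b) ⊆ Metric.closedBall x₀ R :=
  closure_minimal ((support_radialProfile_rpow hR hs hb).trans Metric.ball_subset_closedBall)
    Metric.isClosed_closedBall

lemma hasCompactSupport_radialProfile_rpow (hR : 0 ≤ R) (hs : 0 < s) (hb : b ≠ 0) :
    HasCompactSupport (fun x => radialProfile x₀ R s x ^ b) :=
  HasCompactSupport.of_support_subset_isCompact (isCompact_closedBall x₀ R)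
    ((support_radialProfile_rpow hR hs hb).trans Metric.ball_subset_closedBall)

/-- For the conjugate exponent `s` of `p` the `p`-flux of the barrier is regular. -/
lemma flux_radialProfile_rpow {p : ℝ} (hp : 1 < p) (hb : 1 < b) (x : Eucl N) :
    ‖gradient (fun x => radialProfile x₀ R (p / (p - 1)) x ^ b) x‖ ^ (p - 2) •
        gradient (fun x => radialProfile x₀ R (p / (p - 1)) x ^ b) x
      = (-((b * (p / (p - 1))) ^ (p - 1) * radialProfile x₀ R (p / (p - 1)) x ^ ((b - 1) * (p - 1))))
        • (x - x₀) := by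
  have hp1 : 0 < p - 1 := by linarith
  have hs : 1 < p / (p - 1) := by rw [one_lt_div hp1]; linarith
  set s := p / (p - 1) with hs'
  rw [gradient_radialProfile_rpow hs hb]
  set η := radialProfile x₀ R s x
  have hη : 0 ≤ η := radialProfile_nonneg x
  rcases hη.eq_or_lt with h0 | h0
  · rw [← h0, Real.zero_rpow (by linarith), Real.zero_rpow (by nlinarith)]
    simp
  rcases eq_or_ne (x - x₀) 0 with hy | hy
  · simp [hy]
  have hy0 : 0 < ‖x - x₀‖ := norm_pos_iff.2 hy
  set r := ‖x - x₀‖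
  rw [smul_smul]
  congr 1
  rw [norm_smul, norm_neg, Real.norm_of_nonneg (by positivity)]
  have e1 : b * η ^ (b - 1) * (s * r ^ (s - 2)) * r = (b * s) * η ^ (b - 1) * r ^ (s - 1) := by
    rw [show s - 1 = s - 2 + 1 by ring, Real.rpow_add_one hy0.ne']; ring
  rw [show ‖x - x₀‖ = r from rfl, e1, Real.mul_rpow (by positivity) (by positivity),
    Real.mul_rpow (by positivity) (by positivity), ← Real.rpow_mul h0.le, ← Real.rpow_mul hy0.le]
  have hbs : 0 < b * s := by positivity
  have e2 : (b * s) ^ (p - 1) = (b * s) ^ (p - 2) * (b * s) := by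
    rw [← Real.rpow_add_one hbs.ne']; ring_nf
  have e3 : η ^ ((b - 1) * (p - 1)) = η ^ ((b - 1) * (p - 2)) * η ^ (b - 1) := by
    rw [← Real.rpow_add h0]; ring_nf
  -- The exponent equals `(s - 1)(p - 1) - 1`, which is 0 for conjugate exponents. All powers of `|x
  -- - x₀|` cancel, and the flux is a power of the profile times `x - x₀`.
  have e4 : r ^ ((s - 1) * (p - 2)) * r ^ (s - 2) = 1 := by
    rw [← Real.rpow_add hy0]
    have : (s - 1) * (p - 2) + (s - 2) = 0 := by
      rw [hs']; field_simp; ring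
    rw [this, Real.rpow_zero]
  rw [e2, e3]
  linear_combination (-((b * s) ^ (p - 2) * (b * s) * η ^ ((b - 1) * (p - 2)) * η ^ (b - 1))) * e4

lemma inner_gradient_radialProfile_rpow_nonpos (hs : 1 < s) (hb : 1 < b) (x : Eucl N) :
    inner ℝ (gradient (fun x => radialProfile x₀ R s x ^ b) x) (x - x₀) ≤ 0 := by
  rw [gradient_radialProfile_rpow hs hb, real_inner_smul_left, real_inner_self_eq_norm_sq]
  have := radialProfile_nonneg (x₀ := x₀) (R := R) (s := s) x
  have h2 : 0 ≤ b * radialProfile x₀ R s x ^ (b - 1) * (s * ‖x - x₀‖ ^ (s - 2)) := by positivity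
  nlinarith [sq_nonneg ‖x - x₀‖]

end Barrier

/-! ### Positivity on `{a > 0}` by comparison with the barrier -/

section Comparison

variable {N : ℕ} {Ω : Set (Eucl N)} {p q lam M : ℝ} {a u v : Eucl N → ℝ}
  {g k : Eucl N → Eucl N} {B : BoundaryCondition}

lemma rpow_sub_rpow_le {r : ℝ} (hr : 1 < r) {s t : ℝ} (hs : 0 ≤ s) (ht : 0 ≤ t) :
    s ^ r - t ^ r ≤ r * (s ^ (r - 1) * (s - t)) := by
  have h := norm_rpow_convex_ineq hr s t
  rw [rpow_sub_two_mul_inner_of_nonneg hr hs, Real.norm_of_nonneg hs, Real.norm_of_nonneg ht] at h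
  linear_combination h

/-- Convexity bounds this difference only from above, so a cruder lower bound is used. It lacks the
factor `r`, whence the constant `a₀ / q` in the comparison. -/
lemma le_rpow_sub_rpow {r : ℝ} (hr : 1 < r) {s t : ℝ} (ht : 0 ≤ t) (hts : t ≤ s) :
    s ^ (r - 1) * (s - t) ≤ s ^ r - t ^ r := by
  have e (x : ℝ) (hx : 0 ≤ x) : x ^ r = x ^ (r - 1) * x := by
    rcases hx.eq_or_lt with h | h
    · rw [← h, Real.zero_rpow (by linarith), mul_zero]
    · rw [← Real.rpow_add_one h.ne', sub_add_cancel]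
  have h1 : t ^ (r - 1) * t ≤ s ^ (r - 1) * t :=
    mul_le_mul_of_nonneg_right (Real.rpow_le_rpow ht hts (by linarith)) ht
  rw [e s (ht.trans hts), e t ht]
  linear_combination h1

lemma isOpen_posSet (hΩ : IsOpen Ω) (hac : ContinuousOn a Ω) : IsOpen (posSet Ω a) :=
  hac.isOpen_inter_preimage hΩ isOpen_Ioi

/-- No continuity of `u` is needed: a continuous minorant positive at `x₀` keeps `u` positive a.e.
near `x₀`, and a locally null set is null. -/
lemma ae_pos_of_continuous_lower_bounds (hΩ : IsOpen Ω) (hac : ContinuousOn a Ω)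
    (h : ∀ x₀ ∈ posSet Ω a, ∃ v : Eucl N → ℝ, Continuous v ∧ 0 < v x₀ ∧
      ∀ᵐ x ∂(volume.restrict Ω), v x ≤ u x) :
    ∀ᵐ x ∂(volume.restrict (posSet Ω a)), 0 < u x := by
  rw [ae_restrict_iff' (isOpen_posSet hΩ hac).measurableSet]
  have key : volume {x | x ∈ posSet Ω a ∧ ¬ 0 < u x} = 0 := by
    refine measure_null_of_locally_null _ fun x hx => ?_
    obtain ⟨v, hv, hvx, hvu⟩ := h x hx.1
    rw [ae_restrict_iff' hΩ.measurableSet] at hvu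
    refine ⟨{x | x ∈ posSet Ω a ∧ ¬ 0 < u x} ∩ {x | 0 < v x}, inter_mem_nhdsWithin _
      ((isOpen_lt continuous_const hv).mem_nhds hvx), measure_mono_null ?_ (ae_iff.1 hvu)⟩
    rintro y ⟨⟨hy1, hy2⟩, hy3⟩ hy4
    exact hy2 (lt_of_lt_of_le hy3 (hy4 hy1.1))
  rw [ae_iff]
  refine measure_mono_null (fun x hx => ?_) key
  simpa using hx

lemma pos_of_continuous_lower_bounds (hΩ : IsOpen Ω) (hac : ContinuousOn a Ω)
    (h : ∀ x₀ ∈ posSet Ω a, ∃ v : Eucl N → ℝ, Continuous v ∧ 0 < v x₀ ∧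
      ∀ᵐ x ∂(volume.restrict Ω), v x ≤ u x) {w : Eucl N → ℝ} (hw : ContinuousOn w (posSet Ω a))
    (hwu : w =ᵐ[volume.restrict (posSet Ω a)] u) {x₀ : Eucl N} (hx₀ : x₀ ∈ posSet Ω a) :
    0 < w x₀ := by
  obtain ⟨v, hv, hvx, hvu⟩ := h x₀ hx₀
  by_contra hneg
  have ho := isOpen_posSet hΩ hac
  have hopen : IsOpen (posSet Ω a ∩ (fun x => w x - v x) ⁻¹' Iio 0) :=
    (hw.sub hv.continuousOn).isOpen_inter_preimage ho isOpen_Iio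
  have hpos := hopen.measure_pos volume ⟨x₀, hx₀, by
    simp only [mem_preimage, mem_Iio]; linarith⟩
  refine hpos.ne' ?_
  have hvu' : ∀ᵐ x ∂(volume.restrict (posSet Ω a)), v x ≤ u x :=
    ae_mono (Measure.restrict_mono_set _ fun x hx => hx.1) hvu
  have hle : ∀ᵐ x ∂(volume.restrict (posSet Ω a)), v x ≤ w x := by
    filter_upwards [hvu', hwu] with x h1 h2
    rwa [h2]
  rw [ae_restrict_iff' ho.measurableSet] at hle
  refine measure_mono_null ?_ (ae_iff.1 hle)
  rintro y ⟨hy1, hy2⟩ hy4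
  have := hy4 hy1
  simp only [mem_preimage, mem_Iio] at hy2
  linarith

variable [IsFiniteMeasure (volume.restrict Ω)]

lemma InEnergySpace.energyI_eq_integral (D : Admissible Ω p q lam a M)
    (h : InEnergySpace B Ω p u g) :
    energyI Ω p q lam a u = ∫ x in Ω, (1 / p * ‖g x‖ ^ p - lam / p * |u x| ^ p
      - 1 / q * (a x * |u x| ^ q)) :=
  integral_congr_weakGrad
    (r := fun x w => 1 / p * ‖w‖ ^ p - lam / p * |u x| ^ p - 1 / q * (a x * |u x| ^ q))
    (h.weakGrad_ae_eq D.one_lt_p.le D.isOpen)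

lemma InEnergySpace.integrable_energyI (D : Admissible Ω p q lam a M)
    (h : InEnergySpace B Ω p u g) :
    Integrable (fun x => 1 / p * ‖g x‖ ^ p - lam / p * |u x| ^ p
      - 1 / q * (a x * |u x| ^ q)) (volume.restrict Ω) :=
  (((integrable_norm_rpow_real D.p_pos h.memLp_grad).const_mul _).sub
    ((integrable_abs_rpow D.p_pos le_rfl h.memLp).const_mul _)).sub
    ((integrable_weight D.q_pos D.lt.le D.aesm D.bound h.memLp).const_mul _)

/-- First order information from comparing a minimizer `u` with `max u v`, when `v` lives where
the weight is at least `a₀`. -/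
lemma InEnergySpace.comparison (D : Admissible Ω p q lam a M) {a₀ : ℝ} (ha₀ : 0 < a₀)
    (hu : InEnergySpace B Ω p u g) (hu0 : NonnegIn Ω u) (hA : 0 < weightInt Ω q a u)
    (hmin : ∀ w H, InEnergySpace B Ω p w H → 0 < weightInt Ω q a w →
      energyI Ω p q lam a u ≤ energyI Ω p q lam a w)
    (hv : InEnergySpace B Ω p v k) (hv0 : ∀ x, 0 ≤ v x) (hva : ∀ x, 0 < v x → a₀ ≤ a x) :
    0 ≤ ∫ x in Ω, (‖k x‖ ^ (p - 2) * inner ℝ (k x) (if 0 < v x - u x then k x - g x else 0)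
      + (-lam * v x ^ (p - 1) - a₀ / q * v x ^ (q - 1)) * max (v x - u x) 0) := by
  have hp := D.one_lt_p
  have hp0 := D.p_pos
  have hq := D.one_lt
  have hq0 := D.q_pos
  have hexp : ENNReal.ofReal q ≤ ENNReal.ofReal p := ENNReal.ofReal_le_ofReal D.lt.le
  have hh := (hv.sub hp.le hu).posPart hp.le D.isOpen
  have hM := hu.add hp.le hh
  -- The competitor is `max u v`; it differs from `u` only where `v > u ≥ 0`, and there `a ≥ a₀ >
  -- 0`, so the constraint integral does not decrease.
  have hApos : 0 < weightInt Ω q a (fun x => u x + max (v x - u x) 0) := by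
    refine hA.trans_le (integral_mono_ae (integrable_weight hq0 D.lt.le D.aesm D.bound hu.memLp)
      (integrable_weight hq0 D.lt.le D.aesm D.bound hM.memLp) ?_)
    filter_upwards [hu0] with x hx
    rcases le_or_gt (v x - u x) 0 with h | h
    · simp only [max_eq_right h, add_zero, le_refl]
    · have h1 : 0 < a x := ha₀.trans_le (hva x (by linarith))
      simp only [max_eq_left h.le]
      rw [add_sub_cancel, abs_of_nonneg hx, abs_of_nonneg (hv0 x)]
      have h2 : u x ≤ v x := by linarith
      gcongr
  have hle := hmin _ _ hM hApos
  rw [hu.energyI_eq_integral D, hM.energyI_eq_integral D] at hle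
  have iu := hu.integrable_energyI D
  have iM := hM.integrable_energyI D
  have h0 := sub_nonneg.2 hle
  rw [← integral_sub iM iu] at h0
  refine h0.trans (integral_mono_ae (iM.sub iu) ?_ ?_)
  · have i1 := integrable_rpow_inner hp hv.memLp_grad hh.memLp_grad
    have i2 := (integrable_rpow_mul_norm hp hv.memLp hh.memLp).const_mul (-lam)
    have i3 := (integrable_rpow_mul_norm hq (hv.memLp.mono_exponent hexp)
      (hh.memLp.mono_exponent hexp)).const_mul (a₀ / q)
    refine (i1.add (i2.sub i3)).congr (Eventually.of_forall fun x => ?_)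
    simp only [Pi.add_apply, Pi.sub_apply]
    rw [Real.norm_of_nonneg (hv0 x), Real.norm_of_nonneg (le_max_right _ _)]
    ring
  · filter_upwards [hu0] with x hx
    have hlam := D.lam_neg
    rcases le_or_gt (v x - u x) 0 with h | h
    · simp [max_eq_right h, not_lt.2 h]
    · have hvp : 0 ≤ v x := hv0 x
      simp only [max_eq_left h.le, if_pos h]
      rw [add_sub_cancel, add_sub_cancel, abs_of_nonneg hx, abs_of_nonneg hvp]
      have e1 := norm_rpow_convex_ineq hp (k x) (g x)
      rw [← neg_sub (k x) (g x), inner_neg_right] at e1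
      have e2 := rpow_sub_rpow_le hp hvp hx
      have e3 := le_rpow_sub_rpow hq hx (by linarith : u x ≤ v x)
      have e4 := hva x (by linarith)
      have e5 : 0 ≤ v x ^ (q - 1) * (v x - u x) := by positivity
      have f1 : 1 / p * (‖k x‖ ^ p - ‖g x‖ ^ p)
          ≤ ‖k x‖ ^ (p - 2) * inner ℝ (k x) (k x - g x) := by
        rw [one_div_mul_eq_div, div_le_iff₀ hp0]
        linear_combination e1
      have f2 : -lam / p * (v x ^ p - u x ^ p) ≤ -lam * (v x ^ (p - 1) * (v x - u x)) := by
        have := mul_le_mul_of_nonneg_left e2 (div_nonneg (by linarith : 0 ≤ -lam) hp0.le)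
        refine this.trans_eq ?_
        field_simp
      have f3 : a₀ / q * (v x ^ (q - 1) * (v x - u x)) ≤ 1 / q * (a x * (v x ^ q - u x ^ q)) := by
        rw [div_mul_eq_mul_div, one_div_mul_eq_div]
        refine div_le_div_of_nonneg_right ?_ hq0.le
        exact mul_le_mul e4 e3 e5 (ha₀.le.trans e4)
      linear_combination f1 + f2 + f3

lemma integrable_mul_of_hasCompactSupport (hp : 1 ≤ p) {F : Eucl N → ℝ} (hF : Continuous F)
    (hFc : HasCompactSupport F) (hu : MemLp u (ENNReal.ofReal p) (volume.restrict Ω)) :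
    Integrable (fun x => u x * F x) (volume.restrict Ω) := by
  obtain ⟨C, hC⟩ := hFc.exists_bound_of_continuous hF
  exact (hu.integrable (by simpa using hp)).mul_bdd hF.aestronglyMeasurable
    (Eventually.of_forall hC)

lemma integrable_inner_of_hasCompactSupport (hp : 1 ≤ p) {F : Eucl N → Eucl N} (hF : Continuous F)
    (hFc : HasCompactSupport F) (hg : MemLp g (ENNReal.ofReal p) (volume.restrict Ω)) :
    Integrable (fun x => inner ℝ (F x) (g x)) (volume.restrict Ω) := by
  obtain ⟨C, hC⟩ := hFc.exists_bound_of_continuous hF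
  refine ((hg.integrable (by simpa using hp)).norm.const_mul C).mono'
    (hF.aestronglyMeasurable.inner hg.aestronglyMeasurable) (Eventually.of_forall fun x => ?_)
  exact (norm_inner_le_norm _ _).trans (mul_le_mul_of_nonneg_right (hC x) (norm_nonneg _))

/-- The barrier `ε η^b` has a `C¹` flux, so the comparison inequality can be integrated by parts.
For small `ε` the result is bounded above by a negative multiple of `∫ (v - u)₊ w^(q-1)`, with `w =
η^b`, which must therefore vanish. -/
lemma InEnergySpace.exists_continuous_lower_bound (D : Admissible Ω p q lam a M) {a₀ : ℝ}
    (ha₀ : 0 < a₀) {x₀ : Eucl N} {R : ℝ} (hR : 0 < R) (hR1 : R ≤ 1)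
    (hball : Metric.closedBall x₀ R ⊆ Ω) (haball : ∀ x ∈ Metric.ball x₀ R, a₀ ≤ a x)
    (hu : InEnergySpace B Ω p u g) (hu0 : NonnegIn Ω u) (hA : 0 < weightInt Ω q a u)
    (hmin : ∀ w H, InEnergySpace B Ω p w H → 0 < weightInt Ω q a w →
      energyI Ω p q lam a u ≤ energyI Ω p q lam a w) :
    ∃ v : Eucl N → ℝ, Continuous v ∧ 0 < v x₀ ∧ ∀ᵐ x ∂(volume.restrict Ω), v x ≤ u x := by
  have hp := D.one_lt_p
  have hp0 := D.p_pos
  have hq := D.one_lt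
  have hq0 := D.q_pos
  have hlam := D.lam_neg
  have hpq : 0 < p - q := sub_pos.2 D.lt
  have hp1 : 0 < p - 1 := by linarith
  set s := p / (p - 1) with hs_def
  have hs : 1 < s := by rw [hs_def, one_lt_div hp1]; linarith
  -- The first summand ensures `b (p - q) ≥ p - 1`, equivalent to `b (q - 1) ≤ γ`; the second
  -- ensures `γ > 1`, so that the flux is `C¹`; the last gives `b > 1`.
  set b := (p - 1) / (p - q) + 1 / (p - 1) + 1 with hb_def
  have hb1 : 0 < (p - 1) / (p - q) := by positivity
  have hb2 : 0 < 1 / (p - 1) := by positivity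
  have hb : 1 < b := by linarith
  set γ := (b - 1) * (p - 1) with hγ_def
  have hγ : 1 < γ := by
    have : 1 / (p - 1) * (p - 1) = 1 := by field_simp
    have h2 : 0 < (p - 1) / (p - q) * (p - 1) := by positivity
    rw [hγ_def, hb_def]
    linarith
  have hγb : b * (q - 1) ≤ γ := by
    have h1 : (p - 1) / (p - q) * (p - q) = p - 1 := by field_simp
    have h2 : 0 < 1 / (p - 1) * (p - q) := by positivity
    rw [hγ_def]
    have h3 : p - 1 ≤ b * (p - q) := by
      rw [hb_def]; linarith
    linarith
  set η := radialProfile x₀ R s with hη_def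
  have hη0 : ∀ x, 0 ≤ η x := fun x => radialProfile_nonneg x
  have hη1 : ∀ x, η x ≤ 1 := radialProfile_le_one hR.le hR1 (by linarith)
  set w : Eucl N → ℝ := fun x => η x ^ b with hw_def
  set ζ : Eucl N → ℝ := fun x => η x ^ γ with hζ_def
  have hw0 (x : Eucl N) : 0 ≤ w x := Real.rpow_nonneg (hη0 x) _
  have hw1 (x : Eucl N) : w x ≤ 1 := Real.rpow_le_one (hη0 x) (hη1 x) (by linarith)
  have hwd : ContDiff ℝ 1 w := contDiff_radialProfile_rpow hs hb
  have hζd : ContDiff ℝ 1 ζ := contDiff_radialProfile_rpow hs hγ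
  have hs0 : 0 < s := by linarith
  have hwc : HasCompactSupport w :=
    hasCompactSupport_radialProfile_rpow hR.le hs0 (by linarith : b ≠ 0)
  have hζc : HasCompactSupport ζ :=
    hasCompactSupport_radialProfile_rpow hR.le hs0 (by linarith : γ ≠ 0)
  have hws : tsupport w ⊆ Ω := (tsupport_radialProfile_rpow hR.le hs0 (by linarith)).trans hball
  have hζs : tsupport ζ ⊆ Ω := (tsupport_radialProfile_rpow hR.le hs0 (by linarith)).trans hball
  have hζw (x : Eucl N) : ζ x ≤ w x ^ (q - 1) := by
    rw [hw_def, hζ_def]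
    simp only
    rw [← Real.rpow_mul (hη0 x)]
    rcases (hη0 x).eq_or_lt with h | h
    · rw [← h, Real.zero_rpow (by linarith)]; positivity
    · exact Real.rpow_le_rpow_of_exponent_ge h (hη1 x) hγb
  set c := (b * s) ^ (p - 1) with hc_def
  have hc : 0 ≤ c := by positivity
  -- Flux and zero-order term scale like `ε^(p-1)`, the term with `a₀` like `ε^(q-1)`; as `q < p`,
  -- the latter dominates for small `ε`.
  obtain ⟨ε, hε, hεs⟩ : ∃ ε : ℝ, 0 < ε ∧ ε ^ (p - q) * (c * N + -lam) < a₀ / q := by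
    have h1 : Tendsto (fun ε : ℝ => ε ^ (p - q) * (c * N + -lam)) (𝓝[>] 0) (𝓝 0) := by
      have h2 : ContinuousAt (fun ε : ℝ => ε ^ (p - q) * (c * N + -lam)) 0 :=
        (Real.continuousAt_rpow_const _ _ (Or.inr hpq.le)).mul_const _
      have h3 := h2.tendsto.mono_left (nhdsWithin_le_nhds (s := Ioi 0))
      simpa [Real.zero_rpow hpq.ne'] using h3
    obtain ⟨ε, h4, h5⟩ := ((h1.eventually (gt_mem_nhds (by positivity : 0 < a₀ / q))).and
      self_mem_nhdsWithin).exists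
    exact ⟨ε, h5, h4⟩
  have hv := (inEnergySpace_of_contDiff hp.le D.isOpen B hwd hwc hws).const_mul ε
  have hh := (hv.sub hp.le hu).posPart hp.le D.isOpen
  have hcomp := hu.comparison D ha₀ hu0 hA hmin hv (fun x => mul_nonneg hε.le (hw0 x))
    (fun x hx => haball x (mem_ball_of_radialProfile_ne_zero hR.le hs0 fun h0 => by
      rw [hw_def] at hx
      simp only [hη_def, h0, Real.zero_rpow (by linarith : b ≠ 0), mul_zero, lt_irrefl] at hx))
  have hflux (x y : Eucl N) : ‖ε • gradient w x‖ ^ (p - 2) * inner ℝ (ε • gradient w x) y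
      = -(ε ^ (p - 1) * c) * (ζ x * inner ℝ (x - x₀) y) := by
    have h1 := flux_radialProfile_rpow (x₀ := x₀) (R := R) hp hb x
    have h2 : ‖gradient w x‖ ^ (p - 2) • gradient w x = (-(c * ζ x)) • (x - x₀) := h1
    have h3 := congrArg (fun z => inner ℝ z y) h2
    simp only [real_inner_smul_left] at h3
    rw [norm_smul, Real.norm_of_nonneg hε.le, Real.mul_rpow hε.le (norm_nonneg _),
      real_inner_smul_left, show p - 1 = p - 2 + 1 by ring, Real.rpow_add_one hε.ne']
    linear_combination (ε ^ (p - 2) * ε) * h3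
  simp_rw [hflux] at hcomp
  set h : Eucl N → ℝ := fun x => max (ε * w x - u x) 0 with hh_def
  set H : Eucl N → Eucl N := fun x => if 0 < ε * w x - u x then ε • gradient w x - g x else 0
  have hh0 (x : Eucl N) : 0 ≤ h x := le_max_right _ _
  have hζ' := continuous_gradient_of_contDiff hζd
  have hζc' := hasCompactSupport_gradient hζc
  have hwr {r : ℝ} (hr : 1 < r) : Continuous fun x => (ε * w x) ^ (r - 1) :=
    (continuous_const.mul hwd.continuous).rpow_const fun _ => Or.inr (by linarith)
  have hwrc {r : ℝ} (hr : 1 < r) : HasCompactSupport fun x => (ε * w x) ^ (r - 1) :=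
    hwc.comp_left (g := fun t => (ε * t) ^ (r - 1))
      (by simp [Real.zero_rpow (by linarith : r - 1 ≠ 0)])
  have hwr' : Continuous fun x => w x ^ (q - 1) :=
    hwd.continuous.rpow_const fun _ => Or.inr (by linarith)
  have hwrc' : HasCompactSupport fun x => w x ^ (q - 1) :=
    hwc.comp_left (g := fun t => t ^ (q - 1)) (Real.zero_rpow (by linarith : q - 1 ≠ 0))
  have hsub : Continuous fun x : Eucl N => x - x₀ := continuous_id.sub continuous_const
  have i1 : Integrable (fun x => ζ x * inner ℝ (x - x₀) (H x)) (volume.restrict Ω) := by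
    refine (integrable_inner_of_hasCompactSupport hp.le (F := fun x => ζ x • (x - x₀))
      (hζd.continuous.smul hsub) hζc.smul_right hh.memLp_grad).congr
      (Eventually.of_forall fun x => ?_)
    simp only [real_inner_smul_left]
  have i2 : Integrable (fun x => h x * (N * ζ x + inner ℝ (gradient ζ x) (x - x₀)))
      (volume.restrict Ω) := by
    refine integrable_mul_of_hasCompactSupport hp.le
      (F := fun x => N * ζ x + inner ℝ (gradient ζ x) (x - x₀))
      ((continuous_const.mul hζd.continuous).add (hζ'.inner hsub)) ?_ hh.memLp
    refine HasCompactSupport.add hζc.mul_left (hζc'.mono fun x hx => ?_)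
    intro h0
    exact hx (by simp [h0])
  have i3 : Integrable (fun x => (-lam * (ε * w x) ^ (p - 1) - a₀ / q * (ε * w x) ^ (q - 1)) * h x)
      (volume.restrict Ω) := by
    refine (((integrable_mul_of_hasCompactSupport hp.le (hwr hp) (hwrc hp) hh.memLp).const_mul
      (-lam)).sub ((integrable_mul_of_hasCompactSupport hp.le (hwr hq) (hwrc hq)
        hh.memLp).const_mul (a₀ / q))).congr (Eventually.of_forall fun x => ?_)
    simp only [Pi.sub_apply, hh_def]
    ring
  have i4 : Integrable (fun x => h x * w x ^ (q - 1)) (volume.restrict Ω) :=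
    integrable_mul_of_hasCompactSupport hp.le hwr' hwrc' hh.memLp
  have hdiv : ∫ x in Ω, ζ x * inner ℝ (x - x₀) (H x)
      = - ∫ x in Ω, h x * (N * ζ x + inner ℝ (gradient ζ x) (x - x₀)) :=
    hh.toHasSobolevGradient.integral_mul_inner_sub hp.le D.isOpen hζd hζc hζs x₀
  rw [integral_add (i1.const_mul _) i3, integral_const_mul, hdiv, neg_mul_neg,
    ← integral_const_mul, ← integral_add (i2.const_mul _) i3] at hcomp
  set δ := ε ^ (q - 1) * (a₀ / q - ε ^ (p - q) * (c * N + -lam)) with hδ_def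
  have hδ : 0 < δ := mul_pos (by positivity) (by linarith)
  -- The radial derivative of `ζ` is nonpositive and is dropped. Since `R ≤ 1` gives `η ≤ 1`, both
  -- `ζ` and `w^(p-1)` are at most `w^(q-1)`, and the factor `-δ` remains.
  have hbound : ∫ x in Ω, (ε ^ (p - 1) * c * (h x * (N * ζ x + inner ℝ (gradient ζ x) (x - x₀)))
        + (-lam * (ε * w x) ^ (p - 1) - a₀ / q * (ε * w x) ^ (q - 1)) * h x)
      ≤ ∫ x in Ω, -δ * (h x * w x ^ (q - 1)) := by
    refine integral_mono ((i2.const_mul _).add i3) (i4.const_mul _) fun x => ?_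
    have e1 : ε ^ (p - 1) = ε ^ (q - 1) * ε ^ (p - q) := by
      rw [← Real.rpow_add hε]; ring_nf
    have e2 : inner ℝ (gradient ζ x) (x - x₀) ≤ 0 :=
      inner_gradient_radialProfile_rpow_nonpos hs hγ x
    have e3 : w x ^ (p - 1) ≤ w x ^ (q - 1) :=
      Real.rpow_le_rpow_of_exponent_ge' (hw0 x) (hw1 x) (by linarith) (by linarith)
    have e4 : N * ζ x + inner ℝ (gradient ζ x) (x - x₀) ≤ N * w x ^ (q - 1) := by
      have := mul_le_mul_of_nonneg_left (hζw x) (Nat.cast_nonneg N : (0 : ℝ) ≤ N)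
      linarith
    have hεp : 0 ≤ ε ^ (p - 1) := by positivity
    have e5 := mul_le_mul_of_nonneg_left e4 (mul_nonneg (mul_nonneg hεp hc) (hh0 x))
    have e6 := mul_le_mul_of_nonneg_left e3
      (mul_nonneg (mul_nonneg hεp (by linarith : 0 ≤ -lam)) (hh0 x))
    simp only
    rw [Real.mul_rpow hε.le (hw0 x), Real.mul_rpow hε.le (hw0 x), hδ_def]
    rw [e1] at e5 e6 ⊢
    linear_combination e5 + e6
  rw [integral_const_mul] at hbound
  have hzero : ∫ x in Ω, h x * w x ^ (q - 1) = 0 := by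
    refine le_antisymm ?_ (integral_nonneg fun x => ?_)
    · nlinarith
    · have := hw0 x
      have := hh0 x
      positivity
  rw [integral_eq_zero_iff_of_nonneg (fun x => mul_nonneg (hh0 x) (Real.rpow_nonneg (hw0 x) _)) i4]
    at hzero
  refine ⟨fun x => ε * w x, continuous_const.mul hwd.continuous,
    mul_pos hε (Real.rpow_pos_of_pos (radialProfile_self hR hs0) _), ?_⟩
  filter_upwards [hzero, hu0] with x hx hux
  -- Either `(v - u)₊ = 0`, or the barrier vanishes at `x`, where `u ≥ 0` is enough.
  rcases mul_eq_zero.1 hx with h1 | h1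
  · have := le_max_left (ε * w x - u x) 0
    rw [show max (ε * w x - u x) 0 = 0 from h1] at this
    linarith
  · rw [(Real.rpow_eq_zero (hw0 x) (by linarith)).1 h1, mul_zero]
    exact hux

lemma InEnergySpace.exists_continuous_lower_bound_of_mem (D : Admissible Ω p q lam a M)
    (hac : ContinuousOn a Ω) {x₀ : Eucl N} (hx₀ : x₀ ∈ posSet Ω a)
    (hu : InEnergySpace B Ω p u g) (hu0 : NonnegIn Ω u) (hA : 0 < weightInt Ω q a u)
    (hmin : ∀ w H, InEnergySpace B Ω p w H → 0 < weightInt Ω q a w →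
      energyI Ω p q lam a u ≤ energyI Ω p q lam a w) :
    ∃ v : Eucl N → ℝ, Continuous v ∧ 0 < v x₀ ∧ ∀ᵐ x ∂(volume.restrict Ω), v x ≤ u x := by
  have hnhds : Ω ∈ 𝓝 x₀ := D.isOpen.mem_nhds hx₀.1
  have h1 : ∀ᶠ x in 𝓝 x₀, x ∈ Ω ∧ a x₀ / 2 ≤ a x := by
    filter_upwards [hnhds, (hac.continuousAt hnhds).eventually
      (lt_mem_nhds (half_lt_self hx₀.2))] with x hx hx' using ⟨hx, le_of_lt hx'⟩
  obtain ⟨R, hR, hRs⟩ := Metric.nhds_basis_closedBall.mem_iff.1 h1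
  have hsub : Metric.closedBall x₀ (min R 1) ⊆ {x | x ∈ Ω ∧ a x₀ / 2 ≤ a x} :=
    (Metric.closedBall_subset_closedBall (min_le_left _ _)).trans hRs
  exact hu.exists_continuous_lower_bound D (half_pos hx₀.2) (lt_min hR one_pos) (min_le_right _ _)
    (fun x hx => (hsub hx).1) (fun x hx => (hsub (Metric.ball_subset_closedBall hx)).2)
    hu0 hA hmin

end Comparison

/-! ### Truncated test functions for the Picone inequality -/

section TestFunction

/-- A bounded `C¹` approximation of `max s 0 ^ q`. -/
def truncPow (k q s : ℝ) : ℝ := (max (k * Real.arctan (s / k)) 0) ^ q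

/-- The derivative of `truncPow`. -/
def truncPowDeriv (k q s : ℝ) : ℝ :=
  q * (max (k * Real.arctan (s / k)) 0) ^ (q - 1) * (1 / (1 + (s / k) ^ 2))

variable {k q ε : ℝ}

lemma hasDerivAt_mul_arctan_div (hk : 0 < k) (s : ℝ) :
    HasDerivAt (fun s => k * Real.arctan (s / k)) (1 / (1 + (s / k) ^ 2)) s := by
  have h := (((hasDerivAt_id s).div_const k).arctan).const_mul k
  convert! h using 1
  simp only [id]
  field_simp

lemma hasDerivAt_truncPow (hq : 1 < q) (hk : 0 < k) (s : ℝ) :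
    HasDerivAt (truncPow k q) (truncPowDeriv k q s) s := by
  have h := (hasDerivAt_max_rpow hq (k * Real.arctan (s / k))).comp s (hasDerivAt_mul_arctan_div hk s)
  exact h

lemma continuous_truncPowDeriv (hq : 1 < q) : Continuous (truncPowDeriv k q) := by
  have h1 : Continuous fun s : ℝ => (max (k * Real.arctan (s / k)) 0) ^ (q - 1) :=
    Continuous.rpow_const (by fun_prop) fun _ => Or.inr (by linarith)
  have h2 : Continuous fun s : ℝ => 1 / (1 + (s / k) ^ 2) :=
    continuous_const.div (by fun_prop) fun s => by positivity
  exact (continuous_const.mul h1).mul h2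

lemma max_mul_arctan_le (hk : 0 < k) (s : ℝ) :
    max (k * Real.arctan (s / k)) 0 ≤ k * (Real.pi / 2) :=
  max_le (mul_le_mul_of_nonneg_left (Real.arctan_lt_pi_div_two _).le hk.le) (by positivity)

lemma one_div_one_add_sq_le (s : ℝ) : 1 / (1 + s ^ 2) ≤ 1 := by
  rw [div_le_one (by positivity)]
  nlinarith [sq_nonneg s]

lemma abs_truncPow_le (hq : 1 < q) (hk : 0 < k) (s : ℝ) :
    |truncPow k q s| ≤ (k * (Real.pi / 2)) ^ q := by
  have h := le_max_right (k * Real.arctan (s / k)) 0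
  rw [truncPow, abs_of_nonneg (Real.rpow_nonneg h _)]
  exact Real.rpow_le_rpow h (max_mul_arctan_le hk s) (by linarith)

lemma abs_truncPowDeriv_le (hq : 1 < q) (hk : 0 < k) (s : ℝ) :
    |truncPowDeriv k q s| ≤ q * (k * (Real.pi / 2)) ^ (q - 1) := by
  have h := le_max_right (k * Real.arctan (s / k)) 0
  have h1 := Real.rpow_le_rpow h (max_mul_arctan_le hk s) (by linarith : 0 ≤ q - 1)
  have h2 := Real.rpow_nonneg h (q - 1)
  have h3 := one_div_one_add_sq_le (s / k)
  have hq0 : 0 < q := by linarith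
  rw [truncPowDeriv, abs_of_nonneg (by positivity)]
  refine (mul_le_of_le_one_right (by positivity) h3).trans ?_
  gcongr

lemma max_mul_arctan_le_self (hk : 0 < k) {s : ℝ} (hs : 0 ≤ s) :
    max (k * Real.arctan (s / k)) 0 ≤ s := by
  refine max_le ?_ hs
  have h0 : 0 ≤ s / k := by positivity
  have h1 := Real.le_tan (Real.arctan_nonneg.2 h0) (Real.arctan_lt_pi_div_two _)
  rw [Real.tan_arctan, le_div_iff₀ hk] at h1
  linarith

lemma tendsto_max_mul_arctan {s : ℝ} (hs : 0 ≤ s) :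
    Tendsto (fun n : ℕ => max (((n : ℝ) + 1) * Real.arctan (s / ((n : ℝ) + 1))) 0) atTop (𝓝 s) := by
  have h1 : Tendsto (fun n : ℕ => ((n : ℝ) + 1) * Real.arctan (s / ((n : ℝ) + 1))) atTop (𝓝 s) := by
    rcases hs.eq_or_lt with rfl | hs
    · simp
    have h2 := hasDerivAt_iff_tendsto_slope_zero.1 (Real.hasDerivAt_arctan 0)
    have h3 : Tendsto (fun n : ℕ => s / ((n : ℝ) + 1)) atTop (𝓝[≠] 0) := by
      refine tendsto_nhdsWithin_iff.2 ⟨?_, Eventually.of_forall fun n => ?_⟩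
      · have := (tendsto_one_div_add_atTop_nhds_zero_nat (𝕜 := ℝ)).const_mul s
        simpa [div_eq_mul_inv] using this
      · exact (by positivity : 0 < s / ((n : ℝ) + 1)).ne'
    have h4 := (h2.comp h3).const_mul s
    simp only [Function.comp_def, zero_add, Real.arctan_zero, sub_zero, smul_eq_mul] at h4
    convert! h4 using 2
    · field_simp
    · simp
  simpa [max_eq_left hs] using h1.max (tendsto_const_nhds (x := (0 : ℝ)))

/-- A bounded `C¹` function which equals `(ε + t) ^ (1 - q)` for `t ≥ 0`. -/
def dampedPow (ε q t : ℝ) : ℝ :=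
  (ε + max t 0) ^ (1 - q) + (1 - q) * ε ^ (-q) * Real.arctan (min t 0)

/-- The derivative of `dampedPow`. -/
def dampedPowDeriv (ε q t : ℝ) : ℝ :=
  (1 - q) * (ε + max t 0) ^ (-q) * (1 / (1 + (min t 0) ^ 2))

lemma dampedPow_of_nonneg {t : ℝ} (ht : 0 ≤ t) : dampedPow ε q t = (ε + t) ^ (1 - q) := by
  simp [dampedPow, max_eq_left ht, min_eq_right ht]

lemma dampedPowDeriv_of_nonneg {t : ℝ} (ht : 0 ≤ t) :
    dampedPowDeriv ε q t = (1 - q) * (ε + t) ^ (-q) := by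
  simp [dampedPowDeriv, max_eq_left ht, min_eq_right ht]

lemma continuous_dampedPow (hε : 0 < ε) : Continuous (dampedPow ε q) := by
  have h1 : Continuous fun t : ℝ => (ε + max t 0) ^ (1 - q) :=
    Continuous.rpow_const (by fun_prop) fun t => Or.inl
      (by have := le_max_right t 0; positivity)
  exact h1.add (by fun_prop)

lemma continuous_dampedPowDeriv (hε : 0 < ε) : Continuous (dampedPowDeriv ε q) := by
  have h1 : Continuous fun t : ℝ => (ε + max t 0) ^ (-q) :=
    Continuous.rpow_const (by fun_prop) fun t => Or.inl
      (by have := le_max_right t 0; positivity)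
  exact (continuous_const.mul h1).mul
    (continuous_const.div (by fun_prop) fun s => by positivity)

/-- The arctangent branch is bounded and has at 0 the slope `(1 - q) ε^(-q)` of the power branch, so
the two join in a `C¹` way. Only `t ≥ 0` matters later, but the chain rule asks for bounds on all of
`ℝ`. -/
lemma hasDerivAt_dampedPow (hε : 0 < ε) (t : ℝ) :
    HasDerivAt (dampedPow ε q) (dampedPowDeriv ε q t) t := by
  have hne : ∀ t : ℝ, t ≠ 0 → HasDerivAt (dampedPow ε q) (dampedPowDeriv ε q t) t := by
    intro t ht
    rcases lt_or_gt_of_ne ht with h | h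
    · have h1 := ((Real.hasDerivAt_arctan t).const_mul ((1 - q) * ε ^ (-q))).const_add (ε ^ (1 - q))
      have e : dampedPowDeriv ε q t = (1 - q) * ε ^ (-q) * (1 / (1 + t ^ 2)) := by
        simp [dampedPowDeriv, max_eq_right h.le, min_eq_left h.le]
      rw [e]
      refine h1.congr_of_eventuallyEq ?_
      filter_upwards [gt_mem_nhds h] with s hs
      have hs' : s ≤ 0 := le_of_lt hs
      simp [dampedPow, max_eq_right hs', min_eq_left hs']
    · have h1 := ((hasDerivAt_id t).const_add ε).rpow_const (p := 1 - q)
        (Or.inl (by simp only [id]; positivity))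
      rw [dampedPowDeriv_of_nonneg h.le]
      have e : (1 - q) * (ε + t) ^ (-q) = 1 * (1 - q) * (ε + id t) ^ (1 - q - 1) := by
        simp only [id]; ring_nf
      rw [e]
      refine h1.congr_of_eventuallyEq ?_
      filter_upwards [lt_mem_nhds h] with s hs
      exact dampedPow_of_nonneg (le_of_lt hs)
  rcases eq_or_ne t 0 with rfl | ht
  · exact hasDerivAt_of_hasDerivAt_of_ne' (fun y hy => hne y hy)
      (continuous_dampedPow hε).continuousAt (continuous_dampedPowDeriv hε).continuousAt 0
  · exact hne t ht

lemma abs_dampedPow_le (hq : 1 < q) (hε : 0 < ε) (t : ℝ) :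
    |dampedPow ε q t| ≤ ε ^ (1 - q) + (q - 1) * ε ^ (-q) * (Real.pi / 2) := by
  have h0 := le_max_right t 0
  have h1 : (ε + max t 0) ^ (1 - q) ≤ ε ^ (1 - q) :=
    Real.rpow_le_rpow_of_nonpos hε (by linarith) (by linarith)
  have h2 : 0 < (ε + max t 0) ^ (1 - q) := by positivity
  have h3 : |Real.arctan (min t 0)| ≤ Real.pi / 2 :=
    abs_le.2 ⟨(Real.neg_pi_div_two_lt_arctan _).le, (Real.arctan_lt_pi_div_two _).le⟩
  refine (abs_add_le _ _).trans ?_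
  rw [abs_of_pos h2, abs_mul, abs_mul, abs_of_neg (by linarith : 1 - q < 0), neg_sub,
    abs_of_pos (by positivity : 0 < ε ^ (-q))]
  have h4 : 0 ≤ (q - 1) * ε ^ (-q) := mul_nonneg (by linarith) (by positivity)
  gcongr

lemma abs_dampedPowDeriv_le (hq : 1 < q) (hε : 0 < ε) (t : ℝ) :
    |dampedPowDeriv ε q t| ≤ (q - 1) * ε ^ (-q) := by
  have h0 := le_max_right t 0
  have h1 : (ε + max t 0) ^ (-q) ≤ ε ^ (-q) :=
    Real.rpow_le_rpow_of_nonpos hε (by linarith) (by linarith)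
  have h3 := one_div_one_add_sq_le (min t 0)
  rw [dampedPowDeriv, abs_mul, abs_mul, abs_of_neg (by linarith : 1 - q < 0), neg_sub,
    abs_of_pos (by positivity : 0 < (ε + max t 0) ^ (-q)),
    abs_of_pos (by positivity : 0 < 1 / (1 + (min t 0) ^ 2))]
  have h5 : 0 ≤ q - 1 := by linarith
  refine (mul_le_of_le_one_right (by positivity) h3).trans ?_
  gcongr

lemma C1Bounded.mul_single {f f' h h' : ℝ → ℝ} {Cf Cf' Ch Ch' : ℝ}
    (hf : ∀ s, HasDerivAt f (f' s) s) (hf' : Continuous f') (hfb : ∀ s, |f s| ≤ Cf)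
    (hfb' : ∀ s, |f' s| ≤ Cf') (hh : ∀ s, HasDerivAt h (h' s) s) (hh' : Continuous h')
    (hhb : ∀ s, |h s| ≤ Ch) (hhb' : ∀ s, |h' s| ≤ Ch') (h0 : f 0 = 0) :
    C1Bounded (fun s t => f s * h t) (fun s t => f' s * h t) (fun s t => f s * h' t)
      (max (Cf' * Ch) (Cf * Ch')) where
  hasFDerivAt s t := by
    have h1 := (hf s).comp_hasFDerivAt (s, t)
      (hasFDerivAt_fst (𝕜 := ℝ) (E := ℝ) (F := ℝ) (p := (s, t)))
    have h2 := (hh t).comp_hasFDerivAt (s, t)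
      (hasFDerivAt_snd (𝕜 := ℝ) (E := ℝ) (F := ℝ) (p := (s, t)))
    have h3 := h1.mul h2
    have e : (f ∘ Prod.fst) (s, t) • h' t • ContinuousLinearMap.snd ℝ ℝ ℝ
          + (h ∘ Prod.snd) (s, t) • f' s • ContinuousLinearMap.fst ℝ ℝ ℝ
        = (f' s * h t) • ContinuousLinearMap.fst ℝ ℝ ℝ
          + (f s * h' t) • ContinuousLinearMap.snd ℝ ℝ ℝ := by
      simp only [Function.comp_apply, smul_smul]
      rw [add_comm, mul_comm (h t)]
    rw [← e]
    exact h3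
  continuous_fst := (hf'.comp _root_.continuous_fst).mul
    ((continuous_iff_continuousAt.2 fun t => (hh t).continuousAt).comp _root_.continuous_snd)
  continuous_snd := ((continuous_iff_continuousAt.2 fun t => (hf t).continuousAt).comp
    _root_.continuous_fst).mul (hh'.comp _root_.continuous_snd)
  bound_fst s t := by
    rw [abs_mul]
    exact (mul_le_mul (hfb' s) (hhb t) (abs_nonneg _)
      ((abs_nonneg _).trans (hfb' s))).trans (le_max_left _ _)
  bound_snd s t := by
    rw [abs_mul]
    exact (mul_le_mul (hfb s) (hhb' t) (abs_nonneg _)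
      ((abs_nonneg _).trans (hfb s))).trans (le_max_right _ _)
  zero := by rw [h0, zero_mul]

/-- The ideal test function `U^q / u^(q-1)` need not lie in the energy space. Truncating `U` and
replacing `u` by `ε + u` makes both factors and their derivatives bounded. -/
lemma c1Bounded_truncPow_mul_dampedPow (hq : 1 < q) (hk : 0 < k) (hε : 0 < ε) :
    ∃ C, C1Bounded (fun s t => truncPow k q s * dampedPow ε q t)
      (fun s t => truncPowDeriv k q s * dampedPow ε q t)
      (fun s t => truncPow k q s * dampedPowDeriv ε q t) C :=
  ⟨_, C1Bounded.mul_single (hasDerivAt_truncPow hq hk) (continuous_truncPowDeriv hq)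
    (abs_truncPow_le hq hk) (abs_truncPowDeriv_le hq hk) (hasDerivAt_dampedPow hε)
    (continuous_dampedPowDeriv hε) (abs_dampedPow_le hq hε) (abs_dampedPowDeriv_le hq hε)
    (by simp [truncPow, Real.zero_rpow (by linarith : q ≠ 0)])⟩

end TestFunction

/-! ### Picone and Young inequalities -/

section Picone

variable {E : Type*} [NormedAddCommGroup E] [InnerProductSpace ℝ E] {p q ε k : ℝ}

lemma rpow_sub_two_mul_inner_self (hp : 1 < p) (x : E) :
    ‖x‖ ^ (p - 2) * inner ℝ x x = ‖x‖ ^ p := by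
  rcases eq_or_ne x 0 with rfl | hx
  · simp [Real.zero_rpow (by linarith : p ≠ 0)]
  · have h : 0 < ‖x‖ := norm_pos_iff.2 hx
    rw [real_inner_self_eq_norm_sq, ← Real.rpow_natCast, ← Real.rpow_add h]
    norm_num

/-- The scalar form of the Picone inequality. -/
lemma picone_scalar (hq : 1 < q) (hqp : q < p) {X m n : ℝ} (hX : 0 ≤ X) (hm : 0 ≤ m)
    (hn : 0 ≤ n) :
    q * X ^ (q - 1) * (n ^ (p - 1) * m) + (1 - q) * X ^ q * n ^ p ≤ m ^ q * n ^ (p - q) := by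
  rcases hn.eq_or_lt with h | h
  · rw [← h, Real.zero_rpow (by linarith), Real.zero_rpow (by linarith),
      Real.zero_rpow (by linarith)]
    simp
  -- The tangent bound for `t^q` between `X n` and `m`; multiplying it by `n^(p-q)` gives the claim.
  have h1 := rpow_sub_rpow_le hq (mul_nonneg hX hn) hm
  have e1 : n ^ (p - 1) = n ^ (p - q) * n ^ (q - 1) := by rw [← Real.rpow_add h]; ring_nf
  have e2 : n ^ p = n ^ (p - q) * n ^ q := by rw [← Real.rpow_add h]; ring_nf
  have e3 : n ^ (q - 1) * n = n ^ q := by rw [← Real.rpow_add_one h.ne']; ring_nf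
  have e4 : X ^ (q - 1) * X = X ^ q := by
    rcases hX.eq_or_lt with h' | h'
    · rw [← h', Real.zero_rpow (by linarith : q ≠ 0), mul_zero]
    · rw [← Real.rpow_add_one h'.ne']; ring_nf
  rw [Real.mul_rpow hX hn, Real.mul_rpow hX hn] at h1
  have h2 := mul_le_mul_of_nonneg_left h1 (by positivity : 0 ≤ n ^ (p - q))
  rw [e1, e2]
  have e5 : q * (X ^ (q - 1) * n ^ (q - 1) * (X * n - m))
      = q * (X ^ q * n ^ q) - q * X ^ (q - 1) * n ^ (q - 1) * m := by
    rw [← e3, ← e4]; ring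
  rw [e5] at h2
  linear_combination h2

/-- With `X = T / (ε + t)` the test function's gradient has coefficients `q X^(q-1) T'` and `(1 - q)
X^q`. The truncation satisfies `0 ≤ T' ≤ 1`, so `T'` can be dropped and the scalar inequality
applies; the bound does not depend on `k` or `ε`. -/
lemma picone_test (hq : 1 < q) (hqp : q < p) (hε : 0 < ε) {s t : ℝ}
    (ht : 0 ≤ t) (y z : E) :
    ‖z‖ ^ (p - 2) * inner ℝ z ((truncPowDeriv k q s * dampedPow ε q t) • y
        + (truncPow k q s * dampedPowDeriv ε q t) • z) ≤ ‖y‖ ^ q * ‖z‖ ^ (p - q) := by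
  have hεt : 0 < ε + t := by positivity
  set T := max (k * Real.arctan (s / k)) 0 with hT
  have hT0 : 0 ≤ T := le_max_right _ _
  have h3 := one_div_one_add_sq_le (s / k)
  have h4 : 0 ≤ 1 / (1 + (s / k) ^ 2) := by positivity
  have hX : 0 ≤ T / (ε + t) := by positivity
  have hq0 : 0 < q := by linarith
  have e1 : truncPowDeriv k q s * dampedPow ε q t
      = q * (T / (ε + t)) ^ (q - 1) * (1 / (1 + (s / k) ^ 2)) := by
    rw [truncPowDeriv, dampedPow_of_nonneg ht, Real.div_rpow hT0 hεt.le, ← hT,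
      show 1 - q = -(q - 1) by ring, Real.rpow_neg hεt.le]
    ring
  have e2 : truncPow k q s * dampedPowDeriv ε q t = (1 - q) * (T / (ε + t)) ^ q := by
    rw [truncPow, dampedPowDeriv_of_nonneg ht, Real.div_rpow hT0 hεt.le, ← hT,
      Real.rpow_neg hεt.le]
    ring
  rw [inner_add_right, real_inner_smul_right, real_inner_smul_right, e1, e2]
  have h5 := (abs_le.1 (abs_rpow_sub_two_mul_inner_le (r := p) z y)).2
  have h6 := rpow_sub_two_mul_inner_self (hq.trans hqp) z
  have h7 := picone_scalar hq hqp hX (norm_nonneg y) (norm_nonneg z)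
  have h8 : 0 ≤ q * (T / (ε + t)) ^ (q - 1) := by positivity
  have h9 := mul_le_mul_of_nonneg_left h5 (mul_nonneg h8 h4)
  have h10 := mul_le_mul_of_nonneg_right (mul_le_of_le_one_right h8 h3)
    (by positivity : 0 ≤ ‖z‖ ^ (p - 1) * ‖y‖)
  calc _ = q * (T / (ε + t)) ^ (q - 1) * (1 / (1 + (s / k) ^ 2)) * (‖z‖ ^ (p - 2) * inner ℝ z y)
        + (1 - q) * (T / (ε + t)) ^ q * (‖z‖ ^ (p - 2) * inner ℝ z z) := by ring
    _ ≤ _ := by rw [h6]; linarith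

lemma rpow_mul_rpow_le_young (hq : 0 < q) (hqp : q < p) {m n : ℝ} (hm : 0 ≤ m) (hn : 0 ≤ n) :
    m ^ q * n ^ (p - q) ≤ q / p * m ^ p + (p - q) / p * n ^ p := by
  have hp : 0 < p := hq.trans hqp
  have h := Real.geom_mean_le_arith_mean2_weighted (w₁ := q / p) (w₂ := (p - q) / p)
    (by positivity) (div_nonneg (by linarith) hp.le) (Real.rpow_nonneg hm p)
    (Real.rpow_nonneg hn p) (by field_simp; ring)
  rwa [← Real.rpow_mul hm, ← Real.rpow_mul hn, mul_div_cancel₀ _ hp.ne',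
    mul_div_cancel₀ _ hp.ne'] at h

end Picone

/-! ### Uniqueness among solutions positive where `a > 0` -/

section Uniqueness

lemma rpow_sub_one_mul_self {r s : ℝ} (hr : 1 < r) (hs : 0 ≤ s) : s ^ (r - 1) * s = s ^ r := by
  rcases hs.eq_or_lt with h | h
  · rw [← h, Real.zero_rpow (by linarith : r ≠ 0), mul_zero]
  · rw [← Real.rpow_add_one h.ne', sub_add_cancel]

lemma rpow_mul_add_rpow_le {p q ε t : ℝ} (hq : 1 < q) (hqp : q ≤ p) (hε : 0 < ε) (ht : 0 ≤ t) :
    t ^ (p - 1) * (ε + t) ^ (1 - q) ≤ t ^ (p - q) := by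
  rcases ht.eq_or_lt with h | h
  · rw [← h, Real.zero_rpow (by linarith), zero_mul]
    positivity
  · calc t ^ (p - 1) * (ε + t) ^ (1 - q) ≤ t ^ (p - 1) * t ^ (1 - q) := by
          refine mul_le_mul_of_nonneg_left ?_ (by positivity)
          exact Real.rpow_le_rpow_of_nonpos h (by linarith) (by linarith)
      _ = t ^ (p - q) := by rw [← Real.rpow_add h]; ring_nf

lemma tendsto_rpow_mul_add_rpow {q t : ℝ} (ht : 0 < t) :
    Tendsto (fun n : ℕ => t ^ (q - 1) * (1 / ((n : ℝ) + 1) + t) ^ (1 - q)) atTop (𝓝 1) := by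
  have h1 : Tendsto (fun n : ℕ => 1 / ((n : ℝ) + 1) + t) atTop (𝓝 t) := by
    simpa using (tendsto_one_div_add_atTop_nhds_zero_nat (𝕜 := ℝ)).add_const t
  have h2 := (h1.rpow_const (p := 1 - q) (Or.inl ht.ne')).const_mul (t ^ (q - 1))
  rw [← Real.rpow_add ht] at h2
  simpa using h2

variable {N : ℕ} {Ω : Set (Eucl N)} {p q lam M : ℝ} {a u U : Eucl N → ℝ}
  {g G : Eucl N → Eucl N} {B : BoundaryCondition} [IsFiniteMeasure (volume.restrict Ω)]

/-- The solution is tested with itself. As a consequence its value of `I` is `(1/p - 1/q)` times the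
constraint integral. -/
lemma InEnergySpace.energyE_eq_weightInt (D : Admissible Ω p q lam a M)
    (hu : InEnergySpace B Ω p u g) (hu0 : NonnegIn Ω u)
    (hsol : ∀ φ k, InEnergySpace B Ω p φ k →
      ∫ x in Ω, ‖g x‖ ^ (p - 2) * inner ℝ (g x) (k x)
        = ∫ x in Ω, (lam * u x ^ (p - 1) + a x * u x ^ (q - 1)) * φ x) :
    energyE Ω p lam u = weightInt Ω q a u := by
  have h := hsol u g hu
  simp_rw [rpow_sub_two_mul_inner_self D.one_lt_p] at h
  have i1 := integrable_abs_rpow D.p_pos le_rfl hu.memLp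
  have i2 := integrable_weight D.q_pos D.lt.le D.aesm D.bound hu.memLp
  rw [hu.toHasSobolevGradient.energyE_eq D.one_lt_p.le D.isOpen, h, weightInt,
    ← integral_const_mul, ← integral_add]
  · refine integral_congr_ae ?_
    filter_upwards [hu0] with x hx
    rw [add_mul, mul_assoc, mul_assoc, rpow_sub_one_mul_self D.one_lt_p hx,
      rpow_sub_one_mul_self D.one_lt hx, abs_of_nonneg hx]
    ring
  · refine ((i1.const_mul lam).add i2).congr ?_
    filter_upwards [hu0] with x hx
    show lam * |u x| ^ p + a x * |u x| ^ q = _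
    rw [add_mul, mul_assoc, mul_assoc, rpow_sub_one_mul_self D.one_lt_p hx,
      rpow_sub_one_mul_self D.one_lt hx, abs_of_nonneg hx]
  · exact i1.const_mul _

lemma integrable_rpow_mul_rpow {α E F : Type*} [MeasurableSpace α] {μ : Measure α}
    [NormedAddCommGroup E] [NormedAddCommGroup F] (hq : 0 < q) (hqp : q < p) {f : α → E} {h : α → F}
    (hf : MemLp f (ENNReal.ofReal p) μ) (hh : MemLp h (ENNReal.ofReal p) μ) :
    Integrable (fun x => ‖f x‖ ^ q * ‖h x‖ ^ (p - q)) μ := by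
  have hp : 0 < p := hq.trans hqp
  refine (((integrable_norm_rpow_real hp hf).const_mul (q / p)).add
    ((integrable_norm_rpow_real hp hh).const_mul ((p - q) / p))).mono'
    ((hf.aestronglyMeasurable.norm.aemeasurable.pow_const _).aestronglyMeasurable.mul
      (hh.aestronglyMeasurable.norm.aemeasurable.pow_const _).aestronglyMeasurable)
    (Eventually.of_forall fun x => ?_)
  rw [Real.norm_of_nonneg (by positivity)]
  exact rpow_mul_rpow_le_young hq hqp (norm_nonneg _) (norm_nonneg _)

/-- The Picone inequality, integrated against a positive solution. -/
lemma InEnergySpace.weightInt_le_of_solution (D : Admissible Ω p q lam a M)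
    (hU : InEnergySpace B Ω p U G) (hU0 : NonnegIn Ω U)
    (hu : InEnergySpace B Ω p u g) (hu0 : NonnegIn Ω u)
    (hsol : ∀ φ k, InEnergySpace B Ω p φ k →
      ∫ x in Ω, ‖g x‖ ^ (p - 2) * inner ℝ (g x) (k x)
        = ∫ x in Ω, (lam * u x ^ (p - 1) + a x * u x ^ (q - 1)) * φ x)
    (hpos : ∀ᵐ x ∂(volume.restrict Ω), 0 < a x → 0 < u x) :
    weightInt Ω q a U ≤ (∫ x in Ω, ‖G x‖ ^ q * ‖g x‖ ^ (p - q))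
      + -lam * ∫ x in Ω, ‖U x‖ ^ q * ‖u x‖ ^ (p - q) := by
  have hp := D.one_lt_p
  have hq := D.one_lt
  have hq0 := D.q_pos
  have hlam := D.lam_neg
  have hexp : ENNReal.ofReal q ≤ ENNReal.ofReal p := ENNReal.ofReal_le_ofReal D.lt.le
  have hk (n : ℕ) : (0 : ℝ) < (n : ℝ) + 1 := by positivity
  have hε (n : ℕ) : (0 : ℝ) < 1 / ((n : ℝ) + 1) := by positivity
  set φ : ℕ → Eucl N → ℝ := fun n x =>
    truncPow ((n : ℝ) + 1) q (U x) * dampedPow (1 / ((n : ℝ) + 1)) q (u x) with hφ_def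
  have hφ (n : ℕ) : InEnergySpace B Ω p (φ n) (fun x =>
      (truncPowDeriv ((n : ℝ) + 1) q (U x) * dampedPow (1 / ((n : ℝ) + 1)) q (u x)) • G x
      + (truncPow ((n : ℝ) + 1) q (U x) * dampedPowDeriv (1 / ((n : ℝ) + 1)) q (u x)) • g x) := by
    obtain ⟨C, hC⟩ := c1Bounded_truncPow_mul_dampedPow hq (hk n) (hε n)
    exact InEnergySpace.comp hp.le D.isOpen hC hU hu
  set T : ℕ → ℝ → ℝ := fun n s => max (((n : ℝ) + 1) * Real.arctan (s / ((n : ℝ) + 1))) 0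
  have hT0 (n : ℕ) (s : ℝ) : 0 ≤ T n s := le_max_right _ _
  have hφe (n : ℕ) (x : Eucl N) (hx : 0 ≤ u x) :
      φ n x = T n (U x) ^ q * (1 / ((n : ℝ) + 1) + u x) ^ (1 - q) := by
    simp only [hφ_def, truncPow, dampedPow_of_nonneg hx]
    rfl
  have i1 (n : ℕ) : Integrable (fun x => u x ^ (p - 1) * φ n x) (volume.restrict Ω) := by
    refine (integrable_rpow_inner hp hu.memLp (hφ n).memLp).congr ?_
    filter_upwards [hu0] with x hx using rpow_sub_two_mul_inner_of_nonneg hp hx _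
  have i2 (n : ℕ) : Integrable (fun x => a x * (u x ^ (q - 1) * φ n x)) (volume.restrict Ω) := by
    refine Integrable.bdd_mul ?_ D.aesm D.bound
    refine (integrable_rpow_inner hq (hu.memLp.mono_exponent hexp)
      ((hφ n).memLp.mono_exponent hexp)).congr ?_
    filter_upwards [hu0] with x hx using rpow_sub_two_mul_inner_of_nonneg hq hx _
  have i3 := integrable_rpow_mul_rpow hq0 D.lt hU.memLp_grad hu.memLp_grad
  have i4 := integrable_rpow_mul_rpow hq0 D.lt hU.memLp hu.memLp
  have i5 := integrable_abs_rpow hq0 D.lt.le hU.memLp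
  have hbound (n : ℕ) : ∫ x in Ω, a x * (u x ^ (q - 1) * φ n x)
      ≤ (∫ x in Ω, ‖G x‖ ^ q * ‖g x‖ ^ (p - q)) + -lam * ∫ x in Ω, ‖U x‖ ^ q * ‖u x‖ ^ (p - q) := by
    have h1 := hsol _ _ (hφ n)
    have e1 : ∫ x in Ω, (lam * u x ^ (p - 1) + a x * u x ^ (q - 1)) * φ n x
        = lam * (∫ x in Ω, u x ^ (p - 1) * φ n x) + ∫ x in Ω, a x * (u x ^ (q - 1) * φ n x) := by
      rw [← integral_const_mul, ← integral_add ((i1 n).const_mul lam) (i2 n)]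
      congr 1; ext x; ring
    rw [e1] at h1
    have h2 := integral_mono_ae (integrable_rpow_inner hp hu.memLp_grad (hφ n).memLp_grad) i3
      (hu0.mono fun x hx => picone_test hq D.lt (hε n) hx (G x) (g x))
    have h3 : ∫ x in Ω, u x ^ (p - 1) * φ n x ≤ ∫ x in Ω, ‖U x‖ ^ q * ‖u x‖ ^ (p - q) := by
      refine integral_mono_ae (i1 n) i4 ?_
      filter_upwards [hu0, hU0] with x hx hUx
      rw [hφe n x hx, Real.norm_of_nonneg hx, Real.norm_of_nonneg hUx]
      have h4 := rpow_mul_add_rpow_le hq D.lt.le (hε n) hx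
      have h5 : T n (U x) ^ q ≤ U x ^ q :=
        Real.rpow_le_rpow (hT0 n _) (max_mul_arctan_le_self (hk n) hUx) hq0.le
      calc u x ^ (p - 1) * (T n (U x) ^ q * (1 / ((n : ℝ) + 1) + u x) ^ (1 - q))
          = T n (U x) ^ q * (u x ^ (p - 1) * (1 / ((n : ℝ) + 1) + u x) ^ (1 - q)) := by ring
        _ ≤ _ := mul_le_mul h5 h4 (by have := hε n; positivity) (by positivity)
    have h6 := mul_le_mul_of_nonneg_left h3 (by linarith : 0 ≤ -lam)
    linarith
  -- Where `u > 0` the factor `u^(q-1) (ε + u)^(1-q)` tends to 1; where `u = 0` it is 0 for every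
  -- `n`. Hence the restriction to `{u > 0}` in the limit.
  have hlim : Tendsto (fun n => ∫ x in Ω, a x * (u x ^ (q - 1) * φ n x)) atTop
      (𝓝 (∫ x in Ω, a x * (if 0 < u x then |U x| ^ q else 0))) := by
    refine tendsto_integral_of_dominated_convergence (fun x => M * |U x| ^ q)
      (fun n => (i2 n).aestronglyMeasurable) (i5.const_mul M) (fun n => ?_) ?_
    · filter_upwards [hu0, hU0, D.bound] with x hx hUx hax
      have h4 := rpow_mul_add_rpow_le hq le_rfl (hε n) hx
      rw [sub_self, Real.rpow_zero] at h4
      have h5 : T n (U x) ^ q ≤ |U x| ^ q := by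
        rw [abs_of_nonneg hUx]
        exact Real.rpow_le_rpow (hT0 n _) (max_mul_arctan_le_self (hk n) hUx) hq0.le
      have h7 := Real.rpow_nonneg (hT0 n (U x)) q
      have h8 : 0 ≤ u x ^ (q - 1) * (1 / ((n : ℝ) + 1) + u x) ^ (1 - q) := by
        have := hε n; positivity
      have e2 : u x ^ (q - 1) * φ n x
          = T n (U x) ^ q * (u x ^ (q - 1) * (1 / ((n : ℝ) + 1) + u x) ^ (1 - q)) := by
        rw [hφe n x hx]; ring
      rw [norm_mul, e2, Real.norm_of_nonneg (mul_nonneg h7 h8)]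
      exact mul_le_mul hax ((mul_le_of_le_one_right h7 h4).trans h5) (mul_nonneg h7 h8)
        ((abs_nonneg _).trans hax)
    · filter_upwards [hu0, hU0] with x hx hUx
      refine Tendsto.const_mul _ ?_
      rcases hx.eq_or_lt with h | h
      · simp [← h, Real.zero_rpow (by linarith : q - 1 ≠ 0)]
      · rw [if_pos h, abs_of_nonneg hUx]
        have h1 := ((tendsto_max_mul_arctan hUx).rpow_const (p := q) (Or.inr hq0.le)).mul
          (tendsto_rpow_mul_add_rpow (q := q) h)
        rw [mul_one] at h1
        refine h1.congr fun n => ?_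
        rw [hφe n x hx]
        ring
  refine le_trans (integral_mono_ae (integrable_weight hq0 D.lt.le D.aesm D.bound hU.memLp) ?_ ?_)
    (le_of_tendsto' hlim hbound)
  · refine Integrable.bdd_mul ?_ D.aesm D.bound
    have hs : NullMeasurableSet {x | 0 < u x} (volume.restrict Ω) :=
      nullMeasurableSet_lt aemeasurable_const hu.memLp.aestronglyMeasurable.aemeasurable
    refine (i5.indicator₀ hs).congr (Eventually.of_forall fun x => ?_)
    simp only [indicator, Set.mem_ofPred_eq]
  -- The limit omits `a |U|^q` on `{u = 0}`, but there `a ≤ 0` by the positivity hypothesis, so the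
  -- omission goes in the right direction.
  · filter_upwards [hu0, hpos] with x hx hax
    split_ifs with h
    · exact le_rfl
    · rw [mul_zero]
      exact mul_nonpos_of_nonpos_of_nonneg (not_lt.1 fun h' => h (hax h')) (by positivity)

/-- Young with weights `q/p` and `(p-q)/p` turns the mixed Picone terms into the same combination of
the two energies, which equal the two constraint integrals. Absorbing the share `q/p < 1` of `U`
leaves the claim. -/
lemma InEnergySpace.weightInt_le_weightInt_of_solution (D : Admissible Ω p q lam a M)
    (hU : InEnergySpace B Ω p U G) (hU0 : NonnegIn Ω U)
    (hUE : energyE Ω p lam U = weightInt Ω q a U)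
    (hu : InEnergySpace B Ω p u g) (hu0 : NonnegIn Ω u)
    (hsol : ∀ φ k, InEnergySpace B Ω p φ k →
      ∫ x in Ω, ‖g x‖ ^ (p - 2) * inner ℝ (g x) (k x)
        = ∫ x in Ω, (lam * u x ^ (p - 1) + a x * u x ^ (q - 1)) * φ x)
    (hpos : ∀ᵐ x ∂(volume.restrict Ω), 0 < a x → 0 < u x) :
    weightInt Ω q a U ≤ weightInt Ω q a u := by
  have hq0 := D.q_pos
  have hp0 := D.p_pos
  have hlam := D.lam_neg
  have hpq := D.lt
  have h1 := hU.weightInt_le_of_solution D hU0 hu hu0 hsol hpos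
  have hEu := hu.energyE_eq_weightInt D hu0 hsol
  have young {E : Type} [NormedAddCommGroup E] {f h : Eucl N → E}
      (hf : MemLp f (ENNReal.ofReal p) (volume.restrict Ω))
      (hh : MemLp h (ENNReal.ofReal p) (volume.restrict Ω)) :
      ∫ x in Ω, ‖f x‖ ^ q * ‖h x‖ ^ (p - q)
        ≤ q / p * (∫ x in Ω, ‖f x‖ ^ p) + (p - q) / p * ∫ x in Ω, ‖h x‖ ^ p := by
    have j1 := (integrable_norm_rpow_real hp0 hf).const_mul (q / p)
    have j2 := (integrable_norm_rpow_real hp0 hh).const_mul ((p - q) / p)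
    rw [← integral_const_mul, ← integral_const_mul, ← integral_add j1 j2]
    exact integral_mono (integrable_rpow_mul_rpow hq0 hpq hf hh) (j1.add j2) fun x =>
      rpow_mul_rpow_le_young hq0 hpq (norm_nonneg _) (norm_nonneg _)
  have h2 := young hU.memLp_grad hu.memLp_grad
  have h3 := mul_le_mul_of_nonneg_left (young hU.memLp hu.memLp) (by linarith : 0 ≤ -lam)
  rw [hU.toHasSobolevGradient.energyE_eq D.one_lt_p.le D.isOpen] at hUE
  rw [hu.toHasSobolevGradient.energyE_eq D.one_lt_p.le D.isOpen] at hEu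
  simp only [Real.norm_eq_abs] at h1 h2 h3
  have h4 : weightInt Ω q a U ≤ q / p * weightInt Ω q a U + (p - q) / p * weightInt Ω q a u := by
    linear_combination h1 + h2 + h3 + (q / p) * hUE + ((p - q) / p) * hEu
  have h5 : (p - q) / p = 1 - q / p := by field_simp
  rw [h5] at h4
  have h6 : q / p < 1 := (div_lt_one hp0).2 hpq
  nlinarith

end Uniqueness

/-! ### Assembly of the theorem -/

lemma exists_admissible {N : ℕ} {Ω : Set (Eucl N)} (hΩo : IsOpen Ω) (hΩb : Bornology.IsBounded Ω)
    {p q lam : ℝ} (hq : 1 < q) (hqp : q < p) (hlam : lam < 0) {a : Eucl N → ℝ}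
    (ha : ContinuousOn a (closure Ω)) : ∃ M, Admissible Ω p q lam a M := by
  obtain ⟨M, hM⟩ := hΩb.isCompact_closure.exists_bound_of_continuousOn ha
  exact ⟨M, hΩo, hq, hqp, hlam,
    (ha.mono subset_closure).aestronglyMeasurable hΩo.measurableSet,
    (ae_restrict_iff' hΩo.measurableSet).2
      (Eventually.of_forall fun x hx => hM x (subset_closure hx))⟩

end SubhomPLap

end

theorem proposition3p1 (N : ℕ) (hN : 1 ≤ N) (B : SubhomPLap.BoundaryCondition)
    (Ω : Set (EuclideanSpace ℝ (Fin N))) (hΩo : IsOpen Ω) (hΩb : Bornology.IsBounded Ω)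
    (hΩc : IsConnected Ω) (p q lam : ℝ) (hq : 1 < q) (hqp : q < p) (hlam : lam < 0)
    (a : EuclideanSpace ℝ (Fin N) → ℝ) (ha : ContinuousOn a (closure Ω))
    (hapos : ∃ x ∈ Ω, 0 < a x) (haneg : ∃ x ∈ Ω, a x < 0) :
    ∃ V U : EuclideanSpace ℝ (Fin N) → ℝ,
      -- `V` is the nonnegative function attaining `m_+`, and it is the only one
      SubhomPLap.IsNonnegMinimizerE B Ω p q lam a V ∧
      (∀ W, SubhomPLap.IsNonnegMinimizerE B Ω p q lam a W → W =ᵐ[volume.restrict Ω] V) ∧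
      -- `U` is the nonnegative minimizer of `I_lam` over `Aplus`, the only one,
      -- and a positive multiple of `V`
      SubhomPLap.IsNonnegMinimizerI B Ω p q lam a U ∧
      (∀ W, SubhomPLap.IsNonnegMinimizerI B Ω p q lam a W → W =ᵐ[volume.restrict Ω] U) ∧
      0 < SubhomPLap.mPlus B Ω p q lam a ∧
      (∀ᵐ x ∂(volume.restrict Ω),
        U x = SubhomPLap.mPlus B Ω p q lam a ^ (-(1 / (p - q))) * V x) ∧
      -- `U` is a solution that is positive where `a > 0`: almost everywhere there, and at every
      -- point for the continuous representative
      SubhomPLap.IsSolution B Ω p q lam a U ∧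
      (∀ᵐ x ∂(volume.restrict (SubhomPLap.posSet Ω a)), 0 < U x) ∧
      (∀ w : EuclideanSpace ℝ (Fin N) → ℝ, ContinuousOn w (SubhomPLap.posSet Ω a) →
        w =ᵐ[volume.restrict (SubhomPLap.posSet Ω a)] U →
        ∀ x ∈ SubhomPLap.posSet Ω a, 0 < w x) ∧
      -- and it is the only solution that is positive a.e. where `a > 0`
      (∀ u, SubhomPLap.IsSolution B Ω p q lam a u →
        (∀ᵐ x ∂(volume.restrict (SubhomPLap.posSet Ω a)), 0 < u x) →
        u =ᵐ[volume.restrict Ω] U) := by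
  open SubhomPLap Filter Topology in
  have : IsFiniteMeasure (volume.restrict Ω) := ⟨by
    rw [Measure.restrict_apply_univ]; exact hΩb.measure_lt_top⟩
  obtain ⟨M, D⟩ := exists_admissible hΩo hΩb hq hqp hlam ha
  have hp := D.one_lt_p.le
  have hac : ContinuousOn a Ω := ha.mono subset_closure
  have hposo := isOpen_posSet hΩo hac
  obtain ⟨x₀, hx₀, hax₀⟩ := hapos
  obtain ⟨V, G, hV, hV0, hV1, hVE⟩ := exists_minimizer (B := B) D
    (splus_nonempty D (hposo.mem_nhds (⟨hx₀, hax₀⟩ : x₀ ∈ posSet Ω a)))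
  have hm := mPlus_pos D hV hV1 hVE
  set m := mPlus B Ω p q lam a with hm_def
  set U : Eucl N → ℝ := fun x => m ^ (-(1 / (p - q))) * V x with hU_def
  have hU : InEnergySpace B Ω p U (fun x => m ^ (-(1 / (p - q))) • G x) := hV.const_mul _
  have hU0 : NonnegIn Ω U := hV0.mono fun x hx => mul_nonneg (by positivity) hx
  have hUA : weightInt Ω q a U = m ^ (-(q / (p - q))) := weightInt_rescaled hm hV1
  have hUE : energyE Ω p lam U = weightInt Ω q a U :=
    (hV.energyE_rescaled D hm hVE).trans hUA.symm
  have hUI : energyI Ω p q lam a U = m ^ (-(q / (p - q))) * (1 / p - 1 / q) :=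
    hV.energyI_rescaled D hm hV1 hVE
  have hUpos : 0 < weightInt Ω q a U := by rw [hUA]; positivity
  have hmin : ∀ w H, InEnergySpace B Ω p w H → 0 < weightInt Ω q a w →
      energyI Ω p q lam a U ≤ energyI Ω p q lam a w := fun w H hw hA => by
    rw [hUI]; exact hw.le_energyI D hm hA
  have hlower : ∀ x ∈ posSet Ω a, ∃ v : Eucl N → ℝ, Continuous v ∧ 0 < v x ∧
      ∀ᵐ y ∂(volume.restrict Ω), v y ≤ U y := fun x hx =>
    hU.exists_continuous_lower_bound_of_mem D hac hx hU0 hUpos hmin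
  have huniq : ∀ W H, InEnergySpace B Ω p W H → NonnegIn Ω W → 0 < weightInt Ω q a W →
      energyI Ω p q lam a W ≤ energyI Ω p q lam a U → W =ᵐ[volume.restrict Ω] U :=
    fun W H hW hW0 hA hI => hV.ae_eq_rescaled D hm hV0 hV1 hVE hW hW0 hA (hI.trans_eq hUI)
  refine ⟨V, U, ⟨hV0, ⟨hV.mem_energySpace hp hΩo, hV1⟩, fun w hw => ?_⟩, fun W hW => ?_,
    ⟨hU0, ⟨hU.mem_energySpace hp hΩo, hUpos⟩, fun w hw => ?_⟩, fun W hW => ?_, hm,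
    Eventually.of_forall fun x => rfl,
    (hU.isSolution_iff D).2 ⟨hU0, fun φ k hφ => hU.eulerLagrange D hU0 hUpos hmin hφ⟩,
    ae_pos_of_continuous_lower_bounds hΩo hac hlower,
    fun w hw hwU x hx => pos_of_continuous_lower_bounds hΩo hac hlower hw hwU hx,
    fun u hu hupos => ?_⟩
  · have h := inEnergySpace_weakGrad hp hΩo hw.1
    exact hVE.trans_le (h.mPlus_le D hw.2)
  · have h := inEnergySpace_weakGrad hp hΩo hW.2.1.1
    refine h.ae_eq_of_minimizers D hV hW.1 hV0 hW.2.1.2 hV1 ?_ hVE.le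
    exact (hW.2.2 ⟨hV.mem_energySpace hp hΩo, hV1⟩).trans_eq hVE
  · exact hmin w _ (inEnergySpace_weakGrad hp hΩo hw.1) hw.2
  · exact huniq W _ (inEnergySpace_weakGrad hp hΩo hW.2.1.1) hW.1 hW.2.1.2
      (hW.2.2 ⟨hU.mem_energySpace hp hΩo, hUpos⟩)
  · have hu' := inEnergySpace_weakGrad hp hΩo hu.1
    obtain ⟨hu0, hsol⟩ := (hu'.isSolution_iff D).1 hu
    have hpos : ∀ᵐ x ∂(volume.restrict Ω), 0 < a x → 0 < u x := by
      rw [ae_restrict_iff' hposo.measurableSet] at hupos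
      rw [ae_restrict_iff' hΩo.measurableSet]
      filter_upwards [hupos] with x hx hxΩ hxa using hx ⟨hxΩ, hxa⟩
    have hle := hU.weightInt_le_weightInt_of_solution D hU0 hUE hu' hu0 hsol hpos
    have hEu := hu'.energyE_eq_weightInt D hu0 hsol
    -- Both `u` and `U` have `I`-value `(1/p - 1/q)` times their constraint integral. The factor is
    -- nonpositive, so the larger integral of `u` makes it a minimizer as well.
    refine huniq u _ hu' hu0 (hUpos.trans_le hle) ?_
    rw [hu'.energyI_eq' D, hU.energyI_eq' D, hEu, hUE]
    have h1 : 1 / p - 1 / q ≤ 0 := by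
      rw [sub_nonpos]; exact one_div_le_one_div_of_le D.q_pos hqp.le
    have h2 := mul_le_mul_of_nonpos_right hle h1
    linear_combination h2
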